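/- Let $d\ge 1$ and let $\Omega\subset\mathbb R^d$ be a bounded polytopic domain (connected, open, the interior of the union of the simplices of a finite conforming initial mesh $\mathcal T_0$). Let $A:\Omega\to\mathbb R^{d\times d}$ be symmetric, uniformly positive definite and Lipschitz on the interior of each element of $\mathcal T_0$, let $0\le c\in L^\infty(\Omega)$, and put $a(u,v)=\int_\Omega (A\nabla u\cdot\nabla v+cuv)$, $b(u,v)=\int_\Omega uv$, $\|u\|_b=b(u,u)^{1/2}$. Let $\lambda$ be an eigenvalue of multiplicity $q$ of: $u\in H^1_0(\Omega)$, $a(u,v)=\lambda b(u,v)$ for all $v\in H_0^1(\Omega)$; let $M(\lambda)$ be its eigenspace and let $k_0$ be the number of eigenvalues smaller than $\lambda$, counted with multiplicity. Let $\Gamma$ be a circle with centre $\lambda^{-1}$ such that no $\mu^{-1}$, with $\mu\ne\lambda$ an eigenvalue, lies on or inside $\Gamma$. Fix a polynomial degree $k\ge 1$, degrees $m,m'\ge 0$ and a shape regularity constant $\gamma^*$. For a conforming simplicial mesh $\mathcal T_h$ of $\Omega$ that refines $\mathcal T_0$ and satisfies $h_T/\rho_T\le\gamma^*$ for all $T\in\mathcal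 T_h$ ($h_T$ the diameter of $T$, $\rho_T$ the diameter of the biggest ball in $T$, $h=\max_T h_T$), let $V_h\subset H_0^1(\Omega)$ be the space of continuous functions that are polynomials of degree at most $k$ on each $T\in\mathcal T_h$. Let $\lambda_{1,h}\le\dots\le\lambda_{n_h,h}$, $n_h=\dim V_h$, with $b$-orthonormal eigenfunctions $u_{1,h},\dots,u_{n_h,h}$ be the eigenpairs of $a(u_h,v)=\lambda_h b(u_h,v)$ for all $v\in V_h$. Write $\lambda_{h,l}=\lambda_{k_0+l,h}$, $u_{h,l}=u_{k_0+l,h}$ $(1\le l\le q)$, $U_h=(u_{h,1},\dots,u_{h,q})$ and $M_h(\lambda)=\mathrm{span}\{u_{h,1},\dots,u_{h,q}\}$. Let $K_h:L^2(\Omega)\to V_h$ be given by $a(K_hw,v)=b(w,v)$ for all $v\in V_h$, and let $E_h=\frac1{2\pi i}\int_\Gamma(z-K_h)^{-1}dz$. For $V=\sum_{j=1}^q\alpha_ju_{h,j}\in M_h(\lambda)$, where $\alpha_j=b(V,u_{h,j})$, define the element residual on $T\in\mathcal T_h$ and the jump residual on an interior face $E=T^+\cap T^-$ (with outward unit normals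 $\nu^\pm$) by $$\mathcal R_T(V)=\sum_{j=1}^q\alpha_j\lambda_{h,j}u_{h,j}+\nabla\cdot(A\nabla V)-cV,\qquad J_E(V)=-(A\nabla V)^+\cdot\nu^+-(A\nabla V)^-\cdot\nu^-,$$ and set $$\eta_h^2(V,T)=h_T^2\|\mathcal R_T(V)\|_{0,T}^2+\sum_{E\subset\partial T}h_E\|J_E(V)\|_{0,E}^2,$$ $$osc_h^2(V,T)=h_T^2\|\mathcal R_T(V)-\overline{\mathcal R_T(V)}\|_{0,T}^2+\sum_{E\subset\partial T}h_E\|J_E(V)-\overline{J_E(V)}\|_{0,E}^2,$$ where $E$ runs over the interior faces, $h_E$ is the diameter of $E$, and the bars denote the $L^2$-projections onto polynomials of degree at most $m$ on $T$ and at most $m'$ on $E$. For a tuple $W=(w_1,\dots,w_q)$ put $\eta_h^2(W,T)=\sum_l\eta_h^2(w_l,T)$ and $osc_h^2(W,T)=\sum_l osc_h^2(w_l,T)$. Then there are $h_0>0$ and $C>0$, depending on the data above but not on the mesh, such that for every such mesh with $h<h_0$ and every choice of the discrete eigenpairs one has $k_0+q\le n_h$ and, for every $b$-orthonormal basis $u_1,\dots,u_q$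 of $M(\lambda)$, with $E_hU=(E_hu_1,\dots,E_hu_q)$, and for every $T\in\mathcal T_h$, $$\eta_h^2(U_h,T)\le C\,\eta_h^2(E_hU,T),\qquad \eta_h^2(E_hU,T)\le C\,\eta_h^2(U_h,T),$$ $$osc_h^2(U_h,T)\le C\,osc_h^2(E_hU,T),\qquad osc_h^2(E_hU,T)\le C\,osc_h^2(U_h,T).$$ -/

import Mathlib

open MeasureTheory Set Filter Topology
open scoped ContDiff

noncomputable section

namespace EigenFEM

/-- Euclidean `d`-space. -/
abbrev Sp (d : ℕ) := EuclideanSpace ℝ (Fin d)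

/-- `L²(Ω)` (real valued). -/
abbrev L2 {d : ℕ} (Ω : Set (Sp d)) := Lp ℝ 2 (volume.restrict Ω)

/-- `L²(Ω; ℂ)`, the complexification of `L²(Ω)`, on which resolvents are taken. -/
abbrev L2C {d : ℕ} (Ω : Set (Sp d)) := Lp ℂ 2 (volume.restrict Ω)

/-- `L²(Ω) × L²(Ω)^d`: pairs (function, weak gradient). -/
abbrev L2Pair {d : ℕ} (Ω : Set (Sp d)) := L2 Ω × Lp (Sp d) 2 (volume.restrict Ω)

/-! ### The Sobolev space `H¹₀(Ω)` -/

/-- The pairs `(φ, ∇φ)` with `φ ∈ C_c^∞(Ω)`. -/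
def testPairs {d : ℕ} (Ω : Set (Sp d)) : Set (L2Pair Ω) :=
  {p | ∃ φ : Sp d → ℝ, ContDiff ℝ ∞ φ ∧ HasCompactSupport φ ∧ tsupport φ ⊆ Ω ∧
    (p.1 =ᵐ[volume.restrict Ω] φ) ∧ (p.2 =ᵐ[volume.restrict Ω] gradient φ)}

/-- `H¹₀(Ω)`, the closure of `C_c^∞(Ω)` in the `H¹` norm. An element is stored as the pair
`(w, ∇w)` of the function and its weak gradient. -/
def H10 {d : ℕ} (Ω : Set (Sp d)) : Submodule ℝ (L2Pair Ω) :=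
  (Submodule.span ℝ (testPairs Ω)).topologicalClosure

/-! ### Simplicial meshes -/

/-- The elements (`d`-dimensional closed simplices) of a mesh, given by their vertex sets. -/
def elements {d : ℕ} (K : Geometry.SimplicialComplex ℝ (Sp d)) : Set (Finset (Sp d)) :=
  {t | t ∈ K.faces ∧ t.card = d + 1}

/-- The closed simplex with vertex set `t`. -/
abbrev simplex {d : ℕ} (t : Finset (Sp d)) : Set (Sp d) := convexHull ℝ (t : Set (Sp d))

/-- A (finite) conforming simplicial mesh of `Ω`. That two elements meet in a common face or not at
all is part of the notion of a simplicial complex. -/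
structure IsConformingMesh {d : ℕ} (Ω : Set (Sp d)) (K : Geometry.SimplicialComplex ℝ (Sp d)) :
    Prop where
  finite : K.faces.Finite
  pure : ∀ s ∈ K.faces, ∃ t ∈ elements K, s ⊆ t
  space_eq : K.space = closure Ω

/-- A polytopic bounded domain: a connected nonempty open set that is the interior of a finite
conforming union of simplices, namely of those of the mesh `K₀`. -/
structure IsPolytopicDomain {d : ℕ} (Ω : Set (Sp d)) (K₀ : Geometry.SimplicialComplex ℝ (Sp d)) :
    Prop where
  isOpen : IsOpen Ω
  isConnected : IsConnected Ω
  interior_closure : interior (closure Ω) = Ω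
  mesh : IsConformingMesh Ω K₀

/-- `K` is a refinement of `K₀`. -/
def IsRefinement {d : ℕ} (K K₀ : Geometry.SimplicialComplex ℝ (Sp d)) : Prop :=
  ∀ t ∈ elements K, ∃ t₀ ∈ elements K₀, simplex t ⊆ simplex t₀

/-- The diameter `h_T` (or `h_E`) of an element or a face. -/
def diamS {d : ℕ} (t : Finset (Sp d)) : ℝ := Metric.diam (simplex t)

/-- `ρ_T`: the diameter of the biggest ball contained in `T`. -/
def inDiam {d : ℕ} (t : Finset (Sp d)) : ℝ :=
  2 * sSup {ρ : ℝ | 0 ≤ ρ ∧ ∃ x, Metric.closedBall x ρ ⊆ simplex t}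

/-- Shape regularity with constant `γ`: `h_T / ρ_T ≤ γ` for all elements. -/
def IsShapeRegular {d : ℕ} (γ : ℝ) (K : Geometry.SimplicialComplex ℝ (Sp d)) : Prop :=
  ∀ t ∈ elements K, diamS t / inDiam t ≤ γ

/-- The mesh size `h = max h_T`. -/
def meshSize {d : ℕ} (K : Geometry.SimplicialComplex ℝ (Sp d)) : ℝ :=
  sSup (diamS '' elements K)

/-- `e` is an interior face of the mesh: a `(d-1)`-simplex shared by two elements. -/
def IsInteriorFace {d : ℕ} (K : Geometry.SimplicialComplex ℝ (Sp d)) (e : Finset (Sp d)) : Prop :=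
  e.card = d ∧ e ∈ K.faces ∧ ∃ t ∈ elements K, ∃ t' ∈ elements K, t ≠ t' ∧ e ⊆ t ∧ e ⊆ t'

/-- The barycenter of a simplex. -/
def bary {d : ℕ} (t : Finset (Sp d)) : Sp d := (t.card : ℝ)⁻¹ • ∑ x ∈ t, x

/-- The unit normal of the face `e` of the element `t` that points out of `t`: the component of
`bary t - bary e` orthogonal to the face points into `t`; normalize it and change the sign. -/
def outerNormal {d : ℕ} (t e : Finset (Sp d)) : Sp d :=
  let w : Sp d := (vectorSpan ℝ (e : Set (Sp d)))ᗮ.starProjection (bary t - bary e);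
  (-‖w‖⁻¹) • w

/-! ### Coefficients and bilinear forms -/

/-- `A` is piecewise Lipschitz over the initial mesh, symmetric, uniformly positive definite;
`0 ≤ c ∈ L^∞(Ω)`. -/
structure IsAdmissible {d : ℕ} (Ω : Set (Sp d)) (K₀ : Geometry.SimplicialComplex ℝ (Sp d))
    (A : Sp d → Matrix (Fin d) (Fin d) ℝ) (c : Sp d → ℝ) : Prop where
  lipschitz : ∀ t ∈ elements K₀, ∀ i j, ∃ C : NNReal,
    LipschitzOnWith C (fun x => A x i j) (interior (simplex t))
  symm : ∀ᵐ x ∂(volume.restrict Ω), (A x).IsSymm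
  elliptic : ∃ a₀ : ℝ, 0 < a₀ ∧ ∀ᵐ x ∂(volume.restrict Ω), ∀ ξ : Sp d,
    a₀ * ‖ξ‖ ^ 2 ≤ inner ℝ (Matrix.toEuclideanCLM (n := Fin d) (𝕜 := ℝ) (A x) ξ) ξ
  c_memLp : MemLp c ⊤ (volume.restrict Ω)
  c_nonneg : ∀ᵐ x ∂(volume.restrict Ω), 0 ≤ c x

/-- `(A ∇u, ∇v) + (c u, v)` for functions `u`, `v` with gradients `gu`, `gv`. -/
def energy {d : ℕ} (Ω : Set (Sp d)) (A : Sp d → Matrix (Fin d) (Fin d) ℝ) (c : Sp d → ℝ)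
    (u : Sp d → ℝ) (gu : Sp d → Sp d) (v : Sp d → ℝ) (gv : Sp d → Sp d) : ℝ :=
  ∫ x in Ω, (inner ℝ (Matrix.toEuclideanCLM (n := Fin d) (𝕜 := ℝ) (A x) (gu x)) (gv x)
    + c x * u x * v x)

/-- `b(u, v) = (u, v)`, the `L²(Ω)` inner product. -/
def bForm {d : ℕ} (Ω : Set (Sp d)) (u v : Sp d → ℝ) : ℝ := ∫ x in Ω, u x * v x

/-- `a(w, v)` on `H¹₀(Ω)`. -/
def aForm {d : ℕ} (Ω : Set (Sp d)) (A : Sp d → Matrix (Fin d) (Fin d) ℝ) (c : Sp d → ℝ)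
    (w v : L2Pair Ω) : ℝ :=
  energy Ω A c w.1 w.2 v.1 v.2

/-- `a(w, v)` for finite element functions, whose weak gradient is the piecewise gradient. -/
def aFormFE {d : ℕ} (Ω : Set (Sp d)) (A : Sp d → Matrix (Fin d) (Fin d) ℝ) (c : Sp d → ℝ)
    (w v : Sp d → ℝ) : ℝ :=
  energy Ω A c w (gradient w) v (gradient v)

/-! ### The continuous eigenvalue problem -/

/-- `M(μ)`: the solutions `w ∈ H¹₀(Ω)` of `a(w, v) = μ b(w, v)` for all `v ∈ H¹₀(Ω)`. -/
def eigenspace {d : ℕ} (Ω : Set (Sp d)) (A : Sp d → Matrix (Fin d) (Fin d) ℝ) (c : Sp d → ℝ)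
    (μ : ℝ) : Set (L2Pair Ω) :=
  {w | w ∈ H10 Ω ∧ ∀ v ∈ H10 Ω, aForm Ω A c w v = μ * bForm Ω w.1 v.1}

/-- `μ` is an eigenvalue. -/
def IsEigenvalue {d : ℕ} (Ω : Set (Sp d)) (A : Sp d → Matrix (Fin d) (Fin d) ℝ) (c : Sp d → ℝ)
    (μ : ℝ) : Prop :=
  ∃ w ∈ eigenspace Ω A c μ, w ≠ 0

/-- The multiplicity `q` of `μ`. -/
def multiplicity {d : ℕ} (Ω : Set (Sp d)) (A : Sp d → Matrix (Fin d) (Fin d) ℝ) (c : Sp d → ℝ)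
    (μ : ℝ) : ℕ :=
  (eigenspace Ω A c μ).finrank ℝ

/-- `k₀`: the number of eigenvalues below `μ`, counted with multiplicity. -/
def numBelow {d : ℕ} (Ω : Set (Sp d)) (A : Sp d → Matrix (Fin d) (Fin d) ℝ) (c : Sp d → ℝ)
    (μ : ℝ) : ℕ :=
  {w : L2Pair Ω | ∃ μ' < μ, w ∈ eigenspace Ω A c μ'}.finrank ℝ

/-- `u` is a `b`-orthonormal basis of `M(μ)`. -/
structure IsOrthonormalBasisOf {d : ℕ} (Ω : Set (Sp d)) (A : Sp d → Matrix (Fin d) (Fin d) ℝ)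
    (c : Sp d → ℝ) (μ : ℝ) {q : ℕ} (u : Fin q → L2Pair Ω) : Prop where
  mem : ∀ l, u l ∈ eigenspace Ω A c μ
  orthonormal : ∀ i j, bForm Ω (u i).1 (u j).1 = if i = j then 1 else 0
  span : eigenspace Ω A c μ ⊆ Submodule.span ℝ (Set.range u)

/-! ### The finite element space and the discrete eigenvalue problem -/

/-- `v` is a polynomial function of total degree at most `k`. -/
def IsPoly {d : ℕ} (k : ℕ) (v : Sp d → ℝ) : Prop :=
  ∃ p : MvPolynomial (Fin d) ℝ, p.totalDegree ≤ k ∧ ∀ x, v x = MvPolynomial.eval (fun i => x i) p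

lemma IsPoly.add {d k : ℕ} {v w : Sp d → ℝ} (hv : IsPoly k v) (hw : IsPoly k w) :
    IsPoly k (v + w) := by
  obtain ⟨p, hp, hpv⟩ := hv
  obtain ⟨r, hr, hrw⟩ := hw
  exact ⟨p + r, (MvPolynomial.totalDegree_add p r).trans (max_le hp hr),
    fun x => by simp [hpv, hrw]⟩

lemma IsPoly.smul {d k : ℕ} {v : Sp d → ℝ} (a : ℝ) (hv : IsPoly k v) : IsPoly k (a • v) := by
  obtain ⟨p, hp, hpv⟩ := hv
  exact ⟨a • p, (MvPolynomial.totalDegree_smul_le a p).trans hp,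
    fun x => by simp [hpv]⟩

/-- `V_h = S₀^{h,k}(Ω) = S^{h,k}(Ω) ∩ H¹₀(Ω)`: continuous functions on the closure of `Ω`,
polynomial of degree at most `k` on each element, that belong to `H¹₀(Ω)`. Functions on the closure
of `Ω` are represented by their extension by zero. -/
def femSpace {d : ℕ} (Ω : Set (Sp d)) (K : Geometry.SimplicialComplex ℝ (Sp d)) (k : ℕ) :
    Submodule ℝ (Sp d → ℝ) where
  carrier := {v | ContinuousOn v (closure Ω) ∧ (∀ x ∉ closure Ω, v x = 0) ∧
    (∀ t ∈ elements K, ∃ p, IsPoly k p ∧ EqOn v p (simplex t)) ∧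
    ∃ w ∈ H10 Ω, w.1 =ᵐ[volume.restrict Ω] v}
  zero_mem' := ⟨continuousOn_const, fun _ _ => rfl,
    fun _ _ => ⟨0, ⟨0, by simp, fun x => by simp⟩, fun _ _ => rfl⟩,
    0, Submodule.zero_mem _, Lp.coeFn_zero ℝ 2 _⟩
  add_mem' := by
    rintro v v' ⟨h1, h2, h3, w, hw, h4⟩ ⟨h1', h2', h3', w', hw', h4'⟩
    refine ⟨h1.add h1', fun x hx => by simp [h2 x hx, h2' x hx], fun t ht => ?_, w + w',
      Submodule.add_mem _ hw hw', (Lp.coeFn_add w.1 w'.1).trans (h4.add h4')⟩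
    obtain ⟨p, hp, hpv⟩ := h3 t ht
    obtain ⟨p', hp', hpv'⟩ := h3' t ht
    exact ⟨p + p', hp.add hp', fun x hx => by simp [hpv hx, hpv' hx]⟩
  smul_mem' := by
    rintro a v ⟨h1, h2, h3, w, hw, h4⟩
    refine ⟨h1.const_smul a, fun x hx => by simp [h2 x hx], fun t ht => ?_, a • w,
      Submodule.smul_mem _ a hw, (Lp.coeFn_smul a w.1).trans (h4.const_smul a)⟩
    obtain ⟨p, hp, hpv⟩ := h3 t ht
    exact ⟨a • p, hp.smul a, fun x hx => by simp [hpv hx]⟩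

/-- `(Λ i, φ i)`, `i < n = dim V_h`, is the complete list of discrete eigenpairs, ordered by
increasing eigenvalue, with `b`-orthonormal eigenfunctions. -/
structure IsDiscreteEigenbasis {d : ℕ} (Ω : Set (Sp d)) (A : Sp d → Matrix (Fin d) (Fin d) ℝ)
    (c : Sp d → ℝ) (K : Geometry.SimplicialComplex ℝ (Sp d)) (k : ℕ) {n : ℕ}
    (Λ : Fin n → ℝ) (φ : Fin n → Sp d → ℝ) : Prop where
  mono : Monotone Λ
  span : Submodule.span ℝ (Set.range φ) = femSpace Ω K k
  orthonormal : ∀ i j, bForm Ω (φ i) (φ j) = if i = j then 1 else 0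
  eigen : ∀ i, ∀ v ∈ femSpace Ω K k, aFormFE Ω A c (φ i) v = Λ i * bForm Ω (φ i) v

/-! ### The discrete solution operator and its spectral projection -/

/-- `T` is the discrete solution operator on `L²(Ω; ℂ)`: it maps `f` to the function `p + i s` with
`p, s ∈ V_h`, `a(p, v) = b(Re f, v)` and `a(s, v) = b(Im f, v)` for all `v ∈ V_h`. -/
def IsDiscreteSolutionOperator {d : ℕ} (Ω : Set (Sp d)) (A : Sp d → Matrix (Fin d) (Fin d) ℝ)
    (c : Sp d → ℝ) (K : Geometry.SimplicialComplex ℝ (Sp d)) (k : ℕ)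
    (T : L2C Ω →L[ℂ] L2C Ω) : Prop :=
  ∀ f : L2C Ω, ∃ p ∈ femSpace Ω K k, ∃ s ∈ femSpace Ω K k,
    (T f =ᵐ[volume.restrict Ω] fun x => (p x : ℂ) + (s x : ℂ) * Complex.I) ∧
    ∀ v ∈ femSpace Ω K k, aFormFE Ω A c p v = bForm Ω (fun x => (f x).re) v ∧
      aFormFE Ω A c s v = bForm Ω (fun x => (f x).im) v

/-- `K_h`, complexified: the (unique) discrete solution operator. -/
def discreteSolutionOperator {d : ℕ} (Ω : Set (Sp d)) (A : Sp d → Matrix (Fin d) (Fin d) ℝ)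
    (c : Sp d → ℝ) (K : Geometry.SimplicialComplex ℝ (Sp d)) (k : ℕ) : L2C Ω →L[ℂ] L2C Ω :=
  Classical.epsilon (IsDiscreteSolutionOperator Ω A c K k)

/-- The spectral projection `(2πi)⁻¹ ∮_Γ (z - K_h)⁻¹ dz`, where `Γ` is the circle with center `μ`
and radius `r`. -/
def spectralProjection {d : ℕ} (Ω : Set (Sp d)) (A : Sp d → Matrix (Fin d) (Fin d) ℝ)
    (c : Sp d → ℝ) (K : Geometry.SimplicialComplex ℝ (Sp d)) (k : ℕ) (μ r : ℝ) :
    L2C Ω →L[ℂ] L2C Ω :=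
  (2 * Real.pi * Complex.I : ℂ)⁻¹ •
    ∮ z in C((μ : ℂ), r), resolvent (discreteSolutionOperator Ω A c K k) z

/-- `E_h w` for real `w ∈ L²(Ω)`, as an element of `V_h`. -/
def projE {d : ℕ} (Ω : Set (Sp d)) (A : Sp d → Matrix (Fin d) (Fin d) ℝ)
    (c : Sp d → ℝ) (K : Geometry.SimplicialComplex ℝ (Sp d)) (k : ℕ) (μ r : ℝ) (w : L2 Ω) :
    Sp d → ℝ :=
  Classical.epsilon fun v => v ∈ femSpace Ω K k ∧
    (spectralProjection Ω A c K k μ r (Complex.ofRealCLM.compLp w)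
      =ᵐ[volume.restrict Ω] fun x => (v x : ℂ))

/-! ### Residuals, estimators and oscillations -/

/-- The flux `A ∇v`. -/
def flux {d : ℕ} (A : Sp d → Matrix (Fin d) (Fin d) ℝ) (v : Sp d → ℝ) (x : Sp d) : Sp d :=
  Matrix.toEuclideanCLM (n := Fin d) (𝕜 := ℝ) (A x) (gradient v x)

/-- The divergence of a vector field. -/
def divergence {d : ℕ} (F : Sp d → Sp d) (x : Sp d) : ℝ :=
  ∑ i, (fderiv ℝ F x (EuclideanSpace.single i 1)) i

/-- The right-hand side `∑ⱼ αⱼ λ_{h,j} u_{h,j}`, `αⱼ = b(V, u_{h,j})`, that belongs to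
`V = ∑ⱼ αⱼ u_{h,j}` in the discrete eigenspace with eigenpairs `(Λ j, U j)`. -/
def source {d : ℕ} (Ω : Set (Sp d)) {q : ℕ} (Λ : Fin q → ℝ) (U : Fin q → Sp d → ℝ)
    (V : Sp d → ℝ) (x : Sp d) : ℝ :=
  ∑ j, bForm Ω V (U j) * Λ j * U j x

/-- The element residual `∑ⱼ αⱼ λ_{h,j} u_{h,j} + ∇ · (A ∇V) - c V`. -/
def elementResidual {d : ℕ} (Ω : Set (Sp d)) (A : Sp d → Matrix (Fin d) (Fin d) ℝ)
    (c : Sp d → ℝ) {q : ℕ} (Λ : Fin q → ℝ) (U : Fin q → Sp d → ℝ)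
    (V : Sp d → ℝ) (x : Sp d) : ℝ :=
  source Ω Λ U V x + divergence (flux A V) x - c x * V x

/-- The jump residual `-(A ∇V)⁺ · ν⁺ - (A ∇V)⁻ · ν⁻` on an interior face `e`; the sum is over the
two elements that share `e`, and `(A ∇V)^±` is the trace from inside the element. -/
def jumpResidual {d : ℕ} (A : Sp d → Matrix (Fin d) (Fin d) ℝ)
    (K : Geometry.SimplicialComplex ℝ (Sp d)) (e : Finset (Sp d)) (V : Sp d → ℝ) (x : Sp d) : ℝ :=
  ∑ᶠ t ∈ {t | t ∈ elements K ∧ e ⊆ t},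
    -inner ℝ (extendFrom (interior (simplex t)) (flux A V) x) (outerNormal t e)

/-- `g` is the `L²(ν)` projection of `f` onto polynomials of degree at most `m`. -/
def IsL2Proj {d : ℕ} (ν : Measure (Sp d)) (m : ℕ) (f g : Sp d → ℝ) : Prop :=
  IsPoly m g ∧ ∀ p, IsPoly m p → ∫ x, (f x - g x) * p x ∂ν = 0

/-- The `L²(ν)` projection of `f` onto polynomials of degree at most `m`. -/
def l2Proj {d : ℕ} (ν : Measure (Sp d)) (m : ℕ) (f : Sp d → ℝ) : Sp d → ℝ :=
  Classical.epsilon (IsL2Proj ν m f)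

/-- Lebesgue measure on an element. -/
def elementMeasure {d : ℕ} (t : Finset (Sp d)) : Measure (Sp d) := volume.restrict (simplex t)

/-- Surface measure on a face. -/
def faceMeasure {d : ℕ} (e : Finset (Sp d)) : Measure (Sp d) := (μHE[d - 1]).restrict (simplex e)

open scoped Classical in
/-- The interior faces `E ∈ 𝓔_h`, `E ⊂ ∂T`. -/
def interiorFaces {d : ℕ} (K : Geometry.SimplicialComplex ℝ (Sp d)) (t : Finset (Sp d)) :
    Finset (Finset (Sp d)) :=
  t.powerset.filter (IsInteriorFace K)

/-- `η_h²(V, T)` for `V` in the discrete eigenspace. -/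
def etaSq {d : ℕ} (Ω : Set (Sp d)) (A : Sp d → Matrix (Fin d) (Fin d) ℝ) (c : Sp d → ℝ)
    (K : Geometry.SimplicialComplex ℝ (Sp d)) {q : ℕ} (Λ : Fin q → ℝ) (U : Fin q → Sp d → ℝ)
    (V : Sp d → ℝ) (t : Finset (Sp d)) : ℝ :=
  diamS t ^ 2 * ∫ x, elementResidual Ω A c Λ U V x ^ 2 ∂(elementMeasure t)
    + ∑ e ∈ interiorFaces K t, diamS e * ∫ x, jumpResidual A K e V x ^ 2 ∂(faceMeasure e)

/-- `osc_h²(V, T)` for `V` in the discrete eigenspace; residuals are projected onto polynomials of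
degree at most `m` on elements and at most `m'` on faces. -/
def oscSq {d : ℕ} (Ω : Set (Sp d)) (A : Sp d → Matrix (Fin d) (Fin d) ℝ) (c : Sp d → ℝ)
    (K : Geometry.SimplicialComplex ℝ (Sp d)) (m m' : ℕ) {q : ℕ} (Λ : Fin q → ℝ)
    (U : Fin q → Sp d → ℝ) (V : Sp d → ℝ) (t : Finset (Sp d)) : ℝ :=
  diamS t ^ 2 * ∫ x, (elementResidual Ω A c Λ U V x
      - l2Proj (elementMeasure t) m (elementResidual Ω A c Λ U V) x) ^ 2 ∂(elementMeasure t)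
    + ∑ e ∈ interiorFaces K t, diamS e * ∫ x, (jumpResidual A K e V x
      - l2Proj (faceMeasure e) m' (jumpResidual A K e V) x) ^ 2 ∂(faceMeasure e)

/-- `η_h²(W, T) = ∑_l η_h²(w_l, T)` for a tuple `W` of elements of the discrete eigenspace. -/
def etaSqTuple {d : ℕ} (Ω : Set (Sp d)) (A : Sp d → Matrix (Fin d) (Fin d) ℝ) (c : Sp d → ℝ)
    (K : Geometry.SimplicialComplex ℝ (Sp d)) {q : ℕ} (Λ : Fin q → ℝ) (U : Fin q → Sp d → ℝ)
    (W : Fin q → Sp d → ℝ) (t : Finset (Sp d)) : ℝ :=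
  ∑ l, etaSq Ω A c K Λ U (W l) t

/-- `osc_h²(W, T) = ∑_l osc_h²(w_l, T)`. -/
def oscSqTuple {d : ℕ} (Ω : Set (Sp d)) (A : Sp d → Matrix (Fin d) (Fin d) ℝ) (c : Sp d → ℝ)
    (K : Geometry.SimplicialComplex ℝ (Sp d)) (m m' : ℕ) {q : ℕ} (Λ : Fin q → ℝ)
    (U : Fin q → Sp d → ℝ) (W : Fin q → Sp d → ℝ) (t : Finset (Sp d)) : ℝ :=
  ∑ l, oscSq Ω A c K m m' Λ U (W l) t

/-- The `l`-th member of the cluster among `n` indices, i.e. index `k₀ + l` (from zero). -/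
def clusterIndex {k₀ q n : ℕ} (hn : k₀ + q ≤ n) (l : Fin q) : Fin n :=
  ⟨k₀ + l, by omega⟩

end EigenFEM

end

open EigenFEM

/-! The element residual, where `source` contributes through the coefficients `b(V, u_{h,j})`, and
the jump residual are linear in `V`, up to null sets. Hence on each element `η²` and `osc²` are
squared seminorms, and by Cauchy–Schwarz a tuple `W' = βW` satisfies `η²(W') ≤ (∑ β²) η²(W)`, and
likewise for `osc²` (`etaSqTuple_le`, `oscSqTuple_le`). The theorem therefore reduces to expressing
`U_h` and `E_hU` in terms of each other by `q × q` matrices whose entries are bounded independently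
of the mesh.

For one direction, the residue theorem turns `E_h` into the `b`-orthogonal projection onto the
discrete eigenfunctions whose reciprocal eigenvalues lie inside `Γ` (`projE_eq`). On fine meshes
these are exactly the `q` cluster members, so `E_h u_l = ∑_j b(u_l, u_{h,j}) u_{h,j}` with
coefficients at most one. For the other direction, on fine meshes this projection changes an element
of `M(λ)` by at most half of its norm, so the matrix is invertible with a uniformly bounded inverse
(`exists_inverse_transition`).

Both facts about fine meshes come from `exists_finset_galerkin`. The solution operator is compact,
so the Galerkin operator is close to it in norm as soon as the Galerkin space approximates finitely
many fixed functions. Counting eigenvalues by dimension arguments across the spectral gaps places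
the cluster inside `Γ` and everything else outside; a gap estimate bounds the projection error. Only
qualitative density of the finite element spaces is needed (`exists_fem_approx`), and no regularity
of the eigenfunctions. The analytic prerequisites are the Poincaré inequality (`exists_poincare`),
Rellich compactness (`exists_compact_approx`) and the membership in `H¹₀(Ω)` of compactly supported
Lipschitz functions (`exists_mem_H10_of_lipschitz`). -/

set_option linter.unusedSectionVars false

/-! ### Spectral subspaces of compact symmetric operators. -/

namespace EigenApprox

section SpectralSums
open Module End
variable {L : Type*} [NormedAddCommGroup L] [InnerProductSpace ℝ L]

/-- The sum of the eigenspaces of `T` to eigenvalues in `I`. -/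
def eigenSum (T : L →L[ℝ] L) (I : Set ℝ) : Submodule ℝ L :=
  ⨆ κ : I, eigenspace (T : Module.End ℝ L) (κ : ℝ)

lemma eigenspace_le_eigenSum (T : L →L[ℝ] L) {I : Set ℝ} {κ : ℝ} (h : κ ∈ I) :
    eigenspace (T : Module.End ℝ L) κ ≤ eigenSum T I :=
  le_iSup (fun κ : I => eigenspace (T : Module.End ℝ L) (κ : ℝ)) ⟨κ, h⟩

lemma eigenSum_mono (T : L →L[ℝ] L) {I J : Set ℝ} (h : I ⊆ J) : eigenSum T I ≤ eigenSum T J :=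
  iSup_le fun κ => eigenspace_le_eigenSum T (h κ.2)

lemma eigenSum_union (T : L →L[ℝ] L) (I J : Set ℝ) :
    eigenSum T (I ∪ J) = eigenSum T I ⊔ eigenSum T J := by
  refine le_antisymm (iSup_le ?_)
    (sup_le (eigenSum_mono T subset_union_left) (eigenSum_mono T subset_union_right))
  rintro ⟨κ, h | h⟩
  · exact (eigenspace_le_eigenSum T h).trans le_sup_left
  · exact (eigenspace_le_eigenSum T h).trans le_sup_right

lemma eigenSum_singleton (T : L →L[ℝ] L) (κ : ℝ) :
    eigenSum T {κ} = eigenspace (T : Module.End ℝ L) κ := by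
  simp [eigenSum]

lemma exists_sum_of_mem_eigenSum {T : L →L[ℝ] L} {I : Set ℝ} {w : L} (hw : w ∈ eigenSum T I) :
    ∃ (F : Finset ℝ) (f : ∀ κ : ℝ, eigenspace (T : Module.End ℝ L) κ),
      (∀ κ ∈ F, κ ∈ I) ∧ w = ∑ κ ∈ F, (f κ : L) := by
  classical
  obtain ⟨g, hg⟩ := (Submodule.mem_iSup_iff_exists_dfinsupp' _ w).1 hw
  refine ⟨g.support.map (Function.Embedding.subtype _),
    fun κ => if h : κ ∈ I then g ⟨κ, h⟩ else 0, ?_, ?_⟩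
  · intro κ hκ
    simp only [Finset.mem_map, Function.Embedding.coe_subtype] at hκ
    obtain ⟨a, -, rfl⟩ := hκ
    exact a.2
  · rw [Finset.sum_map, ← hg, DFinsupp.sum]
    refine Finset.sum_congr rfl fun κ _ => ?_
    simp

lemma eigenSum_isOrtho {T : L →L[ℝ] L} (hT : T.IsSymmetric) {I J : Set ℝ} (h : Disjoint I J) :
    eigenSum T I ⟂ eigenSum T J := by
  refine Submodule.isOrtho_iSup_left.2 fun κ => Submodule.isOrtho_iSup_right.2 fun μ => ?_
  have hne : (κ : ℝ) ≠ μ := fun e => h.ne_of_mem κ.2 μ.2 e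
  refine Submodule.isOrtho_iff_inner_eq.2 fun u hu v hv => ?_
  exact hT.orthogonalFamily_eigenspaces hne ⟨u, hu⟩ ⟨v, hv⟩

/-- Orthogonality of the eigenspaces makes all three quadratic quantities weighted sums over one
decomposition; the spectral bounds below are then termwise comparisons. -/
lemma inner_apply_self_of_mem_eigenSum {T : L →L[ℝ] L} (hT : T.IsSymmetric) {I : Set ℝ} {w : L}
    (hw : w ∈ eigenSum T I) :
    ∃ (F : Finset ℝ) (f : ℝ → L), (∀ κ ∈ F, κ ∈ I) ∧ inner ℝ (T w) w = ∑ κ ∈ F, κ * ‖f κ‖ ^ 2 ∧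
      ‖T w‖ ^ 2 = ∑ κ ∈ F, κ ^ 2 * ‖f κ‖ ^ 2 ∧ ‖w‖ ^ 2 = ∑ κ ∈ F, ‖f κ‖ ^ 2 := by
  classical
  obtain ⟨F, f, hF, rfl⟩ := exists_sum_of_mem_eigenSum hw
  have hfam := hT.orthogonalFamily_eigenspaces
  have hTw : T (∑ κ ∈ F, (f κ : L)) = ∑ κ ∈ F, ((κ • f κ : _) : L) := by
    rw [map_sum]
    exact Finset.sum_congr rfl fun κ _ => mem_eigenspace_iff.1 (f κ).2
  refine ⟨F, fun κ => f κ, hF, ?_, ?_, ?_⟩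
  · rw [hTw]
    refine (hfam.inner_sum (fun κ => κ • f κ) f F).trans (Finset.sum_congr rfl fun κ _ => ?_)
    simp [real_inner_smul_left]
  · rw [hTw]
    refine (hfam.norm_sum (fun κ => κ • f κ) F).trans (Finset.sum_congr rfl fun κ _ => ?_)
    simp [norm_smul, mul_pow]
  · exact hfam.norm_sum f F

lemma le_inner_of_mem_eigenSum {T : L →L[ℝ] L} (hT : T.IsSymmetric) {I : Set ℝ} {s : ℝ}
    (hs : ∀ κ ∈ I, s ≤ κ) {w : L} (hw : w ∈ eigenSum T I) : s * ‖w‖ ^ 2 ≤ inner ℝ (T w) w := by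
  obtain ⟨F, f, hF, h1, -, h2⟩ := inner_apply_self_of_mem_eigenSum hT hw
  rw [h1, h2, Finset.mul_sum]
  exact Finset.sum_le_sum fun κ hκ => by gcongr; exact hs κ (hF κ hκ)

lemma inner_le_of_mem_eigenSum {T : L →L[ℝ] L} (hT : T.IsSymmetric) {I : Set ℝ} {s : ℝ}
    (hs : ∀ κ ∈ I, κ ≤ s) {w : L} (hw : w ∈ eigenSum T I) : inner ℝ (T w) w ≤ s * ‖w‖ ^ 2 := by
  obtain ⟨F, f, hF, h1, -, h2⟩ := inner_apply_self_of_mem_eigenSum hT hw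
  rw [h1, h2, Finset.mul_sum]
  exact Finset.sum_le_sum fun κ hκ => by gcongr; exact hs κ (hF κ hκ)

lemma le_norm_of_mem_eigenSum {T : L →L[ℝ] L} (hT : T.IsSymmetric) {I : Set ℝ} {s : ℝ}
    (hs0 : 0 ≤ s) (hs : ∀ κ ∈ I, s ≤ κ) {w : L} (hw : w ∈ eigenSum T I) : s * ‖w‖ ≤ ‖T w‖ := by
  obtain ⟨F, f, hF, -, h1, h2⟩ := inner_apply_self_of_mem_eigenSum hT hw
  refine le_of_sq_le_sq ?_ (norm_nonneg _)
  rw [mul_pow, h1, h2, Finset.mul_sum]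
  exact Finset.sum_le_sum fun κ hκ => by gcongr; exact hs κ (hF κ hκ)

/-- An infinite-dimensional `W` has a bounded sequence with mutual distances at least 1. Its images
stay at distance at least `s`, so no subsequence of them converges, against compactness. -/
lemma finiteDimensional_of_isCompactOperator {T : L →L[ℝ] L} (hT : IsCompactOperator T)
    {W : Submodule ℝ L} {s : ℝ} (hs : 0 < s) (hW : ∀ w ∈ W, s * ‖w‖ ≤ ‖T w‖) :
    FiniteDimensional ℝ W := by
  by_contra hfin
  obtain ⟨R, f, hR, hf1, hf2⟩ := exists_seq_norm_le_one_le_norm_sub (𝕜 := ℝ) (E := W) hfin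
  have hc := hT.isCompact_closure_image_closedBall R
  have hmem : ∀ n, T (f n : L) ∈ closure (T '' Metric.closedBall 0 R) := fun n =>
    subset_closure ⟨f n, by simpa using hf1 n, rfl⟩
  obtain ⟨x, -, φ, hφ, hx⟩ := hc.tendsto_subseq hmem
  have hcau := hx.cauchySeq
  obtain ⟨N, hN⟩ := Metric.cauchySeq_iff.1 hcau s hs
  have h := hN (N + 1) (by omega) N le_rfl
  have h2 := hf2 (hφ.injective.ne (show N + 1 ≠ N by omega))
  rw [dist_eq_norm] at h
  simp only [Function.comp_apply, ← map_sub] at h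
  have h3 := hW _ (f (φ (N + 1)) - f (φ N)).2
  rw [Submodule.coe_norm] at h2
  simp only [AddSubgroupClass.coe_sub] at h2 h3
  nlinarith

lemma finiteDimensional_eigenSum {T : L →L[ℝ] L} (hT : T.IsSymmetric) (hc : IsCompactOperator T)
    {I : Set ℝ} {s : ℝ} (hs0 : 0 < s) (hs : ∀ κ ∈ I, s ≤ κ) :
    FiniteDimensional ℝ (eigenSum T I) :=
  finiteDimensional_of_isCompactOperator hc hs0 fun _ hw => le_norm_of_mem_eigenSum hT hs0.le hs hw

/-- The eigenspaces in question are independent subspaces of one finite-dimensional space, so only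
finitely many are nonzero. -/
lemma finite_eigenvalues_ge {T : L →L[ℝ] L} (hT : T.IsSymmetric) (hc : IsCompactOperator T)
    {s : ℝ} (hs0 : 0 < s) :
    {κ : ℝ | s ≤ κ ∧ eigenspace (T : Module.End ℝ L) κ ≠ ⊥}.Finite := by
  have hfd : FiniteDimensional ℝ (eigenSum T (Ici s)) :=
    finiteDimensional_eigenSum hT hc hs0 fun κ h => h
  have hind : iSupIndep fun κ : Ici s =>
      (eigenspace (T : Module.End ℝ L) (κ : ℝ)).comap (eigenSum T (Ici s)).subtype := by
    refine OrthogonalFamily.independent (𝕜 := ℝ) (fun κ μ hne v w => ?_)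
    exact hT.orthogonalFamily_eigenspaces (fun e => hne (Subtype.ext e))
      ⟨v.1.1, v.2⟩ ⟨w.1.1, w.2⟩
  have hfin := WellFoundedGT.finite_ne_bot_of_iSupIndep hind
  refine (hfin.image Subtype.val).subset ?_
  rintro κ ⟨h1, h2⟩
  refine ⟨⟨κ, h1⟩, ?_, rfl⟩
  obtain ⟨v, hv, hv0⟩ := (Submodule.ne_bot_iff _).1 h2
  refine (Submodule.ne_bot_iff _).2
    ⟨⟨v, eigenspace_le_eigenSum T (show κ ∈ Ici s from h1) hv⟩, hv, ?_⟩
  simpa using hv0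

/-- By the spectral theorem the eigenspaces span a dense subspace, so a vector orthogonal to the
part above `s` is a limit of vectors from the part at or below `s`, where the bound holds termwise.
-/
lemma inner_le_of_orthogonal [CompleteSpace L] {T : L →L[ℝ] L} (hT : T.IsSymmetric)
    (hc : IsCompactOperator T) {s : ℝ} {w : L} (hw : w ∈ (eigenSum T (Ioi s))ᗮ) :
    inner ℝ (T w) w ≤ s * ‖w‖ ^ 2 := by
  have htop : (⨆ κ : ℝ, eigenspace (T : Module.End ℝ L) κ) = eigenSum T (Iic s) ⊔
      eigenSum T (Ioi s) := by
    rw [← eigenSum_union, Iic_union_Ioi]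
    exact le_antisymm (iSup_le fun κ => eigenspace_le_eigenSum T (mem_univ κ))
      (iSup_le fun κ => le_iSup (fun κ : ℝ => eigenspace (T : Module.End ℝ L) κ) κ.1)
  have hdense := (Submodule.topologicalClosure_eq_top_iff).2
    (ContinuousLinearMap.orthogonalComplement_iSup_eigenspaces_eq_bot hc hT)
  have hw' : w ∈ closure (eigenSum T (Iic s) : Set L) := by
    have h1 : w ∈ closure ((eigenSum T (Iic s) ⊔ eigenSum T (Ioi s) : Submodule ℝ L) : Set L) := by
      rw [← Submodule.topologicalClosure_coe, ← htop, hdense]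
      trivial
    rw [Metric.mem_closure_iff] at h1 ⊢
    intro ε hε
    obtain ⟨b, hb, hdist⟩ := h1 ε hε
    obtain ⟨x, hx, y, hy, rfl⟩ := Submodule.mem_sup.1 hb
    refine ⟨x, hx, lt_of_le_of_lt ?_ hdist⟩
    -- Both `w` and `x` are orthogonal to `y`, so dropping `y` from the approximant `x + y` only
    -- brings it closer to `w`.
    have hxy : inner ℝ (w - x) y = 0 := by
      rw [inner_sub_left, (Submodule.mem_orthogonal' _ _).1 hw y hy,
        (eigenSum_isOrtho hT (Iic_disjoint_Ioi le_rfl)).inner_eq hx hy, sub_zero]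
    rw [dist_eq_norm, dist_eq_norm]
    refine le_of_sq_le_sq ?_ (norm_nonneg _)
    have : w - (x + y) = (w - x) - y := by abel
    rw [this, norm_sub_sq_real (w - x) y, hxy]
    nlinarith [sq_nonneg ‖y‖]
  have hclosed : IsClosed {v : L | inner ℝ (T v) v ≤ s * ‖v‖ ^ 2} :=
    isClosed_le (by fun_prop) (by fun_prop)
  exact closure_minimal (fun v hv => inner_le_of_mem_eigenSum hT (fun κ h => h) hv) hclosed hw'

lemma exists_ne_zero_mem_orthogonal (U Z : Submodule ℝ L) [FiniteDimensional ℝ U]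
    (h : finrank ℝ U < finrank ℝ Z) : ∃ z ∈ Z, z ≠ 0 ∧ z ∈ Uᗮ := by
  -- `finrank` is 0 in infinite dimension, so a positive value forces finite dimension.
  have hZ : FiniteDimensional ℝ Z := FiniteDimensional.of_finrank_pos (by omega)
  obtain ⟨z, hz, hz0⟩ := (Submodule.ne_bot_iff _).1 (LinearMap.ker_ne_bot_of_finrank_lt
    (f := (U.orthogonalProjectionOnto : L →ₗ[ℝ] U) ∘ₗ Z.subtype) h)
  refine ⟨z, z.2, by simpa using hz0, ?_⟩
  rw [← Submodule.orthogonalProjectionOnto_eq_zero_iff]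
  simpa using hz

end SpectralSums

end EigenApprox

/-! ### Counting eigenvalues and comparing eigenvectors under a small perturbation. -/

namespace EigenApprox

section Counting
open Module End
variable {L : Type*} [NormedAddCommGroup L] [InnerProductSpace ℝ L]

/-- The self-adjoint operator with orthonormal eigenvectors `e i` and eigenvalues `κ i`. -/
noncomputable def diagOp {n : ℕ} (κ : Fin n → ℝ) (e : Fin n → L) (f : L) : L :=
  ∑ i, (κ i * inner ℝ (e i) f) • e i

lemma inner_diagOp {n : ℕ} (κ : Fin n → ℝ) (e : Fin n → L) (f : L) :
    inner ℝ (diagOp κ e f) f = ∑ i, κ i * inner ℝ (e i) f ^ 2 := by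
  simp only [diagOp, sum_inner, real_inner_smul_left]
  exact Finset.sum_congr rfl fun i _ => by ring

lemma sum_sq_inner_le {n : ℕ} {e : Fin n → L} (he : Orthonormal ℝ e) (f : L) (s : Finset (Fin n)) :
    ∑ i ∈ s, inner ℝ (e i) f ^ 2 ≤ ‖f‖ ^ 2 := by
  simpa using he.sum_inner_products_le (x := f) (s := s)

lemma sum_inner_smul_of_mem_span {n : ℕ} {e : Fin n → L} (he : Orthonormal ℝ e) {z : L}
    (hz : z ∈ Submodule.span ℝ (range e)) : ∑ i, inner ℝ (e i) z • e i = z := by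
  classical
  induction hz using Submodule.span_induction with
  | mem x hx =>
    obtain ⟨j, rfl⟩ := hx
    simp [orthonormal_iff_ite.1 he]
  | zero => simp
  | add x y _ _ hx hy => simp only [inner_add_right, add_smul, Finset.sum_add_distrib, hx, hy]
  | smul a x _ hx => simp only [inner_smul_right, mul_smul, ← Finset.smul_sum, hx]

lemma norm_sq_of_mem_span {n : ℕ} {e : Fin n → L} (he : Orthonormal ℝ e) {z : L}
    (hz : z ∈ Submodule.span ℝ (range e)) : ‖z‖ ^ 2 = ∑ i, inner ℝ (e i) z ^ 2 := by
  conv_lhs => rw [← sum_inner_smul_of_mem_span he hz]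
  rw [← real_inner_self_eq_norm_sq, he.inner_sum]
  simp [sq]

lemma inner_sub_diagOp_le {n : ℕ} {T : L →L[ℝ] L} {κ : Fin n → ℝ} {e : Fin n → L} {δ : ℝ}
    (hδ : ∀ f, ‖T f - diagOp κ e f‖ ≤ δ * ‖f‖) (f : L) :
    |inner ℝ (T f) f - inner ℝ (diagOp κ e f) f| ≤ δ * ‖f‖ ^ 2 := by
  rw [← inner_sub_left]
  calc _ ≤ ‖T f - diagOp κ e f‖ * ‖f‖ := abs_real_inner_le_norm _ _
    _ ≤ δ * ‖f‖ * ‖f‖ := by gcongr; exact hδ f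
    _ = _ := by ring

lemma finrank_span_image {n : ℕ} {e : Fin n → L} (he : Orthonormal ℝ e) (s : Finset (Fin n)) :
    finrank ℝ (Submodule.span ℝ (e '' s)) = s.card := by
  have h := finrank_span_eq_card (R := ℝ) (he.linearIndependent.comp _ (Subtype.val_injective (p := (· ∈ s))))
  rw [Set.range_comp, Subtype.range_coe_subtype] at h
  simpa using h

/-- A min-max argument across the spectral gap `(α, β)`. If one of the two spaces had larger
dimension, it would contain a nonzero vector orthogonal to the other. On that vector the quadratic
forms of `T` and of the diagonal operator lie on opposite sides of the gap, further apart than `δ`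
allows. -/
lemma card_filter_eq_finrank [CompleteSpace L] {n : ℕ} {T : L →L[ℝ] L} (hT : T.IsSymmetric)
    (hc : IsCompactOperator T) {α β δ τ : ℝ} (hα : 0 ≤ α) (hβ : α < β) (hδ0 : 0 ≤ δ)
    (hgap : ∀ κ, eigenspace (T : Module.End ℝ L) κ ≠ ⊥ → κ ≤ α ∨ β ≤ κ)
    {κ : Fin n → ℝ} {e : Fin n → L} (he : Orthonormal ℝ e)
    (hδ : ∀ f, ‖T f - diagOp κ e f‖ ≤ δ * ‖f‖) (h1 : α + δ < τ) (h2 : τ + δ < β) :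
    (Finset.univ.filter fun i => τ < κ i).card = finrank ℝ (eigenSum T (Ici β)) := by
  classical
  set s := Finset.univ.filter fun i => τ < κ i with hs
  have hIoi : eigenSum T (Ioi α) ≤ eigenSum T (Ici β) := by
    refine iSup_le fun μ => ?_
    by_cases hμ : eigenspace (T : Module.End ℝ L) (μ : ℝ) = ⊥
    · rw [hμ]; exact bot_le
    · rcases hgap μ hμ with h | h
      · exact absurd μ.2 (not_lt.2 h)
      · exact eigenspace_le_eigenSum T h
  have hfd : FiniteDimensional ℝ (eigenSum T (Ici β)) :=
    finiteDimensional_eigenSum hT hc (hα.trans_lt hβ) fun κ h => h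
  have hfd' : FiniteDimensional ℝ (Submodule.span ℝ (e '' s)) :=
    FiniteDimensional.span_of_finite ℝ (s.finite_toSet.image e)
  rw [← finrank_span_image he s]
  refine le_antisymm (not_lt.1 fun hlt => ?_) (not_lt.1 fun hlt => ?_)
  · obtain ⟨z, hz, hz0, hzo⟩ := exists_ne_zero_mem_orthogonal _ _ hlt
    have hz1 := inner_le_of_orthogonal hT hc (Submodule.orthogonal_le hIoi hzo)
    have hz2 := (abs_le.1 (inner_sub_diagOp_le hδ z)).1
    have hout : ∀ i ∉ s, inner ℝ (e i) z = 0 := by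
      intro i hi
      have : Submodule.span ℝ (e '' s) ≤ (ℝ ∙ e i)ᗮ := by
        refine Submodule.span_le.2 ?_
        rintro _ ⟨j, hj, rfl⟩
        refine Submodule.mem_orthogonal_singleton_iff_inner_right.2 (he.2 ?_)
        rintro rfl
        exact hi hj
      exact Submodule.mem_orthogonal_singleton_iff_inner_right.1 (this hz)
    have hnorm : ‖z‖ ^ 2 = ∑ i, inner ℝ (e i) z ^ 2 := by
      exact norm_sq_of_mem_span he (Submodule.span_mono (image_subset_range e _) hz)
    have hz3 : τ * ‖z‖ ^ 2 ≤ inner ℝ (diagOp κ e z) z := by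
      rw [inner_diagOp, hnorm, Finset.mul_sum]
      refine Finset.sum_le_sum fun i _ => ?_
      by_cases hi : i ∈ s
      · gcongr
        exact (Finset.mem_filter.1 hi).2.le
      · simp [hout i hi]
    have : 0 < ‖z‖ ^ 2 := by positivity
    nlinarith
  · obtain ⟨z, hz, hz0, hzo⟩ := exists_ne_zero_mem_orthogonal _ _ hlt
    have hz1 := le_inner_of_mem_eigenSum hT (fun κ h => h) hz
    have hz2 := (abs_le.1 (inner_sub_diagOp_le hδ z)).2
    have hz3 : inner ℝ (diagOp κ e z) z ≤ τ * ‖z‖ ^ 2 := by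
      rw [inner_diagOp]
      -- Here `τ ≥ 0` is needed, since Bessel is only an inequality: the diagonal operator is 0 off
      -- the span of `e`.
      refine le_trans ?_ (mul_le_mul_of_nonneg_left (sum_sq_inner_le he z Finset.univ) (by linarith))
      rw [Finset.mul_sum]
      refine Finset.sum_le_sum fun i _ => ?_
      by_cases hi : i ∈ s
      · have : inner ℝ (e i) z = 0 :=
          (Submodule.mem_orthogonal _ _).1 hzo _ (Submodule.subset_span ⟨i, hi, rfl⟩)
        simp [this]
      · gcongr
        simpa [hs] using hi
    have : 0 < ‖z‖ ^ 2 := by positivity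
    nlinarith

/-- Turns the number of eigenvalues beyond a threshold into a statement about positions in the
ordered list. -/
lemma mem_iff_lt_card_of_isLowerSet {n : ℕ} {s : Finset (Fin n)} (hs : IsLowerSet (s : Set (Fin n)))
    (i : Fin n) : i ∈ s ↔ (i : ℕ) < s.card := by
  constructor
  · intro hi
    have : (Finset.Iic i) ⊆ s := fun j hj => hs (Finset.mem_Iic.1 hj) hi
    have := Finset.card_le_card this
    rw [Fin.card_Iic] at this
    omega
  · intro hlt
    by_contra hi
    have : s ⊆ Finset.Iio i := fun j hj => Finset.mem_Iio.2 (not_le.1 fun h => hi (hs h hj))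
    have := Finset.card_le_card this
    rw [Fin.card_Iio] at this
    omega

/-- With `p` the part of `u` orthogonal to all `e i`, the defect `T u - diagOp κ e u` has components
`κ₀ p` and `(κ₀ - κ i)(e i, u) e i`. The projection error consists of `p` and the components outside
`s`, each amplified in the defect by at least `r`. The assumption `r ≤ κ₀` serves `p`, on which the
diagonal operator vanishes. -/
lemma norm_sub_proj_le {n : ℕ} {T : L →L[ℝ] L} {κ : Fin n → ℝ} {e : Fin n → L}
    (he : Orthonormal ℝ e) {δ κ₀ r : ℝ} (hr : 0 < r) (hrκ : r ≤ κ₀)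
    (hδ : ∀ f, ‖T f - diagOp κ e f‖ ≤ δ * ‖f‖) {u : L} (hu : T u = κ₀ • u)
    (s : Finset (Fin n)) (hs : ∀ i ∉ s, r ≤ |κ i - κ₀|) :
    r * ‖u - ∑ i ∈ s, inner ℝ (e i) u • e i‖ ≤ δ * ‖u‖ := by
  classical
  refine le_trans (le_of_sq_le_sq ?_ (norm_nonneg _)) (hδ u)
  set p := u - ∑ i, inner ℝ (e i) u • e i with hp
  have hpe : ∀ i, inner ℝ p (e i) = 0 := by
    intro i
    rw [hp, inner_sub_left, he.inner_left_fintype]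
    simp [real_inner_comm]
  have key : ∀ g : Fin n → ℝ, ∀ a : ℝ, ‖a • p + ∑ i, g i • e i‖ ^ 2 = a ^ 2 * ‖p‖ ^ 2 + ∑ i, g i ^ 2 := by
    intro g a
    have h1 : inner ℝ (a • p) (∑ i, g i • e i) = 0 := by
      rw [inner_sum]
      exact Finset.sum_eq_zero fun i _ => by simp [real_inner_smul_left, real_inner_smul_right, hpe]
    have h2 : ‖∑ i, g i • e i‖ ^ 2 = ∑ i, g i ^ 2 := by
      rw [← real_inner_self_eq_norm_sq, he.inner_sum]
      simp [sq]
    rw [norm_add_sq_real, h1, h2, norm_smul, mul_pow, Real.norm_eq_abs, sq_abs]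
    ring
  have e1 : u - ∑ i ∈ s, inner ℝ (e i) u • e i =
      (1 : ℝ) • p + ∑ i, (if i ∈ s then 0 else inner ℝ (e i) u) • e i := by
    have : ∑ i ∈ s, inner ℝ (e i) u • e i =
        ∑ i, (if i ∈ s then inner ℝ (e i) u • e i else 0) := by simp
    rw [hp, one_smul, this, sub_add, ← Finset.sum_sub_distrib]
    congr 1
    refine Finset.sum_congr rfl fun i _ => ?_
    split_ifs <;> simp
  have e2 : T u - diagOp κ e u = κ₀ • p + ∑ i, ((κ₀ - κ i) * inner ℝ (e i) u) • e i := by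
    rw [hu, hp, smul_sub, diagOp, sub_add, Finset.smul_sum, ← Finset.sum_sub_distrib]
    congr 1
    refine Finset.sum_congr rfl fun i _ => ?_
    rw [smul_smul, ← sub_smul]
    congr 1
    ring
  rw [mul_pow, e1, e2, key, key, mul_add, Finset.mul_sum, one_pow, one_mul]
  refine add_le_add (by gcongr) (Finset.sum_le_sum fun i _ => ?_)
  split_ifs with hi
  · simp; positivity
  · rw [mul_pow]
    gcongr ?_ * _
    rw [← sq_abs (κ₀ - κ i), abs_sub_comm]
    gcongr
    exact hs i hi

end Counting

end EigenApprox

/-! ### Coercive variational problems, their solution operators and Galerkin approximation. -/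

namespace EigenApprox

section Variational
open Module End
variable {X L : Type*} [NormedAddCommGroup X] [InnerProductSpace ℝ X] [CompleteSpace X]
  [NormedAddCommGroup L] [InnerProductSpace ℝ L] [CompleteSpace L]
  (ι : X →L[ℝ] L) {a : X →L[ℝ] X →L[ℝ] ℝ}

/-- The solution operator: `a (solOp f) v = (f, ι v)` for all `v`. -/
noncomputable def solOp (ha : IsCoercive a) : L →L[ℝ] X :=
  (ha.continuousLinearEquivOfBilin.symm : X →L[ℝ] X) ∘L (ContinuousLinearMap.adjoint ι)

/-- The eigenspace of the variational problem. -/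
def eigX (a : X →L[ℝ] X →L[ℝ] ℝ) (μ : ℝ) : Submodule ℝ X where
  carrier := {w | ∀ v, a w v = μ * inner ℝ (ι w) (ι v)}
  zero_mem' v := by simp
  add_mem' {x y} hx hy v := by
    simp only [mem_ofPred_eq] at hx hy
    simp [hx v, hy v, inner_add_left, mul_add]
  smul_mem' c x hx v := by
    simp only [mem_ofPred_eq] at hx
    simp only [map_smul, _root_.smul_apply, smul_eq_mul, hx v, real_inner_smul_left]
    ring

variable {ι}

lemma mem_eigX {μ : ℝ} {w : X} : w ∈ eigX ι a μ ↔ ∀ v, a w v = μ * inner ℝ (ι w) (ι v) := Iff.rfl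

lemma apply_solOp (ha : IsCoercive a) (f : L) (v : X) : a (solOp ι ha f) v = inner ℝ f (ι v) := by
  rw [← ha.continuousLinearEquivOfBilin_apply]
  simp [solOp, ContinuousLinearMap.adjoint_inner_left]

lemma eq_zero_of_apply_self_nonpos (ha : IsCoercive a) {w : X} (h : a w w ≤ 0) : w = 0 := by
  obtain ⟨C, hC, hc⟩ := ha
  have := hc w
  by_contra hw
  have : 0 < ‖w‖ := norm_pos_iff.2 hw
  have : 0 < C * ‖w‖ * ‖w‖ := by positivity
  linarith

lemma eq_of_forall_apply_eq (ha : IsCoercive a) {w w' : X} (h : ∀ v, a w v = a w' v) : w = w' := by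
  rw [← sub_eq_zero]
  refine eq_zero_of_apply_self_nonpos ha ?_
  simp [h]

lemma isSymmetric_comp_solOp (ha : IsCoercive a) (hs : ∀ x y, a x y = a y x) :
    (ι ∘L solOp ι ha : L →L[ℝ] L).IsSymmetric := by
  intro f g
  change inner ℝ (ι (solOp ι ha f)) g = inner ℝ f (ι (solOp ι ha g))
  rw [real_inner_comm, ← apply_solOp ha, ← apply_solOp ha, hs]

/-- Solving with right-hand side `ι w` divides an eigenvector by its eigenvalue; conversely an
eigenvector `f` of the solution operator lifts to `μ • solOp f`. -/
lemma map_eigX (ha : IsCoercive a) {μ : ℝ} (hμ : μ ≠ 0) :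
    (eigX ι a μ).map (ι : X →ₗ[ℝ] L) =
      eigenspace ((ι ∘L solOp ι ha : L →L[ℝ] L) : Module.End ℝ L) μ⁻¹ := by
  ext f
  rw [Submodule.mem_map, mem_eigenspace_iff]
  change _ ↔ ι (solOp ι ha f) = μ⁻¹ • f
  constructor
  · rintro ⟨w, hw, rfl⟩
    have : solOp ι ha (ι w) = μ⁻¹ • w := by
      refine eq_of_forall_apply_eq ha fun v => ?_
      rw [apply_solOp, map_smul, _root_.smul_apply, hw v, smul_eq_mul]
      field_simp
    simp [this]
  · intro h
    have hι : ι (μ • solOp ι ha f) = f := by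
      rw [map_smul, h, smul_smul, mul_inv_cancel₀ hμ, one_smul]
    refine ⟨μ • solOp ι ha f, fun v => ?_, hι⟩
    rw [hι, map_smul, _root_.smul_apply, apply_solOp, smul_eq_mul]

lemma eigX_eq_bot (ha : IsCoercive a) {μ : ℝ} (hμ : μ ≤ 0) : eigX ι a μ = ⊥ := by
  refine (Submodule.eq_bot_iff _).2 fun w hw => eq_zero_of_apply_self_nonpos ha ?_
  rw [hw w, real_inner_self_eq_norm_sq]
  exact mul_nonpos_of_nonpos_of_nonneg hμ (by positivity)

/-- Inversion exchanges "below `lam`" with "above `lam⁻¹`"; values `μ ≤ 0` contribute nothing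
because of coercivity. This identifies `k₀` with a spectral dimension of the solution operator. -/
lemma map_iSup_eigX (ha : IsCoercive a) {lam : ℝ} (hlam : 0 < lam) :
    (⨆ μ : Iio lam, eigX ι a μ).map (ι : X →ₗ[ℝ] L) =
      eigenSum (ι ∘L solOp ι ha : L →L[ℝ] L) (Ioi lam⁻¹) := by
  rw [Submodule.map_iSup]
  refine le_antisymm (iSup_le ?_) (iSup_le ?_)
  · rintro ⟨μ, hμ⟩
    rcases le_or_gt μ 0 with h | h
    · simp [eigX_eq_bot ha h]
    · rw [map_eigX ha h.ne']
      exact eigenspace_le_eigenSum _ (inv_strictAnti₀ h hμ)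
  · rintro ⟨κ, hκ⟩
    have hκ0 : 0 < κ := (inv_pos.2 hlam).trans hκ
    have := map_eigX (ι := ι) ha (inv_ne_zero hκ0.ne')
    rw [inv_inv] at this
    rw [← this]
    exact le_iSup (fun μ : Iio lam => (eigX ι a μ).map (ι : X →ₗ[ℝ] L))
      ⟨κ⁻¹, inv_lt_of_inv_lt₀ hlam hκ⟩

lemma eigX_ne_bot_of_eigenspace (ha : IsCoercive a) {κ : ℝ} (hκ : κ ≠ 0)
    (h : eigenspace ((ι ∘L solOp ι ha : L →L[ℝ] L) : Module.End ℝ L) κ ≠ ⊥) :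
    eigX ι a κ⁻¹ ≠ ⊥ := by
  intro hb
  have := map_eigX (ι := ι) ha (inv_ne_zero hκ)
  rw [inv_inv, hb, Submodule.map_bot] at this
  exact h this.symm

/-- Ensures that 0 lies outside `Γ`. If `r ≥ lam⁻¹`, every eigenvalue in `(0, lam⁻¹)` would be
enclosed, so all positive eigenvalues would be at least `lam⁻¹` and span a finite-dimensional space.
In infinite dimension some nonzero `ι x` is orthogonal to it; then `a (solOp (ι x)) (solOp (ι x)) ≤
0`, which forces `x = 0`. -/
lemma radius_lt (ha : IsCoercive a) (hs : ∀ x y, a x y = a y x) (hι : IsCompactOperator ι)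
    (hinj : Function.Injective ι) (hinf : ¬ FiniteDimensional ℝ X) {lam r : ℝ} (hlam : 0 < lam)
    (hΓ : ∀ μ, eigX ι a μ ≠ ⊥ → μ ≠ lam → r < |μ⁻¹ - lam⁻¹|) : r < lam⁻¹ := by
  by_contra! hr
  set T := (ι ∘L solOp ι ha : L →L[ℝ] L) with hT
  have hTs : T.IsSymmetric := isSymmetric_comp_solOp ha hs
  have hTc : IsCompactOperator T := hι.comp_clm _
  have hpos : 0 < lam⁻¹ := inv_pos.2 hlam
  have hfd : FiniteDimensional ℝ (eigenSum T (Ici lam⁻¹)) :=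
    finiteDimensional_eigenSum hTs hTc hpos fun κ h => h
  have hle : eigenSum T (Ioi 0) ≤ eigenSum T (Ici lam⁻¹) := by
    refine iSup_le fun κ => ?_
    have hκ : (0 : ℝ) < κ := κ.2
    by_cases hb : eigenspace (T : Module.End ℝ L) (κ : ℝ) = ⊥
    · rw [hb]; exact bot_le
    refine eigenspace_le_eigenSum T (show lam⁻¹ ≤ (κ : ℝ) from not_lt.1 fun hlt => ?_)
    have h1 := hΓ _ (eigX_ne_bot_of_eigenspace ha hκ.ne' hb) (by
      intro h; rw [← h, inv_inv] at hlt; exact lt_irrefl _ hlt)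
    rw [inv_inv, abs_of_neg (by linarith)] at h1
    linarith
  obtain ⟨x, hx, hx0⟩ : ∃ x : X, ι x ∈ (eigenSum T (Ici lam⁻¹))ᗮ ∧ x ≠ 0 := by
    by_contra! h
    refine hinf (FiniteDimensional.of_injective
      ((eigenSum T (Ici lam⁻¹)).orthogonalProjectionOnto ∘L ι).toLinearMap
      ((injective_iff_map_eq_zero _).2 fun x hx => h x ?_))
    rw [← Submodule.orthogonalProjectionOnto_eq_zero_iff]
    simpa using hx
  have h1 := inner_le_of_orthogonal hTs hTc (Submodule.orthogonal_le hle hx)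
  rw [zero_mul, hT, ContinuousLinearMap.comp_apply, real_inner_comm, ← apply_solOp ha] at h1
  have h2 := eq_zero_of_apply_self_nonpos ha h1
  have h3 : inner ℝ (ι x) (ι x) = 0 := by rw [← apply_solOp ha, h2]; simp
  exact hx0 (hinj (by simpa using h3))

/-- Céa's lemma: Galerkin orthogonality, coercivity and boundedness. The constant depends on `a`
only, not on the space `V`; the `+ 1` makes it positive. -/
lemma galerkin_error (ha : IsCoercive a) :
    ∃ C : ℝ, 0 < C ∧ ∀ (V : Submodule ℝ X) (w w' : X), w' ∈ V → (∀ v ∈ V, a w v = a w' v) →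
      ∀ v ∈ V, ‖w - w'‖ ≤ C * ‖w - v‖ := by
  obtain ⟨c, hc, hcoer⟩ := ha
  refine ⟨(‖a‖ + 1) / c, by positivity, fun V w w' hw' h v hv => ?_⟩
  have h1 : a (w - w') (w - w') = a (w - w') (w - v) := by
    have : ∀ z ∈ V, a (w - w') z = 0 := fun z hz => by simp [h z hz]
    rw [map_sub (a (w - w')) w w', map_sub (a (w - w')) w v, this _ hw', this _ hv]
  have h2 := hcoer (w - w')
  have h3 : a (w - w') (w - v) ≤ ‖a‖ * ‖w - w'‖ * ‖w - v‖ :=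
    (le_abs_self _).trans (a.le_opNorm₂ _ _)
  rw [h1] at h2
  rcases (norm_nonneg (w - w')).eq_or_lt with h0 | h0
  · rw [← h0]; positivity
  · rw [div_mul_eq_mul_div, le_div_iff₀ hc]
    have : c * ‖w - w'‖ ≤ ‖a‖ * ‖w - v‖ := by
      refine le_of_mul_le_mul_right ?_ h0
      linarith
    nlinarith [norm_nonneg (w - v)]

/-- Compactness of the solution operator into `X`, not merely into `L`: coercivity gives `c ‖solOp
(f - g)‖² ≤ ‖f - g‖ ‖ι (solOp (f - g))‖`, so a finite net in `L` for the images of the unit ball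
lifts to a net in the stronger norm. -/
lemma exists_finset_solOp (ha : IsCoercive a) (hι : IsCompactOperator ι) {ε : ℝ} (hε : 0 < ε) :
    ∃ F : Finset X, ∀ f : L, ‖f‖ ≤ 1 → ∃ w ∈ F, ‖solOp ι ha f - w‖ ≤ ε := by
  classical
  obtain ⟨c, hc, hcoer⟩ := id ha
  have hTc : IsCompactOperator (ι ∘L solOp ι ha : L →L[ℝ] L) := hι.comp_clm _
  have htb := (hTc.isCompact_closure_image_closedBall 1).totallyBounded.subset subset_closure
  -- Unit vectors satisfy `‖f - g‖ ≤ 2`, so mesh width `c ε² / 2` in `L` gives `ε` in `X`.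
  obtain ⟨t, hts, htf, ht⟩ := totallyBounded_iff_subset.1 htb _
    (Metric.dist_mem_uniformity (show 0 < c * ε ^ 2 / 2 by positivity))
  obtain ⟨G, hG, rfl⟩ := (Set.subset_image_iff).1 hts
  obtain ⟨G', hG', himg⟩ := Set.exists_subset_bijOn G (ι ∘L solOp ι ha : L →L[ℝ] L)
  have hfin : G'.Finite := Set.Finite.of_finite_image (by rwa [himg.image_eq]) himg.injOn
  refine ⟨hfin.toFinset.image (solOp ι ha), fun f hf => ?_⟩
  have hm : (ι ∘L solOp ι ha : L →L[ℝ] L) f ∈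
      (ι ∘L solOp ι ha : L →L[ℝ] L) '' Metric.closedBall 0 1 := ⟨f, by simpa using hf, rfl⟩
  obtain ⟨y, hy, hdist⟩ := mem_iUnion₂.1 (ht hm)
  change y ∈ (ι ∘L solOp ι ha : L →L[ℝ] L) '' G at hy
  rw [← himg.image_eq] at hy
  obtain ⟨g, hg, rfl⟩ := hy
  refine ⟨solOp ι ha g, by simpa using ⟨g, hg, rfl⟩, ?_⟩
  have hg1 : ‖g‖ ≤ 1 := by simpa using hG (hG' hg)
  have h1 := hcoer (solOp ι ha (f - g))
  rw [apply_solOp] at h1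
  have hd : ‖ι (solOp ι ha (f - g))‖ < c * ε ^ 2 / 2 := by
    have := hdist
    simp only [mem_ofPred_eq, dist_eq_norm] at this
    simpa [← map_sub] using this
  have h2 : ‖f - g‖ ≤ 2 := (norm_sub_le _ _).trans (by linarith)
  have h3 := real_inner_le_norm (f - g) (ι (solOp ι ha (f - g)))
  rw [← map_sub]
  refine le_of_sq_le_sq ?_ hε.le
  have h4 : ‖f - g‖ * ‖ι (solOp ι ha (f - g))‖ ≤ 2 * (c * ε ^ 2 / 2) := by gcongr
  refine le_of_mul_le_mul_left ?_ hc
  nlinarith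

end Variational
end EigenApprox

/-! ### Norm convergence of Galerkin operators and location of the discrete spectrum. -/

namespace EigenApprox

section Discrete
open Module End
variable {X L : Type*} [NormedAddCommGroup X] [InnerProductSpace ℝ X] [CompleteSpace X]
  [NormedAddCommGroup L] [InnerProductSpace ℝ L] [CompleteSpace L]
  {ι : X →L[ℝ] L} {a : X →L[ℝ] X →L[ℝ] ℝ}

/-- `(Λ i, φ i)` are the eigenpairs of the Galerkin problem on the span of the `φ i`. -/
structure IsGalerkinEigenbasis (ι : X →L[ℝ] L) (a : X →L[ℝ] X →L[ℝ] ℝ) {n : ℕ} (Λ : Fin n → ℝ)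
    (φ : Fin n → X) : Prop where
  mono : Monotone Λ
  orthonormal : Orthonormal ℝ fun i => ι (φ i)
  eigen : ∀ i, ∀ v ∈ Submodule.span ℝ (range φ), a (φ i) v = Λ i * inner ℝ (ι (φ i)) (ι v)

lemma IsGalerkinEigenbasis.pos (ha : IsCoercive a) {n : ℕ} {Λ : Fin n → ℝ} {φ : Fin n → X}
    (h : IsGalerkinEigenbasis ι a Λ φ) (i : Fin n) : 0 < Λ i := by
  have h1 := h.eigen i (φ i) (Submodule.subset_span ⟨i, rfl⟩)
  rw [real_inner_self_eq_norm_sq, h.orthonormal.1 i] at h1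
  by_contra! hle
  have := eq_zero_of_apply_self_nonpos ha (w := φ i) (by rw [h1]; simpa using hle)
  have h2 := h.orthonormal.1 i
  simp [this] at h2

lemma IsGalerkinEigenbasis.sum_inner_smul {n : ℕ} {Λ : Fin n → ℝ}
    {φ : Fin n → X} (h : IsGalerkinEigenbasis ι a Λ φ) {v : X}
    (hv : v ∈ Submodule.span ℝ (range φ)) : ∑ i, inner ℝ (ι (φ i)) (ι v) • ι (φ i) = ι v := by
  refine sum_inner_smul_of_mem_span h.orthonormal ?_
  have : ι v ∈ (Submodule.span ℝ (range φ)).map (ι : X →ₗ[ℝ] L) := ⟨v, hv, rfl⟩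
  rw [Submodule.map_span, ← range_comp] at this
  exact this

/-- The diagonal operator built from the discrete eigenpairs is the Galerkin solution operator. By
Céa its error is controlled by the approximation of `solOp f`, and a finite net reduces this to
approximating the elements of `F`; hence the estimate is uniform over the unit ball. -/
lemma norm_comp_solOp_sub_diagOp_le (ha : IsCoercive a)
    (hι : IsCompactOperator ι) {δ : ℝ} (hδ : 0 < δ) :
    ∃ F : Finset X, ∃ ε : ℝ, 0 < ε ∧ ∀ (n : ℕ) (Λ : Fin n → ℝ) (φ : Fin n → X),
      IsGalerkinEigenbasis ι a Λ φ →
      (∀ w ∈ F, ∃ v ∈ Submodule.span ℝ (range φ), ‖w - v‖ < ε) →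
      ∀ f, ‖(ι ∘L solOp ι ha : L →L[ℝ] L) f
        - diagOp (fun i => (Λ i)⁻¹) (fun i => ι (φ i)) f‖ ≤ δ * ‖f‖ := by
  obtain ⟨C, hC, hcea⟩ := galerkin_error (a := a) ha
  -- One `ε` for the distance to the net, one for the Galerkin space; Céa and `ι` contribute `C` and
  -- `‖ι‖`.
  set ε : ℝ := δ / (2 * C * (‖ι‖ + 1)) with hε
  have hε0 : 0 < ε := by positivity
  obtain ⟨F, hF⟩ := exists_finset_solOp (ι := ι) ha hι hε0
  refine ⟨F, ε, hε0, fun n Λ φ hφ hapx f => ?_⟩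
  have key : ∀ f : L, ‖f‖ ≤ 1 → ‖(ι ∘L solOp ι ha : L →L[ℝ] L) f
        - diagOp (fun i => (Λ i)⁻¹) (fun i => ι (φ i)) f‖ ≤ δ := by
    intro f hf
    set w' : X := ∑ i, ((Λ i)⁻¹ * inner ℝ (ι (φ i)) f) • φ i with hw'
    have hmem : w' ∈ Submodule.span ℝ (range φ) :=
      Submodule.sum_mem _ fun i _ => Submodule.smul_mem _ _ (Submodule.subset_span ⟨i, rfl⟩)
    have heq : ∀ v ∈ Submodule.span ℝ (range φ), a (solOp ι ha f) v = a w' v := by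
      intro v hv
      rw [apply_solOp, ← hφ.sum_inner_smul hv, inner_sum, hw', map_sum, _root_.sum_apply]
      refine Finset.sum_congr rfl fun i _ => ?_
      have := (hφ.pos ha i).ne'
      rw [map_smul, _root_.smul_apply, hφ.eigen i v hv, inner_smul_right, smul_eq_mul,
        real_inner_comm (ι (φ i)) f]
      field_simp
    obtain ⟨w, hw, hfw⟩ := hF f hf
    obtain ⟨v, hv, hwv⟩ := hapx w hw
    have h1 := hcea _ _ _ hmem heq v hv
    have h2 : ‖solOp ι ha f - v‖ ≤ 2 * ε := by
      have : solOp ι ha f - v = (solOp ι ha f - w) + (w - v) := by abel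
      rw [this]
      exact (norm_add_le _ _).trans (by linarith)
    have h3 : (ι ∘L solOp ι ha : L →L[ℝ] L) f
        - diagOp (fun i => (Λ i)⁻¹) (fun i => ι (φ i)) f = ι (solOp ι ha f - w') := by
      simp [hw', diagOp]
    rw [h3]
    calc ‖ι (solOp ι ha f - w')‖ ≤ ‖ι‖ * (C * (2 * ε)) :=
          (ι.le_opNorm _).trans (by gcongr; exact h1.trans (by gcongr))
      _ ≤ (‖ι‖ + 1) * (C * (2 * ε)) := by gcongr; linarith
      _ = δ := by rw [hε]; field_simp
  rcases eq_or_ne f 0 with rfl | hf0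
  · simp [diagOp]
  have hn : 0 < ‖f‖ := norm_pos_iff.2 hf0
  have h := key (‖f‖⁻¹ • f) (by rw [norm_smul, norm_inv, norm_norm, inv_mul_cancel₀ hn.ne'])
  have h2 : diagOp (fun i => (Λ i)⁻¹) (fun i => ι (φ i)) (‖f‖⁻¹ • f) =
      ‖f‖⁻¹ • diagOp (fun i => (Λ i)⁻¹) (fun i => ι (φ i)) f := by
    simp only [diagOp, Finset.smul_sum, inner_smul_right, smul_smul]
    exact Finset.sum_congr rfl fun i _ => by congr 1; ring
  rw [h2, map_smul, ← smul_sub, norm_smul, norm_inv, norm_norm, inv_mul_le_iff₀ hn] at h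
  linarith

/-- Only finitely many eigenvalues are at least `(κ₀ - r) / 2`, so their strict distances share a
margin beyond `r`. The remaining ones, accumulating at 0, are more than `r + (κ₀ - r) / 2` away from
`κ₀`. -/
lemma exists_gap {T : L →L[ℝ] L} (hT : T.IsSymmetric) (hc : IsCompactOperator T) {κ₀ r : ℝ}
    (hr0 : 0 < r) (hr : r < κ₀) (h : ∀ κ, 0 < κ → eigenspace (T : Module.End ℝ L) κ ≠ ⊥ → κ ≠ κ₀ →
      r < |κ - κ₀|) :
    ∃ ε : ℝ, 0 < ε ∧ r + ε ≤ κ₀ ∧ ∀ κ, eigenspace (T : Module.End ℝ L) κ ≠ ⊥ → κ ≠ κ₀ →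
      r + ε ≤ |κ - κ₀| := by
  have hs : 0 < (κ₀ - r) / 2 := by linarith
  have hfin := finite_eigenvalues_ge hT hc hs
  have hfin' : {κ : ℝ | ((κ₀ - r) / 2 ≤ κ ∧
      eigenspace (T : Module.End ℝ L) κ ≠ ⊥) ∧ κ ≠ κ₀}.Finite := hfin.subset fun κ h => h.1
  have hev : ∀ᶠ ε in 𝓝[>] (0 : ℝ), ∀ κ ∈ {κ : ℝ | ((κ₀ - r) / 2 ≤ κ ∧
      eigenspace (T : Module.End ℝ L) κ ≠ ⊥) ∧ κ ≠ κ₀}, r + ε ≤ |κ - κ₀| := by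
    refine (eventually_all_finite hfin').2 fun κ hκ => nhdsWithin_le_nhds ?_
    have h1 := h κ (hs.trans_le hκ.1.1) hκ.1.2 hκ.2
    have : ∀ᶠ ε in 𝓝 (0 : ℝ), ε < |κ - κ₀| - r := eventually_lt_nhds (by linarith)
    exact this.mono fun ε hε => by linarith
  have hev2 : ∀ᶠ ε in 𝓝[>] (0 : ℝ), ε < (κ₀ - r) / 2 :=
    nhdsWithin_le_nhds (eventually_lt_nhds hs)
  obtain ⟨ε, ⟨h1, h2⟩, h3⟩ := ((hev.and hev2).and self_mem_nhdsWithin).exists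
  refine ⟨ε, h3, by linarith, fun κ hκ hne => ?_⟩
  by_cases hle : (κ₀ - r) / 2 ≤ κ
  · exact h1 κ ⟨⟨hle, hκ⟩, hne⟩
  · rw [abs_of_neg (by linarith)]
    linarith

/-- Spectral approximation for an isolated eigenvalue, by any Galerkin space that approximates
finitely many elements well enough. -/
theorem exists_finset_galerkin (ha : IsCoercive a) (hs : ∀ x y, a x y = a y x)
    (hι : IsCompactOperator ι) (hinj : Function.Injective ι) {lam r : ℝ}
    (hlam : 0 < lam) (hr : 0 < r) (hrl : r < lam⁻¹)
    (hΓ : ∀ μ, eigX ι a μ ≠ ⊥ → μ ≠ lam → r < |μ⁻¹ - lam⁻¹|) :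
    ∃ F : Finset X, ∃ ε : ℝ, 0 < ε ∧ ∀ (n : ℕ) (Λ : Fin n → ℝ) (φ : Fin n → X),
      IsGalerkinEigenbasis ι a Λ φ →
      (∀ w ∈ F, ∃ v ∈ Submodule.span ℝ (range φ), ‖w - v‖ < ε) →
      finrank ℝ (⨆ μ : Iio lam, eigX ι a μ : Submodule ℝ X) + finrank ℝ (eigX ι a lam) ≤ n ∧
      (∀ i : Fin n, (i : ℕ) < finrank ℝ (⨆ μ : Iio lam, eigX ι a μ : Submodule ℝ X) →
        r < |(Λ i)⁻¹ - lam⁻¹|) ∧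
      (∀ i : Fin n, finrank ℝ (⨆ μ : Iio lam, eigX ι a μ : Submodule ℝ X) ≤ (i : ℕ) →
        (i : ℕ) < finrank ℝ (⨆ μ : Iio lam, eigX ι a μ : Submodule ℝ X) +
          finrank ℝ (eigX ι a lam) → |(Λ i)⁻¹ - lam⁻¹| < r) ∧
      (∀ i : Fin n, finrank ℝ (⨆ μ : Iio lam, eigX ι a μ : Submodule ℝ X) +
          finrank ℝ (eigX ι a lam) ≤ (i : ℕ) → r < |(Λ i)⁻¹ - lam⁻¹|) ∧
      ∀ u ∈ eigX ι a lam, ∀ s : Finset (Fin n), (∀ i ∉ s, r ≤ |(Λ i)⁻¹ - lam⁻¹|) →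
        ‖ι u - ∑ i ∈ s, inner ℝ (ι (φ i)) (ι u) • ι (φ i)‖ ≤ 2⁻¹ * ‖ι u‖ := by
  set T := (ι ∘L solOp ι ha : L →L[ℝ] L) with hTdef
  have hTs : T.IsSymmetric := isSymmetric_comp_solOp ha hs
  have hTc : IsCompactOperator T := hι.comp_clm _
  set κ₀ := lam⁻¹ with hκ₀
  have hκ0 : 0 < κ₀ := inv_pos.2 hlam
  obtain ⟨ε, hε, hrε, hgap⟩ := exists_gap hTs hTc hr hrl (fun κ hκ hb hne => by
    have := hΓ κ⁻¹ (eigX_ne_bot_of_eigenspace ha hκ.ne' hb)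
      (fun h => hne (by rw [hκ₀, ← h, inv_inv]))
    rwa [inv_inv] at this)
  -- The operator error will be `ρ / 2`: small against the gap beyond the circle, to separate the
  -- eigenvalues, and against `r`, to give the factor `2⁻¹` in the projection estimate.
  set ρ := min ε r / 3 with hρ
  have hρ0 : 0 < ρ := by positivity
  have hρε : 3 * ρ ≤ ε := by rw [hρ]; linarith [min_le_left ε r]
  have hρr : 3 * ρ ≤ r := by rw [hρ]; linarith [min_le_right ε r]
  obtain ⟨F, η, hη, happ⟩ := norm_comp_solOp_sub_diagOp_le ha hι (half_pos hρ0)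
  refine ⟨F, η, hη, fun n Λ φ hφ hF => ?_⟩
  have hδ := happ n Λ φ hφ hF
  set κ : Fin n → ℝ := fun i => (Λ i)⁻¹ with hκ
  have hanti : ∀ i j, i ≤ j → κ j ≤ κ i := fun i j hij =>
    inv_anti₀ (hφ.pos ha i) (hφ.mono hij)
  set N₀ := finrank ℝ (⨆ μ : Iio lam, eigX ι a μ : Submodule ℝ X) with hN₀
  set q := finrank ℝ (eigX ι a lam) with hq
  have hup : ∀ κ, eigenspace (T : Module.End ℝ L) κ ≠ ⊥ → κ ≤ κ₀ ∨ κ₀ + (r + ε) ≤ κ := by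
    intro κ hb
    rcases le_or_gt κ κ₀ with h | h
    · exact Or.inl h
    · right
      have := hgap κ hb h.ne'
      rw [abs_of_pos (by linarith)] at this
      linarith
  have hdown : ∀ κ, eigenspace (T : Module.End ℝ L) κ ≠ ⊥ → κ ≤ κ₀ - (r + ε) ∨ κ₀ ≤ κ := by
    intro κ hb
    rcases le_or_gt κ₀ κ with h | h
    · exact Or.inr h
    · left
      have := hgap κ hb h.ne
      rw [abs_of_neg (by linarith)] at this
      linarith
  have hrank1 : finrank ℝ (eigenSum T (Ioi κ₀)) = N₀ := by
    rw [← map_iSup_eigX ha hlam]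
    exact (Submodule.equivMapOfInjective (ι : X →ₗ[ℝ] L) hinj _).finrank_eq.symm
  have hrank2 : finrank ℝ (eigenSum T {κ₀}) = q := by
    rw [eigenSum_singleton, ← map_eigX ha hlam.ne']
    exact (Submodule.equivMapOfInjective (ι : X →ₗ[ℝ] L) hinj _).finrank_eq.symm
  have hsum1 : eigenSum T (Ici (κ₀ + (r + ε))) = eigenSum T (Ioi κ₀) := by
    refine le_antisymm (eigenSum_mono T fun κ h => ?_) (iSup_le fun κ => ?_)
    · have : κ₀ + (r + ε) ≤ κ := h
      exact lt_of_lt_of_le (by linarith) this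
    · by_cases hb : eigenspace (T : Module.End ℝ L) (κ : ℝ) = ⊥
      · rw [hb]; exact bot_le
      · rcases hup κ hb with h | h
        · exact absurd κ.2 (not_lt.2 h)
        · exact eigenspace_le_eigenSum T h
  -- Orthogonality makes the sum of the part above `κ₀` and the eigenspace of `κ₀` direct.
  have hrank3 : finrank ℝ (eigenSum T (Ici κ₀)) = N₀ + q := by
    have hf1 : FiniteDimensional ℝ (eigenSum T (Ioi κ₀)) :=
      finiteDimensional_eigenSum hTs hTc hκ0 fun κ h => (show κ₀ < κ from h).le
    have hf2 : FiniteDimensional ℝ (eigenSum T {κ₀}) :=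
      finiteDimensional_eigenSum hTs hTc hκ0 fun κ h => (show κ = κ₀ from h).ge
    have h1 := Submodule.finrank_sup_add_finrank_inf_eq (eigenSum T (Ioi κ₀)) (eigenSum T {κ₀})
    have h2 : Disjoint (Ioi κ₀) {κ₀} := by simp
    rw [(eigenSum_isOrtho hTs h2).disjoint.eq_bot, finrank_bot, add_zero, hrank1, hrank2,
      ← eigenSum_union] at h1
    rw [← h1, Ioi_union_left]
  have hcard : ∀ τ (m : ℕ), (Finset.univ.filter fun i => τ < κ i).card = m →
      m ≤ n ∧ ∀ i : Fin n, τ < κ i ↔ (i : ℕ) < m := by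
    intro τ m hm
    refine ⟨by simpa [hm] using Finset.card_le_univ (Finset.univ.filter fun i => τ < κ i),
      fun i => ?_⟩
    have hl : IsLowerSet ((Finset.univ.filter fun i => τ < κ i : Finset (Fin n)) : Set (Fin n)) := by
      intro i j hji hi
      simp only [Finset.coe_filter, Finset.mem_univ, true_and, mem_ofPred_eq] at hi ⊢
      exact hi.trans_le (hanti _ _ hji)
    have := mem_iff_lt_card_of_isLowerSet hl i
    rw [hm] at this
    simpa using this
  have hcount : ∀ {α β τ : ℝ}, 0 ≤ α → α < β →
      (∀ κ, eigenspace (T : Module.End ℝ L) κ ≠ ⊥ → κ ≤ α ∨ β ≤ κ) → α + ρ / 2 < τ →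
      τ + ρ / 2 < β → (Finset.univ.filter fun i => τ < κ i).card =
        finrank ℝ (eigenSum T (Ici β)) := fun hα hβ hg h1 h2 =>
    card_filter_eq_finrank hTs hTc hα hβ (half_pos hρ0).le hg hφ.orthonormal hδ h1 h2
  -- Thresholds near both ends of each gap. The two in the upper gap have the same count `N₀`, so no
  -- discrete value lies between them; the two in the lower gap have the same count `N₀ + q`. This
  -- places the cluster within `ρ` of `κ₀` and all other values beyond `r`.
  have c1 := hcard _ _ ((hcount (τ := κ₀ + ρ) hκ0.le (by linarith) hup (by linarith)
    (by linarith)).trans (by rw [hsum1, hrank1]))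
  have c2 := hcard _ _ ((hcount (τ := κ₀ + (r + ε) - ρ) hκ0.le (by linarith) hup (by linarith)
    (by linarith)).trans (by rw [hsum1, hrank1]))
  have c3 := hcard _ _ ((hcount (τ := κ₀ - ρ) (by linarith) (by linarith) hdown (by linarith)
    (by linarith)).trans hrank3)
  have c4 := hcard _ _ ((hcount (τ := κ₀ - (r + ε) + ρ) (by linarith) (by linarith) hdown
    (by linarith) (by linarith)).trans hrank3)
  refine ⟨c3.1, fun i hi => ?_, fun i hi1 hi2 => ?_, fun i hi => ?_, fun u hu s hs => ?_⟩
  · have := (c2.2 i).2 hi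
    rw [abs_of_pos (by linarith)]
    linarith
  · have h1 := mt (c1.2 i).1 (not_lt.2 hi1)
    have h2 := (c3.2 i).2 hi2
    rw [abs_lt]
    constructor <;> linarith
  · have := mt (c4.2 i).1 (not_lt.2 hi)
    rw [abs_of_neg (by linarith)]
    linarith
  · have hTu : T (ι u) = κ₀ • ι u := by
      have : ι u ∈ (eigX ι a lam).map (ι : X →ₗ[ℝ] L) := ⟨u, hu, rfl⟩
      rw [map_eigX ha hlam.ne'] at this
      exact mem_eigenspace_iff.1 this
    have h1 := norm_sub_proj_le hφ.orthonormal hr hrl.le hδ hTu s hs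
    refine le_of_mul_le_mul_left (h1.trans ?_) hr
    nlinarith [norm_nonneg (ι u)]

end Discrete
end EigenApprox

/-! ### The contour integral of the resolvent of a diagonal operator. -/

namespace EigenApprox

section Contour
open InnerProductSpace
variable {H : Type*} [NormedAddCommGroup H] [InnerProductSpace ℂ H] [CompleteSpace H]

lemma sum_smul_rankOne_mul {n : ℕ} {e : Fin n → H} (he : Orthonormal ℂ e) (α β : Fin n → ℂ) :
    (∑ i, α i • rankOne ℂ (e i) (e i) : H →L[ℂ] H) * (∑ i, β i • rankOne ℂ (e i) (e i)) =
      ∑ i, (α i * β i) • rankOne ℂ (e i) (e i) := by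
  classical
  ext f
  simp only [ContinuousLinearMap.mul_def, ContinuousLinearMap.comp_apply, _root_.sum_apply, _root_.smul_apply, rankOne_apply, map_sum,
    map_smul]
  refine Finset.sum_congr rfl fun i _ => ?_
  simp [orthonormal_iff_ite.1 he, smul_smul]
  congr 1
  ring

/-- The operator is 0 on the orthogonal complement of the `e i`, where the resolvent is `z⁻¹`; each
direction `e i` corrects this to `(z - κ i)⁻¹`. Diagonal multiplication verifies both inverse
identities. -/
lemma resolvent_sum_smul_rankOne {n : ℕ} {e : Fin n → H} (he : Orthonormal ℂ e) (κ : Fin n → ℂ)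
    {z : ℂ} (hz : z ≠ 0) (hzκ : ∀ i, z ≠ κ i) :
    resolvent (∑ i, κ i • rankOne ℂ (e i) (e i) : H →L[ℂ] H) z =
      z⁻¹ • (1 : H →L[ℂ] H) + ∑ i, ((z - κ i)⁻¹ - z⁻¹) • rankOne ℂ (e i) (e i) := by
  set D : H →L[ℂ] H := ∑ i, κ i • rankOne ℂ (e i) (e i) with hD
  set R : H →L[ℂ] H := ∑ i, ((z - κ i)⁻¹ - z⁻¹) • rankOne ℂ (e i) (e i) with hR
  have hsum : z • R - z⁻¹ • D - ∑ i, (κ i * ((z - κ i)⁻¹ - z⁻¹)) • rankOne ℂ (e i) (e i) = 0 := by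
    rw [hR, hD, Finset.smul_sum, Finset.smul_sum, ← Finset.sum_sub_distrib, ← Finset.sum_sub_distrib]
    refine Finset.sum_eq_zero fun i _ => ?_
    rw [smul_smul, smul_smul, ← sub_smul, ← sub_smul]
    have : z - κ i ≠ 0 := sub_ne_zero.2 (hzκ i)
    have h0 : z * ((z - κ i)⁻¹ - z⁻¹) - z⁻¹ * κ i - κ i * ((z - κ i)⁻¹ - z⁻¹) = 0 := by
      field_simp
      ring
    rw [h0, zero_smul]
  have hDR : D * R = ∑ i, (κ i * ((z - κ i)⁻¹ - z⁻¹)) • rankOne ℂ (e i) (e i) :=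
    sum_smul_rankOne_mul he _ _
  have hRD : R * D = ∑ i, (κ i * ((z - κ i)⁻¹ - z⁻¹)) • rankOne ℂ (e i) (e i) := by
    rw [hR, hD, sum_smul_rankOne_mul he]
    simp only [mul_comm]
  rw [resolvent, Algebra.algebraMap_eq_smul_one]
  refine Ring.inverse_unit ⟨z • 1 - D, z⁻¹ • 1 + R, ?_, ?_⟩
  · rw [← hDR] at hsum
    rw [sub_mul, mul_add, mul_add, smul_mul_smul_comm, mul_inv_cancel₀ hz, one_smul, one_mul,
      smul_mul_assoc, one_mul, mul_smul_comm, mul_one]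
    rw [← sub_eq_zero, ← hsum]
    abel
  · rw [← hRD] at hsum
    rw [mul_sub, add_mul, add_mul, smul_mul_smul_comm, inv_mul_cancel₀ hz, one_smul, one_mul,
      smul_mul_assoc, one_mul, mul_smul_comm, mul_one]
    rw [← sub_eq_zero, ← hsum]
    abel

lemma circleIntegral_sub_inv_eq_zero {c w : ℂ} {r : ℝ} (hr : 0 < r) (hw : r < ‖w - c‖) :
    ∮ z in C(c, r), (z - w)⁻¹ = 0 := by
  refine DiffContOnCl.circleIntegral_eq_zero hr.le (DifferentiableOn.diffContOnCl fun z hz => ?_)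
  rw [closure_ball c hr.ne', mem_closedBall_iff_norm] at hz
  have : z - w ≠ 0 := by
    intro h
    rw [sub_eq_zero] at h
    rw [h] at hz
    linarith
  fun_prop (disch := exact this)

/-- The Riesz projection of a finite rank self-adjoint operator. -/
lemma contour_resolvent_sum_smul_rankOne {n : ℕ} {e : Fin n → H} (he : Orthonormal ℂ e)
    (κ : Fin n → ℝ) {κ₀ r : ℝ} (hr : 0 < r) (hr0 : r < κ₀) (s : Finset (Fin n))
    (hs : ∀ i ∈ s, |κ i - κ₀| < r) (hs' : ∀ i ∉ s, r < |κ i - κ₀|) :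
    (2 * Real.pi * Complex.I : ℂ)⁻¹ • (∮ z in C((κ₀ : ℂ), r),
        resolvent (∑ i, (κ i : ℂ) • rankOne ℂ (e i) (e i) : H →L[ℂ] H) z) =
      ∑ i ∈ s, rankOne ℂ (e i) (e i) := by
  classical
  have hnorm : ∀ x : ℝ, ‖(x : ℂ) - κ₀‖ = |x - κ₀| := fun x => by
    rw [← Complex.ofReal_sub, Complex.norm_real, Real.norm_eq_abs]
  have hsph : ∀ x : ℝ, |x - κ₀| ≠ r → ∀ z ∈ Metric.sphere (κ₀ : ℂ) r, z - x ≠ 0 := by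
    rintro x hx z hz h
    rw [mem_sphere_iff_norm, sub_eq_zero.1 h, hnorm] at hz
    exact hx hz
  -- The pole at 0, caused by the kernel of the finite rank operator, has to stay outside the
  -- circle.
  have h0r : r < |0 - κ₀| := by rw [zero_sub, abs_neg]; exact hr0.trans_le (le_abs_self _)
  have hne : ∀ i, |κ i - κ₀| ≠ r := fun i => by
    by_cases hi : i ∈ s
    exacts [(hs i hi).ne, (hs' i hi).ne']
  have hint : ∀ x : ℝ, |x - κ₀| ≠ r → CircleIntegrable (fun z : ℂ => (z - x)⁻¹) κ₀ r :=
    fun x hx => ContinuousOn.circleIntegrable hr.le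
      ((continuousOn_id.sub continuousOn_const).inv₀ (hsph x hx))
  have hint0 : CircleIntegrable (fun z : ℂ => z⁻¹) κ₀ r := by simpa using hint 0 h0r.ne'
  have hz0 : ∮ z in C((κ₀ : ℂ), r), z⁻¹ = 0 := by
    have := circleIntegral_sub_inv_eq_zero (c := κ₀) (w := ((0 : ℝ) : ℂ)) hr (by rwa [hnorm])
    simpa using this
  have hcoef : ∀ i, ∮ z in C((κ₀ : ℂ), r), ((z - κ i)⁻¹ - z⁻¹) =
      if i ∈ s then 2 * Real.pi * Complex.I else 0 := by
    intro i
    rw [circleIntegral.integral_sub (hint _ (hne i)) hint0, hz0, sub_zero]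
    split_ifs with hi
    · exact circleIntegral.integral_sub_inv_of_mem_ball
        (by rw [mem_ball_iff_norm, hnorm]; exact hs i hi)
    · exact circleIntegral_sub_inv_eq_zero hr (by rw [hnorm]; exact hs' i hi)
  have hcongr : (∮ z in C((κ₀ : ℂ), r),
        resolvent (∑ i, (κ i : ℂ) • rankOne ℂ (e i) (e i) : H →L[ℂ] H) z) =
      ∮ z in C((κ₀ : ℂ), r), (z⁻¹ • (1 : H →L[ℂ] H) +
        ∑ i, ((z - κ i)⁻¹ - z⁻¹) • rankOne ℂ (e i) (e i)) := by
    refine circleIntegral.integral_congr hr.le fun z hz => ?_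
    refine resolvent_sum_smul_rankOne he _ ?_ fun i => sub_ne_zero.1 (hsph _ (hne i) z hz)
    simpa using hsph 0 h0r.ne' z hz
  have hI : ∀ i, CircleIntegrable (fun z : ℂ => ((z - κ i)⁻¹ - z⁻¹) •
      (rankOne ℂ (e i) (e i) : H →L[ℂ] H)) κ₀ r := fun i => by
    refine ContinuousOn.circleIntegrable hr.le (ContinuousOn.fun_smul ?_ continuousOn_const)
    refine ((continuousOn_id.sub continuousOn_const).inv₀ (hsph _ (hne i))).sub
      (continuousOn_id.inv₀ fun z hz => ?_)
    simpa using hsph 0 h0r.ne' z hz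
  have hI0 : CircleIntegrable (fun z : ℂ => z⁻¹ • (1 : H →L[ℂ] H)) κ₀ r := by
    refine ContinuousOn.circleIntegrable hr.le (ContinuousOn.fun_smul ?_ continuousOn_const)
    exact continuousOn_id.inv₀ fun z hz => by simpa using hsph 0 h0r.ne' z hz
  have hIs : CircleIntegrable (fun z : ℂ => ∑ i, ((z - κ i)⁻¹ - z⁻¹) •
      (rankOne ℂ (e i) (e i) : H →L[ℂ] H)) κ₀ r := by
    exact CircleIntegrable.fun_sum _ fun i _ => hI i
  rw [hcongr, circleIntegral.integral_add hI0 hIs, circleIntegral.integral_smul_const, hz0,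
    zero_smul, zero_add, circleIntegral.integral_fun_sum fun i _ => hI i]
  simp only [circleIntegral.integral_smul_const, hcoef]
  rw [Finset.smul_sum]
  have h2 : (2 * Real.pi * Complex.I : ℂ) ≠ 0 := by simp [Real.pi_ne_zero, Complex.I_ne_zero]
  rw [← Finset.sum_subset (Finset.subset_univ s)]
  · refine Finset.sum_congr rfl fun i hi => ?_
    rw [if_pos hi, smul_smul, inv_mul_cancel₀ h2, one_smul]
  · intro i _ hi
    rw [if_neg hi, zero_smul, smul_zero]

end Contour
end EigenApprox

/-! ### Test functions, weak gradients and translation estimates in `H¹₀(Ω)`. -/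

namespace EigenFEM

section TestFunctions
variable {d : ℕ} {Ω : Set (Sp d)}

lemma Lp_norm_sq {α E : Type*} [MeasurableSpace α] {μ : Measure α} [NormedAddCommGroup E]
    [InnerProductSpace ℝ E] (f : Lp E 2 μ) : ‖f‖ ^ 2 = ∫ x, ‖f x‖ ^ 2 ∂μ := by
  rw [← real_inner_self_eq_norm_sq, L2.inner_def]
  simp

lemma gradient_eq_comp (φ : Sp d → ℝ) :
    gradient φ = fun x => (InnerProductSpace.toDual ℝ (Sp d)).symm (fderiv ℝ φ x) := rfl

lemma continuous_gradient {φ : Sp d → ℝ} (h : ContDiff ℝ 1 φ) : Continuous (gradient φ) := by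
  rw [gradient_eq_comp]
  exact (LinearIsometryEquiv.continuous _).comp (h.continuous_fderiv one_ne_zero)

lemma norm_gradient (φ : Sp d → ℝ) (x : Sp d) : ‖gradient φ x‖ = ‖fderiv ℝ φ x‖ := by
  rw [gradient_eq_comp, LinearIsometryEquiv.norm_map]

lemma hasCompactSupport_gradient {φ : Sp d → ℝ} (h : HasCompactSupport φ) :
    HasCompactSupport (gradient φ) := by
  rw [gradient_eq_comp]
  exact (h.fderiv ℝ).comp_left (g := (InnerProductSpace.toDual ℝ (Sp d)).symm) (map_zero _)

lemma gradient_add' {f g : Sp d → ℝ} {x : Sp d} (hf : DifferentiableAt ℝ f x)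
    (hg : DifferentiableAt ℝ g x) : gradient (f + g) x = gradient f x + gradient g x := by
  simp only [gradient_eq_comp, fderiv_add hf hg, map_add]

lemma gradient_smul' {f : Sp d → ℝ} {x : Sp d} (a : ℝ) (hf : DifferentiableAt ℝ f x) :
    gradient (a • f) x = a • gradient f x := by
  simp only [gradient_eq_comp, fderiv_const_smul hf, map_smul]

/-- Smooth functions with compact support in `Ω`. -/
structure IsTest (Ω : Set (Sp d)) (φ : Sp d → ℝ) : Prop where
  contDiff : ContDiff ℝ ∞ φ
  hasCompactSupport : HasCompactSupport φ
  tsupport_subset : tsupport φ ⊆ Ω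

namespace IsTest
variable {φ ψ : Sp d → ℝ}

lemma contDiff_one (h : IsTest Ω φ) : ContDiff ℝ 1 φ := h.contDiff.of_le (by simp)

lemma differentiable (h : IsTest Ω φ) : Differentiable ℝ φ := h.contDiff_one.differentiable one_ne_zero

lemma memLp (h : IsTest Ω φ) : MemLp φ 2 (volume.restrict Ω) :=
  (h.contDiff.continuous.memLp_of_hasCompactSupport h.hasCompactSupport).restrict _

lemma memLp_gradient (h : IsTest Ω φ) : MemLp (gradient φ) 2 (volume.restrict Ω) :=
  ((continuous_gradient h.contDiff_one).memLp_of_hasCompactSupport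
    (hasCompactSupport_gradient h.hasCompactSupport)).restrict _

/-- The element `(φ, ∇φ)` of `H¹₀(Ω)`. -/
noncomputable def pair (h : IsTest Ω φ) : L2Pair Ω := (h.memLp.toLp, h.memLp_gradient.toLp)

lemma pair_mem (h : IsTest Ω φ) : h.pair ∈ testPairs Ω :=
  ⟨φ, h.contDiff, h.hasCompactSupport, h.tsupport_subset, h.memLp.coeFn_toLp,
    h.memLp_gradient.coeFn_toLp⟩

lemma eq_zero (h : IsTest Ω φ) {x : Sp d} (hx : x ∉ Ω) : φ x = 0 :=
  image_eq_zero_of_notMem_tsupport fun h' => hx (h.tsupport_subset h')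

lemma gradient_eq_zero (h : IsTest Ω φ) {x : Sp d} (hx : x ∉ Ω) : gradient φ x = 0 := by
  have : fderiv ℝ φ x = 0 := by
    refine image_eq_zero_of_notMem_tsupport fun h' => hx (h.tsupport_subset ?_)
    exact tsupport_fderiv_subset ℝ h'
  simp [gradient_eq_comp, this]

end IsTest

lemma mem_testPairs {p : L2Pair Ω} : p ∈ testPairs Ω ↔ ∃ φ, IsTest Ω φ ∧
    p.1 =ᵐ[volume.restrict Ω] φ ∧ p.2 =ᵐ[volume.restrict Ω] gradient φ :=
  ⟨fun ⟨φ, h1, h2, h3, h4, h5⟩ => ⟨φ, ⟨h1, h2, h3⟩, h4, h5⟩,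
    fun ⟨φ, ⟨h1, h2, h3⟩, h4, h5⟩ => ⟨φ, h1, h2, h3, h4, h5⟩⟩

/-- The submodule of test functions. -/
def testSubmodule (Ω : Set (Sp d)) : Submodule ℝ (L2Pair Ω) where
  carrier := testPairs Ω
  zero_mem' := by
    refine ⟨0, contDiff_const, HasCompactSupport.zero, by simp [tsupport], Lp.coeFn_zero _ _ _, ?_⟩
    have : gradient (0 : Sp d → ℝ) = 0 := by ext x : 1; exact gradient_fun_const x 0
    rw [this]
    exact Lp.coeFn_zero _ _ _
  add_mem' := by
    rintro p p' hp hp'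
    obtain ⟨φ, h, h1, h2⟩ := mem_testPairs.1 hp
    obtain ⟨φ', h', h1', h2'⟩ := mem_testPairs.1 hp'
    refine ⟨φ + φ', h.contDiff.add h'.contDiff, h.hasCompactSupport.add h'.hasCompactSupport,
      (tsupport_add φ φ').trans (union_subset h.tsupport_subset h'.tsupport_subset),
      (Lp.coeFn_add _ _).trans (h1.add h1'), (Lp.coeFn_add _ _).trans ((h2.add h2').trans ?_)⟩
    exact .of_forall fun x => (gradient_add' (h.differentiable x) (h'.differentiable x)).symm
  smul_mem' := by
    rintro a p hp
    obtain ⟨φ, h, h1, h2⟩ := mem_testPairs.1 hp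
    refine ⟨a • φ, h.contDiff.const_smul a, h.hasCompactSupport.smul_left (f := fun _ => a),
      (tsupport_smul_subset_right (fun _ => a) φ).trans h.tsupport_subset,
      (Lp.coeFn_smul _ _).trans (h1.const_smul a), (Lp.coeFn_smul _ _).trans
        ((h2.const_smul a).trans ?_)⟩
    exact .of_forall fun x => (gradient_smul' a (h.differentiable x)).symm

lemma H10_eq : H10 Ω = (testSubmodule Ω).topologicalClosure := by
  rw [H10, show testPairs Ω = (testSubmodule Ω : Set (L2Pair Ω)) from rfl, Submodule.span_eq]

lemma isClosed_H10 : IsClosed (H10 Ω : Set (L2Pair Ω)) :=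
  Submodule.isClosed_topologicalClosure _

lemma IsTest.pair_mem_H10 {φ : Sp d → ℝ} (h : IsTest Ω φ) : h.pair ∈ H10 Ω :=
  Submodule.le_topologicalClosure _ (Submodule.subset_span h.pair_mem)

/-- Density principle: a relation between a function and its weak gradient that is closed in `L²`
need only be proved for test functions. -/
lemma H10_induction {P : L2Pair Ω → Prop} (hP : IsClosed {p | P p})
    (h : ∀ φ (hφ : IsTest Ω φ), P hφ.pair) {w : L2Pair Ω} (hw : w ∈ H10 Ω) : P w := by
  rw [H10_eq] at hw
  have hw' : w ∈ closure (testSubmodule Ω : Set (L2Pair Ω)) := hw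
  refine closure_minimal (fun p hp => ?_) hP hw'
  obtain ⟨φ, hφ, h1, h2⟩ := mem_testPairs.1 hp
  have : p = hφ.pair := Prod.ext (Lp.ext (h1.trans hφ.memLp.coeFn_toLp.symm))
    (Lp.ext (h2.trans hφ.memLp_gradient.coeFn_toLp.symm))
  rw [this]
  exact h φ hφ

lemma IsTest.norm_sq_fst {φ : Sp d → ℝ} (h : IsTest Ω φ) : ‖h.pair.1‖ ^ 2 = ∫ x, φ x ^ 2 := by
  rw [Lp_norm_sq, ← setIntegral_eq_integral_of_forall_compl_eq_zero (s := Ω)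
    (f := fun x => φ x ^ 2) fun x hx => by simp [h.eq_zero hx]]
  refine integral_congr_ae ?_
  filter_upwards [h.memLp.coeFn_toLp] with x hx
  simp [IsTest.pair, hx]

lemma IsTest.norm_sq_snd {φ : Sp d → ℝ} (h : IsTest Ω φ) :
    ‖h.pair.2‖ ^ 2 = ∫ x, ‖gradient φ x‖ ^ 2 := by
  rw [Lp_norm_sq, ← setIntegral_eq_integral_of_forall_compl_eq_zero (s := Ω)
    (f := fun x => ‖gradient φ x‖ ^ 2) fun x hx => by simp [h.gradient_eq_zero hx]]
  refine integral_congr_ae ?_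
  filter_upwards [h.memLp_gradient.coeFn_toLp] with x hx
  simp [IsTest.pair, hx]

/-! ### Weak gradients -/

lemma integral_mul_fderiv_of_hasCompactSupport {ψ g : Sp d → ℝ} (hψ : ContDiff ℝ 1 ψ)
    (hc : HasCompactSupport ψ) (hg : ContDiff ℝ 1 g) (v : Sp d) :
    ∫ x, ψ x * fderiv ℝ g x v = -∫ x, fderiv ℝ ψ x v * g x := by
  have h1 : Continuous fun x => fderiv ℝ ψ x v :=
    (hψ.continuous_fderiv one_ne_zero).clm_apply continuous_const
  have h2 : Continuous fun x => fderiv ℝ g x v :=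
    (hg.continuous_fderiv one_ne_zero).clm_apply continuous_const
  have hc1 : HasCompactSupport fun x => fderiv ℝ ψ x v := hc.fderiv_apply ℝ v
  refine integral_mul_fderiv_eq_neg_fderiv_mul_of_integrable
    ((h1.mul hg.continuous).integrable_of_hasCompactSupport hc1.mul_right)
    ((hψ.continuous.mul h2).integrable_of_hasCompactSupport hc.mul_right)
    ((hψ.continuous.mul hg.continuous).integrable_of_hasCompactSupport hc.mul_right)
    (fun x _ => hψ.differentiable one_ne_zero x) fun x _ => hg.differentiable one_ne_zero x

/-- Both sides are inner products with fixed `L²` functions, hence continuous in the pair, so the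
classical formula for test functions passes to the closure. -/
lemma H10_integral_by_parts {w : L2Pair Ω} (hw : w ∈ H10 Ω) {ψ : Sp d → ℝ} (hψ : IsTest Ω ψ)
    (v : Sp d) : ∫ x in Ω, ψ x * inner ℝ (w.2 x) v = -∫ x in Ω, fderiv ℝ ψ x v * w.1 x := by
  have hm1 : MemLp (fun x => ψ x • v) 2 (volume.restrict Ω) :=
    ((hψ.contDiff.continuous.smul continuous_const).memLp_of_hasCompactSupport
      hψ.hasCompactSupport.smul_right).restrict _
  have hm2 : MemLp (fun x => fderiv ℝ ψ x v) 2 (volume.restrict Ω) :=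
    (((hψ.contDiff_one.continuous_fderiv one_ne_zero).clm_apply
      continuous_const).memLp_of_hasCompactSupport
      (hψ.hasCompactSupport.fderiv_apply ℝ v)).restrict _
  have e1 : ∀ p : L2Pair Ω, ∫ x in Ω, ψ x * inner ℝ (p.2 x) v = inner ℝ p.2 hm1.toLp := by
    intro p
    rw [L2.inner_def]
    refine integral_congr_ae ?_
    filter_upwards [hm1.coeFn_toLp] with x hx
    rw [hx, inner_smul_right]
  have e2 : ∀ p : L2Pair Ω, ∫ x in Ω, fderiv ℝ ψ x v * p.1 x = inner ℝ p.1 hm2.toLp := by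
    intro p
    rw [L2.inner_def]
    refine integral_congr_ae ?_
    filter_upwards [hm2.coeFn_toLp] with x hx
    rw [hx]
    simp
  rw [e1, e2]
  refine H10_induction (P := fun p => inner ℝ p.2 hm1.toLp = -inner ℝ p.1 hm2.toLp) ?_ ?_ hw
  · exact isClosed_eq (by fun_prop) (by fun_prop)
  · intro φ hφ
    rw [← e1, ← e2]
    have := integral_mul_fderiv_of_hasCompactSupport hψ.contDiff_one hψ.hasCompactSupport
      hφ.contDiff_one v
    rw [← setIntegral_eq_integral_of_forall_compl_eq_zero (s := Ω)
        (f := fun x => ψ x * fderiv ℝ φ x v) (fun x hx => by simp [hψ.eq_zero hx]),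
      ← setIntegral_eq_integral_of_forall_compl_eq_zero (s := Ω)
        (f := fun x => fderiv ℝ ψ x v * φ x) (fun x hx => by simp [hφ.eq_zero hx])] at this
    refine Eq.trans (integral_congr_ae ?_) (this.trans (congrArg Neg.neg (integral_congr_ae ?_)))
    · filter_upwards [hφ.memLp_gradient.coeFn_toLp] with x hx
      simp [IsTest.pair, hx, inner_gradient_left]
    · filter_upwards [hφ.memLp.coeFn_toLp] with x hx
      simp [IsTest.pair, hx]

lemma IsTest.mono {Ω' : Set (Sp d)} (h : Ω' ⊆ Ω) {ψ : Sp d → ℝ} (hψ : IsTest Ω' ψ) : IsTest Ω ψ :=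
  ⟨hψ.1, hψ.2, hψ.3.trans h⟩

/-- The weak gradient agrees with the gradient where the function is smooth. -/
lemma weakGradient_eq {w : L2Pair Ω} (hw : w ∈ H10 Ω) {O : Set (Sp d)} (hO : IsOpen O)
    (hOΩ : O ⊆ Ω) {g : Sp d → ℝ} (hg : ContDiff ℝ 1 g) (hwg : w.1 =ᵐ[volume.restrict O] g) :
    w.2 =ᵐ[volume.restrict O] gradient g := by
  have key : ∀ v : Sp d, ∀ᵐ x, x ∈ O → inner ℝ (w.2 x) v - fderiv ℝ g x v = 0 := by
    intro v
    have hloc : LocallyIntegrableOn (fun x => inner ℝ (w.2 x) v) O volume := by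
      have h1 : LocallyIntegrable (fun x => inner ℝ (w.2 x) v) (volume.restrict Ω) :=
        ((Lp.memLp w.2).inner_const v).locallyIntegrable (by norm_num)
      refine (locallyIntegrableOn_of_locallyIntegrable_restrict ?_)
      exact h1.mono_measure (Measure.restrict_mono hOΩ le_rfl)
    have hloc2 : LocallyIntegrableOn (fun x => fderiv ℝ g x v) O volume :=
      (((hg.continuous_fderiv one_ne_zero).clm_apply
        continuous_const).locallyIntegrable).locallyIntegrableOn _
    -- Fundamental lemma of the calculus of variations: integrated against any test function in `O`,
    -- the weak and the classical derivative give the same value.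
    refine hO.ae_eq_zero_of_integral_contDiff_smul_eq_zero (hloc.sub hloc2) fun ψ h1 h2 h3 => ?_
    have hψO : IsTest O ψ := ⟨h1, h2, h3⟩
    have hψ : IsTest Ω ψ := hψO.mono hOΩ
    have i1 := H10_integral_by_parts hw hψ v
    have i2 := integral_mul_fderiv_of_hasCompactSupport hψ.contDiff_one h2 hg v
    have hrestr : ∀ f : Sp d → ℝ, (∀ x ∉ O, f x = 0) → ∫ x in Ω, f x = ∫ x in O, f x := by
      intro f hf
      rw [setIntegral_eq_integral_of_forall_compl_eq_zero fun x hx => hf x fun h => hx (hOΩ h),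
        setIntegral_eq_integral_of_forall_compl_eq_zero hf]
    have hf0 : ∀ x ∉ O, fderiv ℝ ψ x v = 0 := fun x hx => by
      have := hψO.gradient_eq_zero hx
      rw [← inner_gradient_left (f := ψ), this, inner_zero_left]
    rw [hrestr _ fun x hx => by simp [hψO.eq_zero hx], hrestr _ fun x hx => by simp [hf0 x hx]] at i1
    rw [← setIntegral_eq_integral_of_forall_compl_eq_zero (s := O)
        (f := fun x => ψ x * fderiv ℝ g x v) (fun x hx => by simp [hψO.eq_zero hx]),
      ← setIntegral_eq_integral_of_forall_compl_eq_zero (s := O)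
        (f := fun x => fderiv ℝ ψ x v * g x) (fun x hx => by simp [hf0 x hx])] at i2
    rw [← setIntegral_eq_integral_of_forall_compl_eq_zero (s := O)
      (fun x hx => by simp [hψO.eq_zero hx])]
    have i3 : ∫ x in O, fderiv ℝ ψ x v * w.1 x = ∫ x in O, fderiv ℝ ψ x v * g x :=
      integral_congr_ae (by filter_upwards [hwg] with x hx; rw [hx])
    have I1 : IntegrableOn (fun x => ψ x * inner ℝ (w.2 x) v) O := by
      have : Integrable (fun x => inner ℝ (w.2 x) v * ψ x) (volume.restrict Ω) :=
        ((Lp.memLp w.2).inner_const v).integrable_mul hψ.memLp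
      refine (this.mono_measure (Measure.restrict_mono hOΩ le_rfl)).congr (.of_forall fun x => ?_)
      simp only [mul_comm]
    have I2 : IntegrableOn (fun x => ψ x * fderiv ℝ g x v) O :=
      (((hψ.contDiff.continuous).mul ((hg.continuous_fderiv one_ne_zero).clm_apply
        continuous_const)).integrable_of_hasCompactSupport h2.mul_right).integrableOn
    simp only [smul_eq_mul, mul_sub]
    rw [integral_sub I1 I2, i1, i2, i3, sub_self]
  have key2 : ∀ᵐ x, ∀ i : Fin d, x ∈ O →
      inner ℝ (w.2 x) (EuclideanSpace.single i 1) - fderiv ℝ g x (EuclideanSpace.single i 1) = 0 :=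
    ae_all_iff.2 fun i => key _
  refine (ae_restrict_iff' hO.measurableSet).2 ?_
  filter_upwards [key2] with x hx hxO
  ext i
  have := hx i hxO
  rw [sub_eq_zero] at this
  have h2 := inner_gradient_left (f := g) (x := x) (y := EuclideanSpace.single i (1 : ℝ))
  rw [← this] at h2
  simp only [EuclideanSpace.inner_single_right, one_mul, conj_trivial] at h2
  exact h2.symm

/-- Justifies storing functions together with their gradients: the function determines its weak
gradient. -/
lemma H10_fst_injective (hΩ : IsOpen Ω) {w : L2Pair Ω} (hw : w ∈ H10 Ω) (h : w.1 = 0) : w = 0 := by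
  have h1 : w.1 =ᵐ[volume.restrict Ω] (fun _ => (0 : ℝ)) := by rw [h]; exact Lp.coeFn_zero _ _ _
  have h2 := weakGradient_eq hw hΩ subset_rfl contDiff_const h1
  refine Prod.ext h (Lp.ext (h2.trans ((Lp.coeFn_zero _ _ _).trans (.of_forall fun x => ?_)).symm))
  simp

/-! ### Translations -/

lemma hasCompactSupport_sq {f : Sp d → ℝ} (h : HasCompactSupport f) :
    HasCompactSupport fun x => f x ^ 2 := by
  simp only [sq]
  exact h.mul_right

lemma sq_integral_le {α : Type*} [MeasurableSpace α] {ν : Measure α} [IsFiniteMeasure ν] {h : α → ℝ}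
    (h1 : Integrable h ν) (h2 : Integrable (fun t => h t ^ 2) ν) :
    (∫ t, h t ∂ν) ^ 2 ≤ ν.real univ * ∫ t, h t ^ 2 ∂ν := by
  set m := ∫ t, h t ∂ν with hm
  set V := ν.real univ with hV
  rcases eq_or_ne ν 0 with rfl | hν
  · simp [hm]
  have hV0 : 0 < V := by
    rw [hV, measureReal_def]
    exact ENNReal.toReal_pos (by simpa using hν) (measure_ne_top _ _)
  -- This integrand is `V⁻¹ (V h - m)²`; expanding its integral gives the claim.
  have h0 : 0 ≤ ∫ t, (V * h t ^ 2 - 2 * m * h t + V⁻¹ * m ^ 2) ∂ν :=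
    integral_nonneg fun t => by
      have : V * h t ^ 2 - 2 * m * h t + V⁻¹ * m ^ 2 = V⁻¹ * (V * h t - m) ^ 2 := by
        field_simp
        ring
      simp only [Pi.zero_apply]
      rw [this]; positivity
  have i3 : Integrable (fun t => V * h t ^ 2 - 2 * m * h t) ν :=
    (h2.const_mul _).sub (h1.const_mul _)
  rw [integral_add i3 (integrable_const _), integral_sub (h2.const_mul _) (h1.const_mul _),
    integral_const_mul, integral_const_mul, ← hm, integral_const, ← hV, smul_eq_mul,
    ← mul_assoc, mul_inv_cancel₀ hV0.ne'] at h0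
  linarith [h0, sq m]

/-- The increment is the integral of the derivative along the segment. Cauchy–Schwarz in the segment
parameter, Fubini and translation invariance give the bound. -/
lemma integral_translate_sub_sq_le {φ : Sp d → ℝ} (hφ : ContDiff ℝ 1 φ) (hc : HasCompactSupport φ)
    (z : Sp d) : ∫ x, (φ (x + z) - φ x) ^ 2 ≤ ‖z‖ ^ 2 * ∫ x, ‖gradient φ x‖ ^ 2 := by
  set G : ℝ × Sp d → ℝ := fun p => ‖gradient φ (p.2 + p.1 • z)‖ ^ 2 with hG
  have hgc := continuous_gradient hφ
  have hGc : Continuous G :=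
    (hgc.comp (by fun_prop : Continuous fun p : ℝ × Sp d => p.2 + p.1 • z)).norm.pow 2
  have hI : Integrable (fun x => ‖gradient φ x‖ ^ 2) := by
    refine (hgc.norm.pow 2).integrable_of_hasCompactSupport ?_
    have := (hasCompactSupport_gradient hc).comp_left (g := fun y : Sp d => ‖y‖ ^ 2) (by simp)
    exact this
  have hgi : ∀ t : ℝ, ∫ x, G (t, x) = ∫ x, ‖gradient φ x‖ ^ 2 := fun t =>
    integral_add_right_eq_self (μ := volume) (fun x => ‖gradient φ x‖ ^ 2) (t • z)
  have hGi : Integrable G ((volume.restrict (Ioc (0 : ℝ) 1)).prod volume) := by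
    refine (integrable_prod_iff hGc.aestronglyMeasurable).2 ⟨.of_forall fun t => ?_, ?_⟩
    · exact hI.comp_add_right (t • z)
    · have : (fun t : ℝ => ∫ x, ‖G (t, x)‖) = fun _ => ∫ x, ‖gradient φ x‖ ^ 2 := by
        ext t
        rw [← hgi t]
        exact integral_congr_ae (.of_forall fun x => Real.norm_of_nonneg (by positivity))
      rw [this]
      exact integrable_const _
  have hpt : ∀ x, (φ (x + z) - φ x) ^ 2 ≤ ‖z‖ ^ 2 * ∫ t in Ioc (0 : ℝ) 1, G (t, x) := by
    intro x
    have hd : ∀ t : ℝ, HasDerivAt (fun t : ℝ => φ (x + t • z)) (fderiv ℝ φ (x + t • z) z) t := by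
      intro t
      have h1 : HasDerivAt (fun t : ℝ => x + t • z) z t := by
        simpa using ((hasDerivAt_id t).smul_const z).const_add x
      exact ((hφ.differentiable one_ne_zero _).hasFDerivAt).comp_hasDerivAt t h1
    have hcd : Continuous fun t : ℝ => fderiv ℝ φ (x + t • z) z :=
      ((hφ.continuous_fderiv one_ne_zero).comp (by fun_prop)).clm_apply continuous_const
    have hftc := intervalIntegral.integral_eq_sub_of_hasDerivAt (a := 0) (b := 1)
      (fun t _ => hd t) (hcd.intervalIntegrable _ _)
    rw [intervalIntegral.integral_of_le zero_le_one] at hftc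
    simp only [one_smul, zero_smul, add_zero] at hftc
    rw [← hftc, ← integral_const_mul]
    have hi1 : IntegrableOn (fun t : ℝ => fderiv ℝ φ (x + t • z) z) (Ioc 0 1) :=
      (hcd.integrableOn_Icc (a := 0) (b := 1)).mono_set Ioc_subset_Icc_self
    have hi2 : IntegrableOn (fun t : ℝ => fderiv ℝ φ (x + t • z) z ^ 2) (Ioc 0 1) :=
      ((hcd.pow 2).integrableOn_Icc (a := 0) (b := 1)).mono_set Ioc_subset_Icc_self
    have hsq := sq_integral_le hi1 hi2
    simp only [measureReal_restrict_apply_univ, Real.volume_real_Ioc, sub_zero, zero_le_one,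
      max_eq_left, one_mul] at hsq
    refine hsq.trans (integral_mono hi2 ?_ fun t => ?_)
    · exact (((hGc.comp (Continuous.prodMk_left x)).const_smul (‖z‖ ^ 2)).integrableOn_Icc
        (a := 0) (b := 1)).mono_set Ioc_subset_Icc_self
    · simp only [hG, norm_gradient]
      rw [← sq_abs, ← mul_pow, mul_comm]
      gcongr
      exact (fderiv ℝ φ (x + t • z)).le_opNorm z
  have hswap := integral_integral_swap (f := fun t x => G (t, x)) hGi
  have hright : ∫ x, ∫ t in Ioc (0 : ℝ) 1, G (t, x) = ∫ x, ‖gradient φ x‖ ^ 2 := by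
    rw [← hswap]
    simp [hgi]
  rw [← hright, ← integral_const_mul]
  refine integral_mono ?_ (hGi.integral_prod_right.const_mul _) hpt
  refine Continuous.integrable_of_hasCompactSupport (by have := hφ.continuous; fun_prop) ?_
  have h1 : HasCompactSupport fun x => φ (x + z) := hc.comp_homeomorph (Homeomorph.addRight z)
  exact hasCompactSupport_sq (h1.sub hc)

end TestFunctions
end EigenFEM

/-! ### Poincaré's inequality and Rellich's theorem. -/

namespace EigenFEM

section Rellich
variable {d : ℕ} {Ω : Set (Sp d)}

/-- A shift by twice the radius of a ball around `Ω` moves `Ω` off itself, so on `Ω` the difference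
`φ(x + z) - φ(x)` is `-φ(x)` and the translation estimate bounds `φ` itself. The assumption `1 ≤ d`
supplies a direction for the shift. -/
lemma exists_poincare (hd : 1 ≤ d) (hb : Bornology.IsBounded Ω) :
    ∃ C : ℝ, 0 < C ∧ ∀ w ∈ H10 Ω, ‖w.1‖ ≤ C * ‖w.2‖ := by
  obtain ⟨R, hR, hball⟩ := hb.subset_ball_lt 0 0
  set z : Sp d := EuclideanSpace.single ⟨0, hd⟩ (2 * R) with hz
  have hzn : ‖z‖ = 2 * R := by simp [hz, abs_of_pos hR]
  refine ⟨2 * R, by positivity, fun w hw => ?_⟩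
  refine H10_induction (P := fun w => ‖w.1‖ ≤ 2 * R * ‖w.2‖)
    (isClosed_le (by fun_prop) (by fun_prop)) (fun φ hφ => ?_) hw
  refine le_of_sq_le_sq ?_ (by positivity)
  rw [mul_pow, hφ.norm_sq_fst, hφ.norm_sq_snd, ← hzn]
  have hc := hφ.contDiff.continuous
  refine le_trans (integral_mono ?_ ?_ fun x => ?_)
    (integral_translate_sub_sq_le hφ.contDiff_one hφ.hasCompactSupport z)
  · exact (hc.pow 2).integrable_of_hasCompactSupport
      (hasCompactSupport_sq hφ.hasCompactSupport)
  · refine Continuous.integrable_of_hasCompactSupport (by fun_prop) ?_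
    have h1 : HasCompactSupport fun x => φ (x + z) :=
      hφ.hasCompactSupport.comp_homeomorph (Homeomorph.addRight z)
    exact hasCompactSupport_sq (h1.sub hφ.hasCompactSupport)
  · by_cases hx : x ∈ Ω
    · have : x + z ∉ Ω := by
        intro h
        have h1 := mem_ball_zero_iff.1 (hball hx)
        have h2 := mem_ball_zero_iff.1 (hball h)
        have h3 : ‖z‖ ≤ ‖x + z‖ + ‖x‖ := by
          simpa using norm_sub_le (x + z) x
        linarith
      simp [hφ.eq_zero this]
    · simp only [hφ.eq_zero hx, ne_eq, OfNat.ofNat_ne_zero, not_false_eq_true, zero_pow]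
      positivity

lemma isCompactOperator_rankOne {H : Type*} [NormedAddCommGroup H] [InnerProductSpace ℝ H]
    (x y : H) : IsCompactOperator (InnerProductSpace.rankOne ℝ x y) := by
  have h : IsCompactOperator (ContinuousLinearMap.toSpanSingleton ℝ x) :=
    isCompactOperator_of_locallyCompactSpace_rng (ContinuousLinearMap.toSpanSingleton ℝ x)
  exact h.comp_clm (innerSL ℝ y)

/-- The averaging operator for the sets `B i` and the weights `1_{P i} / m`. -/
noncomputable def averaging (Ω : Set (Sp d)) [IsFiniteMeasure (volume.restrict Ω)] {N : ℕ}
    {B P : Fin N → Set (Sp d)} (hB : ∀ i, MeasurableSet (B i)) (hP : ∀ i, MeasurableSet (P i))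
    (m : ℝ) : L2 Ω →L[ℝ] L2 Ω :=
  ∑ i, m⁻¹ • InnerProductSpace.rankOne ℝ
    (indicatorConstLp 2 (hP i) (measure_ne_top (volume.restrict Ω) _) (1 : ℝ))
    (indicatorConstLp 2 (hB i) (measure_ne_top (volume.restrict Ω) _) (1 : ℝ))

lemma isCompactOperator_averaging [IsFiniteMeasure (volume.restrict Ω)] {N : ℕ}
    {B P : Fin N → Set (Sp d)} (hB : ∀ i, MeasurableSet (B i)) (hP : ∀ i, MeasurableSet (P i))
    (m : ℝ) : IsCompactOperator (averaging Ω hB hP m) := by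
  have : averaging Ω hB hP m ∈ compactOperator (RingHom.id ℝ) (L2 Ω) (L2 Ω) :=
    Submodule.sum_mem _ fun i _ => Submodule.smul_mem _ _ (isCompactOperator_rankOne _ _)
  exact this

lemma coeFn_averaging [IsFiniteMeasure (volume.restrict Ω)] {N : ℕ}
    {B P : Fin N → Set (Sp d)} (hB : ∀ i, MeasurableSet (B i)) (hP : ∀ i, MeasurableSet (P i))
    (m : ℝ) (f : L2 Ω) : averaging Ω hB hP m f =ᵐ[volume.restrict Ω] fun x =>
      ∑ i, (m⁻¹ * ∫ y in B i, f y ∂(volume.restrict Ω)) * (P i).indicator (fun _ => (1 : ℝ)) x := by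
  have h1 : averaging Ω hB hP m f = ∑ i, (m⁻¹ * ∫ y in B i, f y ∂(volume.restrict Ω)) •
      indicatorConstLp 2 (hP i) (measure_ne_top (volume.restrict Ω) _) (1 : ℝ) := by
    simp [averaging, L2.inner_indicatorConstLp_one, smul_smul]
  rw [h1]
  have h2 : ∀ᵐ x ∂(volume.restrict Ω), ∀ i, indicatorConstLp 2 (hP i)
      (measure_ne_top (volume.restrict Ω) _) (1 : ℝ) x = (P i).indicator (fun _ => (1 : ℝ)) x :=
    ae_all_iff.2 fun i => indicatorConstLp_coeFn
  have h3 : ∀ᵐ x ∂(volume.restrict Ω), ∀ i, ((m⁻¹ * ∫ y in B i, f y ∂(volume.restrict Ω)) •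
      indicatorConstLp 2 (hP i) (measure_ne_top (volume.restrict Ω) _) (1 : ℝ) : L2 Ω) x =
      (m⁻¹ * ∫ y in B i, f y ∂(volume.restrict Ω)) * indicatorConstLp 2 (hP i)
      (measure_ne_top (volume.restrict Ω) _) (1 : ℝ) x :=
    ae_all_iff.2 fun i => Lp.coeFn_smul _ _
  refine (Lp.coeFn_finsetSum _ _).trans ?_
  filter_upwards [h2, h3] with x hx hx3
  simp only [Finset.sum_apply]
  exact Finset.sum_congr rfl fun i _ => by rw [hx3 i, hx i]

lemma integrable_translate_sub_sq {φ : Sp d → ℝ} (hφ : Continuous φ) (hc : HasCompactSupport φ)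
    {S S' : Set (Sp d)} [IsFiniteMeasure (volume.restrict S)]
    [IsFiniteMeasure (volume.restrict S')] :
    Integrable (fun p : Sp d × Sp d => (φ (p.1 + p.2) - φ p.1) ^ 2)
      ((volume.restrict S).prod (volume.restrict S')) := by
  obtain ⟨M, hM⟩ := hφ.bounded_above_of_compact_support hc
  refine Integrable.of_bound (C := (2 * M) ^ 2) (Continuous.aestronglyMeasurable (by fun_prop))
    (.of_forall fun p => ?_)
  rw [Real.norm_eq_abs, abs_pow]
  gcongr
  calc |φ (p.1 + p.2) - φ p.1| ≤ |φ (p.1 + p.2)| + |φ p.1| := abs_sub _ _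
    _ ≤ 2 * M := by linarith [hM (p.1 + p.2), hM p.1, Real.norm_eq_abs (φ p.1),
        Real.norm_eq_abs (φ (p.1 + p.2))]

/-- After exchanging the integrals, the translation estimate applies to each shift of length at most
`s`. -/
lemma integral_sub_average_sq_le {φ : Sp d → ℝ} (hφ : ContDiff ℝ 1 φ) (hc : HasCompactSupport φ)
    {s : ℝ} {S : Set (Sp d)} (hS : Bornology.IsBounded S) :
    ∫ x in S, (∫ z in Metric.closedBall (0 : Sp d) s, (φ (x + z) - φ x) ^ 2) ≤
      volume.real (Metric.closedBall (0 : Sp d) s) * s ^ 2 * ∫ x, ‖gradient φ x‖ ^ 2 := by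
  have : IsFiniteMeasure (volume.restrict S) := ⟨by simpa using hS.measure_lt_top⟩
  have : IsFiniteMeasure (volume.restrict (Metric.closedBall (0 : Sp d) s)) :=
    ⟨by simpa using Metric.isBounded_closedBall.measure_lt_top⟩
  have hcont := hφ.continuous
  have hint := integrable_translate_sub_sq hcont hc (S := S) (S' := Metric.closedBall (0 : Sp d) s)
  rw [integral_integral_swap (f := fun x z => (φ (x + z) - φ x) ^ 2) hint]
  have hle : ∀ z ∈ Metric.closedBall (0 : Sp d) s,
      ∫ x in S, (φ (x + z) - φ x) ^ 2 ≤ s ^ 2 * ∫ x, ‖gradient φ x‖ ^ 2 := by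
    intro z hz
    have h1 : HasCompactSupport fun x => φ (x + z) := hc.comp_homeomorph (Homeomorph.addRight z)
    refine (setIntegral_le_integral ?_ (.of_forall fun x => ?_)).trans
      ((integral_translate_sub_sq_le hφ hc z).trans ?_)
    · exact Continuous.integrable_of_hasCompactSupport (by fun_prop)
        (hasCompactSupport_sq (h1.sub hc))
    · simp only [Pi.zero_apply]; positivity
    · have : ‖z‖ ≤ s := by simpa using hz
      have : 0 ≤ ∫ x, ‖gradient φ x‖ ^ 2 := integral_nonneg fun x => by positivity
      gcongr
  refine (setIntegral_mono_on hint.integral_prod_right (integrable_const _)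
    Metric.isClosed_closedBall.measurableSet hle).trans ?_
  simp [mul_assoc]

/-- On each cell the operator returns the mean over a ball of radius `s`, and every such ball lies
in the ball of radius `2 s` around any point of the cell. Jensen bounds the error by the mean square
of the shifts up to `2 s`; enlarging the ball costs the volume ratio `2 ^ d`. -/
lemma norm_sub_averaging_le {s : ℝ} (hs : 0 < s) (hm : MeasurableSet Ω) (hb : Bornology.IsBounded Ω)
    [IsFiniteMeasure (volume.restrict Ω)] {N : ℕ} {c : Fin N → Sp d} {P : Fin N → Set (Sp d)}
    (hP : ∀ i, MeasurableSet (P i)) (hPc : ∀ i, P i ⊆ Metric.closedBall (c i) s)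
    (hdisj : Pairwise (Function.onFun Disjoint P)) (hcov : Ω ⊆ ⋃ i, P i) {w : L2Pair Ω} (hw : w ∈ H10 Ω) :
    ‖w.1 - averaging Ω (fun i => (Metric.isClosed_closedBall (x := c i) (ε := s)).measurableSet) hP
      (volume.real (Metric.closedBall (0 : Sp d) s)) w.1‖ ≤ 2 ^ d * (2 * s) * ‖w.2‖ := by
  set m := volume.real (Metric.closedBall (0 : Sp d) s) with hmdef
  have hvol : ∀ x : Sp d, volume.real (Metric.closedBall x s) = m := fun x => by
    rw [hmdef, measureReal_def, measureReal_def, Measure.addHaar_closedBall_center]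
  have hm0 : 0 < m := by
    rw [hmdef, measureReal_def]
    exact ENNReal.toReal_pos (Metric.measure_closedBall_pos _ _ hs).ne'
      Metric.isBounded_closedBall.measure_lt_top.ne
  have hm2 : volume.real (Metric.closedBall (0 : Sp d) (2 * s)) = 2 ^ d * m := by
    rw [hmdef, measureReal_def, measureReal_def, Measure.addHaar_closedBall _ _ (by positivity),
      Measure.addHaar_closedBall _ _ hs.le, mul_pow, ENNReal.ofReal_mul (by positivity)]
    simp only [ENNReal.toReal_mul, finrank_euclideanSpace, Fintype.card_fin]
    rw [ENNReal.toReal_ofReal (by positivity)]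
    ring
  set A := averaging Ω (fun i => (Metric.isClosed_closedBall (x := c i) (ε := s)).measurableSet)
    hP m with hA
  refine H10_induction (P := fun w => ‖w.1 - A w.1‖ ≤ 2 ^ d * (2 * s) * ‖w.2‖)
    (isClosed_le (by fun_prop) (by fun_prop)) (fun φ hφ => ?_) hw
  refine le_of_sq_le_sq ?_ (by positivity)
  rw [Lp_norm_sq, mul_pow, hφ.norm_sq_snd]
  have hcφ := hφ.contDiff.continuous
  have hpt : ∀ᵐ x ∂(volume.restrict Ω), ‖(hφ.pair.1 - A hφ.pair.1 : L2 Ω) x‖ ^ 2 ≤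
      m⁻¹ * ∫ z in Metric.closedBall (0 : Sp d) (2 * s), (φ (x + z) - φ x) ^ 2 := by
    filter_upwards [Lp.coeFn_sub hφ.pair.1 (A hφ.pair.1), hφ.memLp.coeFn_toLp,
      coeFn_averaging (fun i => (Metric.isClosed_closedBall (x := c i) (ε := s)).measurableSet) hP
        m hφ.pair.1, ae_restrict_mem hm] with x h1 h2 h3 hx
    obtain ⟨j, hj⟩ := mem_iUnion.1 (hcov hx)
    -- The ball may stick out of `Ω`; the test function vanishes there.
    have h4 : ∫ y in Metric.closedBall (c j) s, hφ.pair.1 y ∂(volume.restrict Ω) =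
        ∫ y in Metric.closedBall (c j) s, φ y := by
      have e0 : hφ.pair.1 =ᵐ[volume.restrict Ω] φ := hφ.memLp.coeFn_toLp
      rw [integral_congr_ae (ae_restrict_of_ae e0),
        Measure.restrict_comm Metric.isClosed_closedBall.measurableSet]
      exact setIntegral_eq_integral_of_forall_compl_eq_zero fun y hy => hφ.eq_zero hy
    have h5 : (A hφ.pair.1) x = m⁻¹ * ∫ y in Metric.closedBall (c j) s, φ y := by
      rw [h3, Finset.sum_eq_single j]
      · simp [hj, h4]
      · intro i _ hij
        have : x ∉ P i := fun h => (hdisj hij).le_bot ⟨h, hj⟩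
        simp [this]
      · simp
    have h6 : hφ.pair.1 x = φ x := h2
    rw [h1, Pi.sub_apply, h5, h6, Real.norm_eq_abs, sq_abs]
    have hfin : IsFiniteMeasure (volume.restrict (Metric.closedBall (c j) s)) :=
      ⟨by simpa using Metric.isBounded_closedBall.measure_lt_top⟩
    have i1 : IntegrableOn (fun y => φ x - φ y) (Metric.closedBall (c j) s) :=
      ContinuousOn.integrableOn_compact (isCompact_closedBall _ _) (by fun_prop)
    have i2 : IntegrableOn (fun y => (φ x - φ y) ^ 2) (Metric.closedBall (c j) s) :=
      ContinuousOn.integrableOn_compact (isCompact_closedBall _ _) (by fun_prop)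
    have hJ := sq_integral_le i1 i2
    rw [measureReal_restrict_apply_univ, hvol, integral_sub (integrable_const _)
      (hcφ.continuousOn.integrableOn_compact (isCompact_closedBall _ _)), integral_const,
      measureReal_restrict_apply_univ, hvol, smul_eq_mul] at hJ
    have e1 : φ x - m⁻¹ * ∫ y in Metric.closedBall (c j) s, φ y =
        m⁻¹ * (m * φ x - ∫ y in Metric.closedBall (c j) s, φ y) := by
      field_simp
    rw [e1, mul_pow]
    calc m⁻¹ ^ 2 * (m * φ x - ∫ y in Metric.closedBall (c j) s, φ y) ^ 2
        ≤ m⁻¹ ^ 2 * (m * ∫ y in Metric.closedBall (c j) s, (φ x - φ y) ^ 2) := by gcongr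
      _ = m⁻¹ * ∫ y in Metric.closedBall (c j) s, (φ x - φ y) ^ 2 := by field_simp
      _ ≤ m⁻¹ * ∫ y in Metric.closedBall x (2 * s), (φ x - φ y) ^ 2 := by
          refine mul_le_mul_of_nonneg_left ?_ (by positivity)
          have i3 : IntegrableOn (fun y => (φ x - φ y) ^ 2) (Metric.closedBall x (2 * s)) :=
            ContinuousOn.integrableOn_compact (isCompact_closedBall _ _) (by fun_prop)
          refine setIntegral_mono_set i3 (.of_forall fun y => ?_) (LE.le.eventuallyLE ?_)
          · simp only [Pi.zero_apply]; positivity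
          · refine Metric.closedBall_subset_closedBall' ?_
            have := hPc j hj
            rw [Metric.mem_closedBall, dist_comm] at this
            linarith
      _ = m⁻¹ * ∫ z in Metric.closedBall (0 : Sp d) (2 * s), (φ (x + z) - φ x) ^ 2 := by
          congr 1
          have := (measurePreserving_add_left volume x).setIntegral_preimage_emb
            (Homeomorph.addLeft x).measurableEmbedding (fun y => (φ x - φ y) ^ 2)
            (Metric.closedBall x (2 * s))
          rw [← this, preimage_add_closedBall, sub_self]
          refine integral_congr_ae (.of_forall fun z => ?_)
          simp only
          ring
  have hint : Integrable (fun x => ∫ z in Metric.closedBall (0 : Sp d) (2 * s),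
      (φ (x + z) - φ x) ^ 2) (volume.restrict Ω) := by
    have : IsFiniteMeasure (volume.restrict (Metric.closedBall (0 : Sp d) (2 * s))) :=
      ⟨by simpa using Metric.isBounded_closedBall.measure_lt_top⟩
    exact (integrable_translate_sub_sq hcφ hφ.hasCompactSupport).integral_prod_left
  refine (integral_mono_ae (Lp.memLp _).norm.integrable_sq (hint.const_mul _) hpt).trans ?_
  rw [integral_const_mul]
  refine (mul_le_mul_of_nonneg_left (integral_sub_average_sq_le hφ.contDiff_one
    hφ.hasCompactSupport hb) (by positivity)).trans ?_
  rw [hm2]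
  have hG : 0 ≤ ∫ x, ‖gradient φ x‖ ^ 2 := integral_nonneg fun x => by positivity
  have e2 : m⁻¹ * (2 ^ d * m * (2 * s) ^ 2 * ∫ x, ‖gradient φ x‖ ^ 2) =
      (2 ^ d * (2 * s) ^ 2) * ∫ x, ‖gradient φ x‖ ^ 2 := by field_simp
  rw [e2, mul_pow]
  gcongr
  have : (1 : ℝ) ≤ 2 ^ d := one_le_pow₀ (by norm_num)
  nlinarith

/-- Rellich's theorem, in the form of approximability by compact operators. -/
lemma exists_compact_approx (hm : MeasurableSet Ω) (hb : Bornology.IsBounded Ω) {ε : ℝ}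
    (hε : 0 < ε) : ∃ A : L2 Ω →L[ℝ] L2 Ω, IsCompactOperator A ∧
      ∀ w ∈ H10 Ω, ‖w.1 - A w.1‖ ≤ ε * ‖w.2‖ := by
  have : IsFiniteMeasure (volume.restrict Ω) := ⟨by simpa using hb.measure_lt_top⟩
  -- Makes the constant `2 ^ d * (2 * s)` of the averaging estimate equal to `ε`.
  set s := ε / (2 ^ d * 2) with hs
  have hs0 : 0 < s := by positivity
  obtain ⟨t, htf, ht⟩ := Metric.totallyBounded_iff.1 (hb.isCompact_closure.totallyBounded.subset
    subset_closure) s hs0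
  obtain ⟨N, c, hc⟩ : ∃ (N : ℕ) (c : Fin N → Sp d), range c = t := by
    obtain ⟨N, c, -, hc⟩ := htf.fin_param
    exact ⟨N, c, hc⟩
  set B : Fin N → Set (Sp d) := fun i => Metric.closedBall (c i) s with hB
  refine ⟨averaging Ω (fun i => (Metric.isClosed_closedBall (x := c i) (ε := s)).measurableSet)
    (P := disjointed B) (fun i => ?_) (volume.real (Metric.closedBall (0 : Sp d) s)),
    isCompactOperator_averaging _ _ _, fun w hw => ?_⟩
  · rw [disjointed_apply, Finset.sup_set_eq_biUnion]
    exact Metric.isClosed_closedBall.measurableSet.diff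
      (Finset.measurableSet_biUnion _ fun j _ => Metric.isClosed_closedBall.measurableSet)
  · refine (norm_sub_averaging_le hs0 hm hb _ (fun i => disjointed_subset B i)
      (disjoint_disjointed B) ?_ hw).trans ?_
    · rw [iUnion_disjointed]
      intro x hx
      obtain ⟨y, hy, hxy⟩ := mem_iUnion₂.1 (ht hx)
      rw [← hc] at hy
      obtain ⟨i, rfl⟩ := hy
      exact mem_iUnion.2 ⟨i, Metric.ball_subset_closedBall hxy⟩
    · gcongr
      rw [hs]
      apply le_of_eq
      field_simp

end Rellich
end EigenFEM

/-! ### Meshes, bounded coefficients, and `H¹₀(Ω)` as a Hilbert space with coercive energy. -/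

namespace EigenFEM

section Mesh
variable {d : ℕ} {Ω : Set (Sp d)} {K K₀ : Geometry.SimplicialComplex ℝ (Sp d)}

lemma isCompact_simplex (t : Finset (Sp d)) : IsCompact (simplex t) :=
  t.finite_toSet.isCompact_convexHull ℝ

lemma IsConformingMesh.finite_elements (h : IsConformingMesh Ω K) : (elements K).Finite :=
  h.finite.subset fun _ ht => ht.1

lemma IsConformingMesh.iUnion_simplex (h : IsConformingMesh Ω K) :
    ⋃ t ∈ elements K, simplex t = closure Ω := by
  rw [← h.space_eq]
  refine subset_antisymm (iUnion₂_subset fun t ht =>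
    Geometry.SimplicialComplex.convexHull_subset_space ht.1) fun x hx => ?_
  obtain ⟨s, hs, hxs⟩ := Geometry.SimplicialComplex.mem_space_iff.1 hx
  obtain ⟨t, ht, hst⟩ := h.pure s hs
  exact mem_iUnion₂.2 ⟨t, ht, convexHull_mono (by exact_mod_cast hst) hxs⟩

lemma IsConformingMesh.simplex_subset (h : IsConformingMesh Ω K) {t : Finset (Sp d)}
    (ht : t ∈ elements K) : simplex t ⊆ closure Ω := by
  rw [← h.iUnion_simplex]
  exact subset_biUnion_of_mem ht

lemma IsPolytopicDomain.interior_simplex_subset (hΩ : IsPolytopicDomain Ω K₀)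
    (h : IsConformingMesh Ω K) {t : Finset (Sp d)} (ht : t ∈ elements K) :
    interior (simplex t) ⊆ Ω := by
  rw [← hΩ.interior_closure]
  exact interior_mono (h.simplex_subset ht)

lemma IsPolytopicDomain.isBounded (hΩ : IsPolytopicDomain Ω K₀) : Bornology.IsBounded Ω := by
  refine Bornology.IsBounded.subset ?_ subset_closure
  rw [← hΩ.mesh.iUnion_simplex]
  exact (Bornology.isBounded_biUnion hΩ.mesh.finite_elements).2 fun t _ =>
    (isCompact_simplex t).isBounded

lemma interior_simplex_nonempty {t : Finset (Sp d)} (ht : t ∈ elements K) :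
    (interior (simplex t)).Nonempty := by
  rw [interior_convexHull_nonempty_iff_affineSpan_eq_top]
  have hi := K.indep ht.1
  have := hi.affineSpan_eq_top_iff_card_eq_finrank_add_one.2 (by
    simp [ht.2])
  simpa using this

/-- The elements cover the domain and frontiers of convex sets are null, so almost everywhere
statements can be checked in the open elements. -/
lemma IsPolytopicDomain.ae_mem_interior (hΩ : IsPolytopicDomain Ω K₀) (h : IsConformingMesh Ω K) :
    ∀ᵐ x ∂(volume.restrict Ω), ∃ t ∈ elements K, x ∈ interior (simplex t) := by
  rw [ae_restrict_iff' hΩ.isOpen.measurableSet]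
  have hf : ∀ᵐ x : Sp d, ∀ t ∈ elements K, x ∉ frontier (simplex t) :=
    (ae_ball_iff h.finite_elements.countable).2 fun t _ =>
      measure_eq_zero_iff_ae_notMem.1 ((convex_convexHull ℝ _).addHaar_frontier volume)
  filter_upwards [hf] with x hx hxΩ
  have : x ∈ ⋃ t ∈ elements K, simplex t := h.iUnion_simplex ▸ subset_closure hxΩ
  obtain ⟨t, ht, hxt⟩ := mem_iUnion₂.1 this
  refine ⟨t, ht, by_contra fun hn => hx t ht ⟨subset_closure hxt, hn⟩⟩

lemma IsPolytopicDomain.restrict_eq (hΩ : IsPolytopicDomain Ω K₀) (h : IsConformingMesh Ω K) :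
    volume.restrict Ω = volume.restrict (⋃ t ∈ elements K, interior (simplex t)) := by
  refine Measure.restrict_congr_set ?_
  have h1 := hΩ.ae_mem_interior h
  rw [ae_restrict_iff' hΩ.isOpen.measurableSet] at h1
  filter_upwards [h1] with x hx
  refine propext ⟨fun hxΩ => mem_iUnion₂.2 ?_, fun hxU => ?_⟩
  · obtain ⟨t, ht, hxt⟩ := hx hxΩ
    exact ⟨t, ht, hxt⟩
  · obtain ⟨t, ht, hxt⟩ := mem_iUnion₂.1 hxU
    exact hΩ.interior_simplex_subset h ht hxt

lemma IsPolytopicDomain.ae_of_forall_element (hΩ : IsPolytopicDomain Ω K₀)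
    (h : IsConformingMesh Ω K) {P : Sp d → Prop}
    (hP : ∀ t ∈ elements K, ∀ᵐ x ∂(volume.restrict (interior (simplex t))), P x) :
    ∀ᵐ x ∂(volume.restrict Ω), P x := by
  rw [hΩ.restrict_eq h]
  exact (ae_restrict_biUnion_iff _ h.finite_elements.countable _).2 hP

lemma restrict_simplex_eq (t : Finset (Sp d)) :
    volume.restrict (simplex t) = volume.restrict (interior (simplex t)) :=
  (Measure.restrict_congr_set (interior_ae_eq_of_null_frontier
    ((convex_convexHull ℝ _).addHaar_frontier volume))).symm

end Mesh

section Coefficients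
variable {d : ℕ} {Ω : Set (Sp d)} {K₀ : Geometry.SimplicialComplex ℝ (Sp d)}
  {A : Sp d → Matrix (Fin d) (Fin d) ℝ} {c : Sp d → ℝ}

/-- The coefficient matrix as an operator. -/
noncomputable def coefOp (A : Sp d → Matrix (Fin d) (Fin d) ℝ) (x : Sp d) : Sp d →L[ℝ] Sp d :=
  Matrix.toEuclideanCLM (n := Fin d) (𝕜 := ℝ) (A x)

/-- The operator depends linearly, hence Lipschitz continuously, on the finitely many matrix
entries. -/
lemma IsAdmissible.lipschitz_coefOp (hAc : IsAdmissible Ω K₀ A c) {t : Finset (Sp d)}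
    (ht : t ∈ elements K₀) : ∃ C : NNReal, LipschitzOnWith C (coefOp A) (interior (simplex t)) := by
  choose C hC using hAc.lipschitz t ht
  let T : (Fin d → Fin d → ℝ) →ₗ[ℝ] (Sp d →L[ℝ] Sp d) :=
    { toFun := fun M => Matrix.toEuclideanCLM (n := Fin d) (𝕜 := ℝ) M
      map_add' := fun M N => map_add (Matrix.toEuclideanCLM (n := Fin d) (𝕜 := ℝ)) M N
      map_smul' := fun a M => map_smul (Matrix.toEuclideanCLM (n := Fin d) (𝕜 := ℝ)) a M }
  have h1 : LipschitzOnWith (∑ i, ∑ j, C i j) (fun x i j => A x i j : Sp d → Fin d → Fin d → ℝ)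
      (interior (simplex t)) := by
    refine LipschitzOnWith.of_dist_le_mul fun x hx y hy => ?_
    refine (dist_pi_le_iff (by positivity)).2 fun i => (dist_pi_le_iff (by positivity)).2 fun j => ?_
    refine ((hC i j).dist_le_mul x hx y hy).trans ?_
    gcongr
    exact (Finset.single_le_sum (f := fun j => C i j) (fun _ _ => zero_le) (Finset.mem_univ j)).trans
      (Finset.single_le_sum (f := fun i => ∑ j, C i j) (fun _ _ => zero_le) (Finset.mem_univ i))
  exact ⟨_, (LinearMap.toContinuousLinearMap T).lipschitz.comp_lipschitzOnWith h1⟩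

lemma exists_norm_le_of_lipschitzOnWith {E F : Type*} [PseudoMetricSpace E] [SeminormedAddCommGroup F]
    {f : E → F} {C : NNReal} {s : Set E} (hf : LipschitzOnWith C f s) (hs : Bornology.IsBounded s) :
    ∃ M, ∀ x ∈ s, ‖f x‖ ≤ M := by
  rcases s.eq_empty_or_nonempty with rfl | ⟨y, hy⟩
  · exact ⟨0, by simp⟩
  · refine ⟨C * Metric.diam s + ‖f y‖, fun x hx => ?_⟩
    have h1 := hf.dist_le_mul x hx y hy
    have h2 := Metric.dist_le_diam_of_mem hs hx hy
    have h3 := norm_sub_norm_le (f x) (f y)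
    rw [dist_eq_norm] at h1
    nlinarith [C.coe_nonneg, mul_le_mul_of_nonneg_left h2 C.coe_nonneg]

/-- Lipschitz maps on bounded sets are bounded, and the initial mesh has finitely many elements. -/
lemma IsAdmissible.exists_norm_coefOp_le (hΩ : IsPolytopicDomain Ω K₀)
    (hAc : IsAdmissible Ω K₀ A c) :
    ∃ M, ∀ t ∈ elements K₀, ∀ x ∈ interior (simplex t), ‖coefOp A x‖ ≤ M := by
  have h : ∀ t, ∃ M, t ∈ elements K₀ → ∀ x ∈ interior (simplex t), ‖coefOp A x‖ ≤ M := by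
    intro t
    by_cases ht : t ∈ elements K₀
    · obtain ⟨C, hC⟩ := hAc.lipschitz_coefOp ht
      obtain ⟨M, hM⟩ := exists_norm_le_of_lipschitzOnWith hC
        ((isCompact_simplex t).isBounded.subset interior_subset)
      exact ⟨M, fun _ => hM⟩
    · exact ⟨0, fun h => absurd h ht⟩
  choose M hM using h
  obtain ⟨B, hB⟩ := (hΩ.mesh.finite_elements.image M).bddAbove
  exact ⟨B, fun t ht x hx => (hM t ht x hx).trans (hB ⟨t, ht, rfl⟩)⟩

lemma IsAdmissible.memLp_coefOp (hΩ : IsPolytopicDomain Ω K₀) (hAc : IsAdmissible Ω K₀ A c) :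
    MemLp (coefOp A) ⊤ (volume.restrict Ω) := by
  obtain ⟨M, hM⟩ := hAc.exists_norm_coefOp_le hΩ
  refine memLp_top_of_bound ?_ M ?_
  · rw [hΩ.restrict_eq hΩ.mesh]
    have := hΩ.mesh.finite_elements.countable.to_subtype
    rw [biUnion_eq_iUnion]
    refine aestronglyMeasurable_iUnion_iff.2 fun t => ?_
    obtain ⟨C, hC⟩ := hAc.lipschitz_coefOp t.2
    exact hC.continuousOn.aestronglyMeasurable isOpen_interior.measurableSet
  · exact hΩ.ae_of_forall_element hΩ.mesh fun t ht =>
      (ae_restrict_mem isOpen_interior.measurableSet).mono fun x hx => hM t ht x hx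

end Coefficients

section HilbertSpace
variable {d : ℕ} {Ω : Set (Sp d)} {K₀ : Geometry.SimplicialComplex ℝ (Sp d)}
  {A : Sp d → Matrix (Fin d) (Fin d) ℝ} {c : Sp d → ℝ}

/-- Pairs with the Hilbert space norm. -/
abbrev L2PairH (Ω : Set (Sp d)) := WithLp 2 (L2 Ω × Lp (Sp d) 2 (volume.restrict Ω))

/-- The identification of the two products. -/
noncomputable abbrev pairEquiv (Ω : Set (Sp d)) : L2PairH Ω ≃L[ℝ] L2Pair Ω :=
  WithLp.prodContinuousLinearEquiv 2 ℝ (L2 Ω) (Lp (Sp d) 2 (volume.restrict Ω))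

/-- `H¹₀(Ω)` with its Hilbert space structure. -/
noncomputable def H10H (Ω : Set (Sp d)) : Submodule ℝ (L2PairH Ω) :=
  (H10 Ω).comap (pairEquiv Ω).toLinearMap

instance : CompleteSpace (H10H Ω) := by
  have : IsClosed (H10H Ω : Set (L2PairH Ω)) := isClosed_H10.preimage (pairEquiv Ω).continuous
  exact this.completeSpace_coe

/-- The pair of a function in `H¹₀(Ω)` and its gradient. -/
noncomputable def toPair (Ω : Set (Sp d)) : H10H Ω →L[ℝ] L2Pair Ω :=
  (pairEquiv Ω : L2PairH Ω →L[ℝ] L2Pair Ω) ∘L (H10H Ω).subtypeL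

/-- An element of `H¹₀(Ω)` as an element of the Hilbert space. -/
noncomputable def ofPair (w : L2Pair Ω) (hw : w ∈ H10 Ω) : H10H Ω :=
  ⟨(pairEquiv Ω).symm w, by simpa [H10H] using hw⟩

lemma toPair_mem (x : H10H Ω) : toPair Ω x ∈ H10 Ω := x.2

@[simp] lemma toPair_ofPair (w : L2Pair Ω) (hw : w ∈ H10 Ω) : toPair Ω (ofPair w hw) = w := rfl

lemma toPair_injective : Function.Injective (toPair Ω) :=
  (pairEquiv Ω).injective.comp Subtype.val_injective

lemma norm_sq_H10H (x : H10H Ω) : ‖x‖ ^ 2 = ‖(toPair Ω x).1‖ ^ 2 + ‖(toPair Ω x).2‖ ^ 2 :=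
  WithLp.prod_norm_sq_eq_of_L2 x.1

/-- The function of an element of `H¹₀(Ω)`. -/
noncomputable def fstH (Ω : Set (Sp d)) : H10H Ω →L[ℝ] L2 Ω :=
  ContinuousLinearMap.fst ℝ _ _ ∘L toPair Ω

/-- The gradient of an element of `H¹₀(Ω)`. -/
noncomputable def sndH (Ω : Set (Sp d)) : H10H Ω →L[ℝ] Lp (Sp d) 2 (volume.restrict Ω) :=
  ContinuousLinearMap.snd ℝ _ _ ∘L toPair Ω

lemma fstH_injective (hΩ : IsOpen Ω) : Function.Injective (fstH Ω) := by
  refine (injective_iff_map_eq_zero _).2 fun x hx => toPair_injective ?_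
  rw [map_zero]
  exact H10_fst_injective hΩ (toPair_mem x) hx

/-- The compact operators are closed in operator norm. -/
lemma isCompactOperator_of_forall_approx {X Y : Type*} [NormedAddCommGroup X] [NormedSpace ℝ X]
    [NormedAddCommGroup Y] [NormedSpace ℝ Y] [CompleteSpace Y] {T : X →L[ℝ] Y}
    (h : ∀ ε : ℝ, 0 < ε → ∃ S : X →L[ℝ] Y, IsCompactOperator S ∧ ∀ x, ‖T x - S x‖ ≤ ε * ‖x‖) :
    IsCompactOperator T := by
  have hcl : T ∈ closure {T : X →L[ℝ] Y | IsCompactOperator T} := by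
    refine Metric.mem_closure_iff.2 fun ε hε => ?_
    obtain ⟨S, hS, hST⟩ := h (ε / 2) (half_pos hε)
    refine ⟨S, hS, ?_⟩
    rw [dist_eq_norm]
    exact lt_of_le_of_lt (ContinuousLinearMap.opNorm_le_bound _ (half_pos hε).le hST)
      (half_lt_self hε)
  exact isClosed_setOfPred_isCompactOperator.closure_subset hcl

lemma isCompactOperator_fstH (hm : MeasurableSet Ω) (hb : Bornology.IsBounded Ω) :
    IsCompactOperator (fstH Ω) := by
  refine isCompactOperator_of_forall_approx fun ε hε => ?_
  obtain ⟨B, hB, hBw⟩ := exists_compact_approx hm hb hε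
  refine ⟨B ∘L fstH Ω, hB.comp_clm (fstH Ω), fun x => (hBw _ (toPair_mem x)).trans ?_⟩
  gcongr
  refine le_of_sq_le_sq ?_ (norm_nonneg _)
  rw [norm_sq_H10H]
  linarith [sq_nonneg ‖(toPair Ω x).1‖]

/-- The bilinear form `∫ (a f, g)` on `L²` for a bounded multiplier `a`. -/
noncomputable def multForm {α 𝓐 E : Type*} [MeasurableSpace α] {μ : Measure α}
    [NormedAddCommGroup 𝓐] [NormedSpace ℝ 𝓐] [NormedAddCommGroup E] [InnerProductSpace ℝ E]
    (B : 𝓐 →L[ℝ] E →L[ℝ] E) (a : Lp 𝓐 ⊤ μ) : Lp E 2 μ →L[ℝ] Lp E 2 μ →L[ℝ] ℝ :=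
  (innerSL ℝ : Lp E 2 μ →L[ℝ] Lp E 2 μ →L[ℝ] ℝ) ∘L B.holderL μ ⊤ 2 2 a

lemma multForm_apply {α 𝓐 E : Type*} [MeasurableSpace α] {μ : Measure α}
    [NormedAddCommGroup 𝓐] [NormedSpace ℝ 𝓐] [NormedAddCommGroup E] [InnerProductSpace ℝ E]
    (B : 𝓐 →L[ℝ] E →L[ℝ] E) {a : α → 𝓐} (ha : MemLp a ⊤ μ) (f g : Lp E 2 μ) :
    Integrable (fun z => inner ℝ (B (a z) (f z)) (g z)) μ ∧
    multForm B ha.toLp f g = ∫ z, inner ℝ (B (a z) (f z)) (g z) ∂μ := by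
  have e : (fun z => inner ℝ ((B.holder 2 ha.toLp f : Lp E 2 μ) z) (g z)) =ᵐ[μ]
      fun z => inner ℝ (B (a z) (f z)) (g z) := by
    filter_upwards [B.coeFn_holder (r := 2) ha.toLp f, ha.coeFn_toLp] with z h1 h2
    rw [h1, h2]
  refine ⟨(L2.integrable_inner _ g).congr e, ?_⟩
  rw [← integral_congr_ae e, ← L2.inner_def]
  rfl

/-- The bilinear form `a` on the Hilbert space `H¹₀(Ω)`, with bounded coefficients. -/
noncomputable def energyForm (a : Lp (Sp d →L[ℝ] Sp d) ⊤ (volume.restrict Ω))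
    (γ : Lp ℝ ⊤ (volume.restrict Ω)) : H10H Ω →L[ℝ] H10H Ω →L[ℝ] ℝ :=
  (multForm (ContinuousLinearMap.id ℝ (Sp d →L[ℝ] Sp d)) a).bilinearComp (sndH Ω) (sndH Ω) +
    (multForm (ContinuousLinearMap.mul ℝ ℝ) γ).bilinearComp (fstH Ω) (fstH Ω)

lemma fstH_apply (x : H10H Ω) : fstH Ω x = (toPair Ω x).1 := rfl

lemma sndH_apply (x : H10H Ω) : sndH Ω x = (toPair Ω x).2 := rfl

set_option maxHeartbeats 1000000 in
lemma energyForm_apply_eq_add (hA : MemLp (coefOp A) ⊤ (volume.restrict Ω))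
    (hc : MemLp c ⊤ (volume.restrict Ω)) (x y : H10H Ω) :
    Integrable (fun z => inner ℝ (coefOp A z ((toPair Ω x).2 z)) ((toPair Ω y).2 z))
      (volume.restrict Ω) ∧
    Integrable (fun z => c z * (toPair Ω x).1 z * (toPair Ω y).1 z) (volume.restrict Ω) ∧
    energyForm hA.toLp hc.toLp x y =
      (∫ z in Ω, inner ℝ (coefOp A z ((toPair Ω x).2 z)) ((toPair Ω y).2 z)) +
      ∫ z in Ω, c z * (toPair Ω x).1 z * (toPair Ω y).1 z := by
  obtain ⟨h1, h2⟩ := multForm_apply (ContinuousLinearMap.id ℝ (Sp d →L[ℝ] Sp d)) hA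
    (sndH Ω x) (sndH Ω y)
  obtain ⟨h3, h4⟩ := multForm_apply (ContinuousLinearMap.mul ℝ ℝ) hc (fstH Ω x) (fstH Ω y)
  have e : (fun z => inner ℝ (ContinuousLinearMap.mul ℝ ℝ (c z) ((toPair Ω x).1 z))
      ((toPair Ω y).1 z)) = fun z => c z * (toPair Ω x).1 z * (toPair Ω y).1 z := by
    funext z
    rw [ContinuousLinearMap.mul_apply', real_inner_eq_re_inner]
    exact mul_comm _ _
  rw [fstH_apply, fstH_apply, e] at h3 h4
  rw [sndH_apply, sndH_apply] at h1 h2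
  refine ⟨h1, h3, ?_⟩
  refine Eq.trans ?_ (congrArg₂ (· + ·) h2 h4)
  rw [energyForm, add_apply, add_apply]
  rfl

lemma energyForm_apply (hA : MemLp (coefOp A) ⊤ (volume.restrict Ω))
    (hc : MemLp c ⊤ (volume.restrict Ω)) (x y : H10H Ω) :
    energyForm hA.toLp hc.toLp x y = aForm Ω A c (toPair Ω x) (toPair Ω y) := by
  obtain ⟨h1, h2, h3⟩ := energyForm_apply_eq_add hA hc x y
  rw [h3, ← integral_add h1 h2]
  rfl

lemma inner_toEuclideanCLM_comm {M : Matrix (Fin d) (Fin d) ℝ} (hM : M.IsSymm) (ξ η : Sp d) :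
    inner ℝ (Matrix.toEuclideanCLM (n := Fin d) (𝕜 := ℝ) M ξ) η =
      inner ℝ (Matrix.toEuclideanCLM (n := Fin d) (𝕜 := ℝ) M η) ξ := by
  rw [real_inner_comm, real_inner_comm ξ, Matrix.inner_toEuclideanCLM, Matrix.inner_toEuclideanCLM,
    Matrix.dotProduct_mulVec, ← Matrix.mulVec_transpose, hM.eq, dotProduct_comm]

lemma IsAdmissible.aForm_comm (hAc : IsAdmissible Ω K₀ A c) (w v : L2Pair Ω) :
    aForm Ω A c w v = aForm Ω A c v w := by
  refine integral_congr_ae ?_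
  filter_upwards [hAc.symm] with x hx
  rw [inner_toEuclideanCLM_comm hx]
  ring

set_option maxHeartbeats 1000000 in
lemma IsAdmissible.isCoercive (hd : 1 ≤ d) (hΩ : IsPolytopicDomain Ω K₀)
    (hAc : IsAdmissible Ω K₀ A c) :
    IsCoercive (energyForm (hAc.memLp_coefOp hΩ).toLp hAc.c_memLp.toLp) := by
  obtain ⟨a₀, ha₀, hell⟩ := hAc.elliptic
  obtain ⟨C, hC, hP⟩ := exists_poincare hd hΩ.isBounded
  -- Ellipticity controls the gradient and the term with `c` is nonnegative; Poincaré bounds the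
  -- full squared norm by `C ^ 2 + 1` times that of the gradient.
  refine ⟨a₀ / (C ^ 2 + 1), by positivity, fun x => ?_⟩
  obtain ⟨h1, h2, h3⟩ := energyForm_apply_eq_add (hAc.memLp_coefOp hΩ) hAc.c_memLp x x
  rw [h3]
  have i1 : a₀ * ‖(toPair Ω x).2‖ ^ 2 ≤
      ∫ z in Ω, inner ℝ (coefOp A z ((toPair Ω x).2 z)) ((toPair Ω x).2 z) := by
    rw [Lp_norm_sq, ← integral_const_mul]
    refine integral_mono_ae ((Lp.memLp _).norm.integrable_sq.const_mul _) h1 ?_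
    filter_upwards [hell] with z hz using hz _
  have i2 : 0 ≤ ∫ z in Ω, c z * (toPair Ω x).1 z * (toPair Ω x).1 z := by
    refine integral_nonneg_of_ae ?_
    filter_upwards [hAc.c_nonneg] with z hz
    simp only [Pi.zero_apply, mul_assoc]
    exact mul_nonneg hz (mul_self_nonneg _)
  have i3 : ‖x‖ ^ 2 ≤ (C ^ 2 + 1) * ‖(toPair Ω x).2‖ ^ 2 := by
    rw [norm_sq_H10H]
    have := pow_le_pow_left₀ (norm_nonneg _) (hP _ (toPair_mem x)) 2
    rw [mul_pow] at this
    linarith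
  rw [mul_assoc, ← sq, div_mul_eq_mul_div, div_le_iff₀ (by positivity)]
  nlinarith [mul_le_mul_of_nonneg_left i3 ha₀.le, sq_nonneg C]

/-- `X` is `H¹₀(Ω)` as a Hilbert space, `J` sends an element to the pair of function and weak
gradient, `ι` is the embedding into `L²(Ω)` and `a` is the energy form. -/
structure IsSobolevModel (Ω : Set (Sp d)) (A : Sp d → Matrix (Fin d) (Fin d) ℝ) (c : Sp d → ℝ)
    {X : Type*} [NormedAddCommGroup X] [InnerProductSpace ℝ X]
    (J : X →L[ℝ] L2Pair Ω) (ι : X →L[ℝ] L2 Ω) (a : X →L[ℝ] X →L[ℝ] ℝ) : Prop where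
  injective : Function.Injective J
  mem_iff : ∀ w, w ∈ H10 Ω ↔ ∃ x, J x = w
  fst : ∀ x, ι x = (J x).1
  norm_sq : ∀ x, ‖x‖ ^ 2 = ‖(J x).1‖ ^ 2 + ‖(J x).2‖ ^ 2
  form : ∀ x y, a x y = aForm Ω A c (J x) (J y)
  coercive : IsCoercive a
  compact : IsCompactOperator ι
  fst_injective : Function.Injective ι

/-- Packages the analytic facts, so that the spectral arguments run over an abstract Hilbert space
`X`. -/
lemma IsAdmissible.exists_isSobolevModel (hd : 1 ≤ d) (hΩ : IsPolytopicDomain Ω K₀)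
    (hAc : IsAdmissible Ω K₀ A c) :
    ∃ (X : Type) (_ : NormedAddCommGroup X) (_ : InnerProductSpace ℝ X) (_ : CompleteSpace X)
      (J : X →L[ℝ] L2Pair Ω) (ι : X →L[ℝ] L2 Ω) (a : X →L[ℝ] X →L[ℝ] ℝ),
      IsSobolevModel Ω A c J ι a :=
  ⟨H10H Ω, inferInstance, inferInstance, inferInstance, toPair Ω, fstH Ω,
    energyForm (hAc.memLp_coefOp hΩ).toLp hAc.c_memLp.toLp, toPair_injective,
    fun w => ⟨fun hw => ⟨ofPair w hw, toPair_ofPair w hw⟩, fun ⟨x, hx⟩ => hx ▸ toPair_mem x⟩,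
    fstH_apply, norm_sq_H10H, energyForm_apply _ _, hAc.isCoercive hd hΩ,
    isCompactOperator_fstH hΩ.isOpen.measurableSet hΩ.isBounded, fstH_injective hΩ.isOpen⟩

end HilbertSpace
end EigenFEM

/-! ### Lipschitz functions with compact support belong to `H¹₀(Ω)`. -/

namespace EigenApprox

/-- A limit of images of a bounded sequence belongs to the range. -/
lemma exists_apply_eq_of_tendsto {X Y : Type*} [NormedAddCommGroup X] [InnerProductSpace ℝ X]
    [CompleteSpace X] [NormedAddCommGroup Y] [InnerProductSpace ℝ Y] [CompleteSpace Y]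
    (ι : X →L[ℝ] Y) {x : ℕ → X} {C : ℝ} (hC : ∀ n, ‖x n‖ ≤ C) {y : Y}
    (hy : Tendsto (fun n => ι (x n)) atTop (𝓝 y)) : ∃ z, ι z = y := by
  let f : ℕ → WeakDual ℝ X := fun n => StrongDual.toWeakDual (InnerProductSpace.toDual ℝ X (x n))
  have hf : ∀ n, f n ∈ WeakDual.toStrongDual ⁻¹' Metric.closedBall (0 : StrongDual ℝ X) C := by
    intro n
    change InnerProductSpace.toDual ℝ X (x n) ∈ Metric.closedBall (0 : StrongDual ℝ X) C
    rw [mem_closedBall_zero_iff, LinearIsometryEquiv.norm_map]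
    exact hC n
  -- Banach–Alaoglu along an ultrafilter yields a weak limit without extracting a subsequence;
  -- uniqueness of limits identifies its image with `y`.
  obtain ⟨l, -, hl⟩ := (WeakDual.isCompact_closedBall (0 : StrongDual ℝ X) C).ultrafilter_le_nhds
    ((hyperfilter ℕ).map f) (by
      rw [le_principal_iff]
      exact Filter.mem_map.2 (Eventually.of_forall hf))
  have hlim : ∀ w, Tendsto (fun n => inner ℝ (x n) w) (hyperfilter ℕ : Filter ℕ) (𝓝 (l w)) :=
    fun w => ((WeakDual.eval_continuous (𝕜 := ℝ) w).tendsto l).comp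
      (show Tendsto f (hyperfilter ℕ : Filter ℕ) (𝓝 l) from hl)
  refine ⟨(InnerProductSpace.toDual ℝ X).symm (WeakDual.toStrongDual l), ?_⟩
  refine ext_inner_right ℝ fun v => ?_
  rw [← ContinuousLinearMap.adjoint_inner_right, InnerProductSpace.toDual_symm_apply]
  refine tendsto_nhds_unique (hlim (ContinuousLinearMap.adjoint ι v)) ?_
  have h2 : Tendsto (fun n => inner ℝ (ι (x n)) v) (hyperfilter ℕ : Filter ℕ) (𝓝 (inner ℝ y v)) :=
    (hy.inner tendsto_const_nhds).mono_left Nat.hyperfilter_le_atTop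
  refine h2.congr fun n => ?_
  rw [ContinuousLinearMap.adjoint_inner_right]

end EigenApprox
namespace EigenFEM
open EigenApprox

section Lipschitz
variable {d : ℕ} {Ω : Set (Sp d)}

/-- Mollification of a Lipschitz function. -/
lemma exists_isTest_approx {v : Sp d → ℝ} {L : NNReal} (hv : LipschitzWith L v)
    (hc : HasCompactSupport v) (hs : tsupport v ⊆ Ω) (hΩ : IsOpen Ω) {ε : ℝ} (hε : 0 < ε) :
    ∃ ψ, IsTest Ω ψ ∧ (∀ x, |ψ x - v x| ≤ ε) ∧ ∀ x, ‖gradient ψ x‖ ≤ L := by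
  obtain ⟨δ₁, hδ₁, hδΩ⟩ := hc.isCompact.exists_cthickening_subset_open hΩ hs
  -- The mollification radius keeps the support in `Ω` and changes the values by at most `L δ ≤ ε`.
  set δ := min δ₁ (ε / (L + 1)) with hδ
  have hδ0 : 0 < δ := by positivity
  have hδ2 : L * δ ≤ ε := by
    have h1 : δ ≤ ε / (L + 1) := min_le_right _ _
    rw [le_div_iff₀ (by positivity)] at h1
    nlinarith
  let b : ContDiffBump (0 : Sp d) := ⟨δ / 2, δ, half_pos hδ0, half_lt_self hδ0⟩
  let ρ : Sp d → ℝ := b.normed volume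
  have hρc : HasCompactSupport ρ := b.hasCompactSupport_normed
  have hρs : ContDiff ℝ ∞ ρ := b.contDiff_normed
  let ψ : Sp d → ℝ := convolution ρ v (ContinuousLinearMap.lsmul ℝ ℝ) volume
  have hψ : ∀ x, ψ x = ∫ t, ρ t * v (x - t) := fun x => rfl
  have hint : ∀ x, Integrable fun t => ρ t * v (x - t) := fun x =>
    (hρs.continuous.mul (hv.continuous.comp (continuous_const.sub continuous_id))).integrable_of_hasCompactSupport
      hρc.mul_right
  have hlip : LipschitzWith L ψ := by
    refine LipschitzWith.of_dist_le_mul fun x y => ?_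
    rw [dist_eq_norm, hψ, hψ, ← integral_sub (hint x) (hint y)]
    refine (norm_integral_le_of_norm_le (g := fun t => ρ t * (L * dist x y))
      ((hρs.continuous.integrable_of_hasCompactSupport hρc).mul_const _)
      (.of_forall fun t => ?_)).trans ?_
    · rw [← mul_sub, norm_mul, Real.norm_of_nonneg (b.nonneg_normed t), ← dist_eq_norm]
      refine mul_le_mul_of_nonneg_left ?_ (b.nonneg_normed t)
      simpa using hv.dist_le_mul (x - t) (y - t)
    · rw [integral_mul_const, b.integral_normed, one_mul]
  refine ⟨ψ, ⟨hρc.contDiff_convolution_left _ hρs hv.continuous.locallyIntegrable,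
    hρc.convolution _ hc, ?_⟩, fun x => ?_, fun x => ?_⟩
  · have h1 : Function.support ψ ⊆ Metric.cthickening δ (tsupport v) := by
      refine (support_convolution_subset _).trans ?_
      rintro _ ⟨s, hs, t, ht, rfl⟩
      have hs' : s ∈ Metric.ball (0 : Sp d) δ := by
        have := b.support_normed_eq (μ := volume) ▸ hs
        exact this
      refine Metric.mem_cthickening_of_dist_le _ t _ _ (subset_tsupport _ ht) ?_
      simpa using (mem_ball_zero_iff.1 hs').le
    exact (closure_minimal h1 Metric.isClosed_cthickening).trans
      ((Metric.cthickening_mono (min_le_left _ _) _).trans hδΩ)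
  · rw [← Real.dist_eq]
    refine b.dist_normed_convolution_le hv.continuous.aestronglyMeasurable fun y hy => ?_
    refine (hv.dist_le_mul y x).trans (le_trans ?_ hδ2)
    gcongr
    exact (Metric.mem_ball.1 hy).le
  · rw [norm_gradient]
    exact norm_fderiv_le_of_lipschitz ℝ hlip

/-- Lipschitz functions with compact support in `Ω` belong to `H¹₀(Ω)`. -/
lemma exists_mem_H10_of_lipschitz {v : Sp d → ℝ} {L : NNReal} (hv : LipschitzWith L v)
    (hc : HasCompactSupport v) (hs : tsupport v ⊆ Ω) (hΩ : IsOpen Ω)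
    (hb : Bornology.IsBounded Ω) : ∃ w ∈ H10 Ω, w.1 =ᵐ[volume.restrict Ω] v := by
  have hfin : IsFiniteMeasure (volume.restrict Ω) := ⟨by simpa using hb.measure_lt_top⟩
  have hvm : MemLp v 2 (volume.restrict Ω) :=
    (hv.continuous.memLp_of_hasCompactSupport hc).restrict _
  choose ψ hψ hψv hψg using fun n : ℕ =>
    exists_isTest_approx hv hc hs hΩ (Nat.one_div_pos_of_nat (α := ℝ) (n := n))
  set c : ℝ := measureUnivNNReal (volume.restrict Ω) ^ (2 : ENNReal).toReal⁻¹ with hcdef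
  have hc0 : 0 ≤ c := by positivity
  have h1 : ∀ n, ‖(hψ n).pair.1 - hvm.toLp‖ ≤ c * (1 / ((n : ℝ) + 1)) := fun n => by
    refine Lp.norm_le_of_ae_bound (by positivity) ?_
    filter_upwards [Lp.coeFn_sub (hψ n).pair.1 hvm.toLp, (hψ n).memLp.coeFn_toLp,
      hvm.coeFn_toLp] with x e1 e2 e3
    rw [e1, Pi.sub_apply, e3, IsTest.pair, e2]
    exact hψv n x
  have h2 : ∀ n, ‖(hψ n).pair.2‖ ≤ c * L := fun n => by
    refine Lp.norm_le_of_ae_bound L.coe_nonneg ?_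
    filter_upwards [(hψ n).memLp_gradient.coeFn_toLp] with x e
    rw [IsTest.pair, e]
    exact hψg n x
  have hlim : Tendsto (fun n => (hψ n).pair.1) atTop (𝓝 hvm.toLp) := by
    refine tendsto_iff_norm_sub_tendsto_zero.2 (squeeze_zero (fun _ => norm_nonneg _) h1 ?_)
    simpa using tendsto_one_div_add_atTop_nhds_zero_nat.const_mul c
  obtain ⟨B, hB⟩ := hlim.norm.bddAbove_range
  -- The mollifications converge in `L²` and their gradients are bounded by the Lipschitz constant.
  -- A bounded sequence in `H¹₀` suffices, so no gradient of `v` itself has to be identified.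
  obtain ⟨z, hz⟩ := exists_apply_eq_of_tendsto (fstH Ω)
    (x := fun n => ofPair (hψ n).pair (hψ n).pair_mem_H10) (C := √(B ^ 2 + (c * L) ^ 2))
    (fun n => by
      refine Real.le_sqrt_of_sq_le ?_
      rw [norm_sq_H10H, toPair_ofPair]
      exact add_le_add (pow_le_pow_left₀ (norm_nonneg _) (hB ⟨n, rfl⟩) 2)
        (pow_le_pow_left₀ (norm_nonneg _) (h2 n) 2)) hlim
  refine ⟨toPair Ω z, toPair_mem z, ?_⟩
  rw [← fstH_apply, hz]
  exact hvm.coeFn_toLp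

end Lipschitz

/-- A function that is Lipschitz on each of finitely many closed sets that cover the space is
Lipschitz. -/
lemma lipschitzWith_of_finite_closed_cover {E ι : Type*} [NormedAddCommGroup E] [NormedSpace ℝ E]
    [Finite ι] {C : ι → Set E} (hC : ∀ i, IsClosed (C i)) (hcov : ⋃ i, C i = univ) {f : E → ℝ}
    {L : NNReal} (hf : ∀ i, LipschitzOnWith L f (C i)) : LipschitzWith L f := by
  have hcont : Continuous f :=
    (locallyFinite_of_finite C).continuous hcov hC fun i => (hf i).continuousOn
  refine LipschitzWith.of_dist_le_mul fun x y => ?_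
  set p : ℝ → E := fun s => x + s • (y - x) with hp
  have hpc : Continuous p := by fun_prop
  have hpd : ∀ s s', dist (p s) (p s') = |s - s'| * dist x y := fun s s' => by
    rw [hp, dist_add_left, dist_eq_norm, ← sub_smul, norm_smul, Real.norm_eq_abs, dist_comm x,
      dist_eq_norm y]
  set S : Set ℝ := {s | dist (f (p s)) (f (p 0)) ≤ L * (s * dist x y)} with hS
  have hScl : IsClosed S := isClosed_le (by fun_prop) (by fun_prop)
  -- Continuous induction along the segment from `x` to `y`: the parameters up to which the bound
  -- holds form a closed set that can always be advanced.
  have key : Icc (0 : ℝ) 1 ⊆ S := by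
    refine (hScl.inter isClosed_Icc).Icc_subset_of_forall_exists_gt (by simp [hS]) ?_
    rintro s ⟨hsS, hs⟩ s' hs'
    -- With finitely many pieces, one of them is met arbitrarily close to the right of `s`. Being
    -- closed it contains `p s`, so its own Lipschitz bound reaches beyond `s`.
    have : ∃ i, ∃ᶠ u in 𝓝[>] s, p u ∈ C i := by
      by_contra! hcon
      obtain ⟨u, hu⟩ := (eventually_all.2 hcon).exists
      obtain ⟨i, hi⟩ := mem_iUnion.1 (hcov ▸ mem_univ (p u))
      exact hu i hi
    obtain ⟨i, hi⟩ := this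
    have hsi : p s ∈ C i := by
      have : s ∈ closure (p ⁻¹' C i) := mem_closure_iff_frequently.2 (hi.filter_mono nhdsWithin_le_nhds)
      exact ((hC i).preimage hpc).closure_subset this
    obtain ⟨u, hu, hus⟩ := (hi.and_eventually (Ioc_mem_nhdsGT hs')).exists
    refine ⟨u, ?_, hus⟩
    have h1 := (hf i).dist_le_mul _ hu _ hsi
    rw [hpd, abs_of_pos (sub_pos.2 hus.1)] at h1
    have h2 : dist (f (p s)) (f (p 0)) ≤ L * (s * dist x y) := hsS
    have h3 := dist_triangle (f (p u)) (f (p s)) (f (p 0))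
    change dist (f (p u)) (f (p 0)) ≤ L * (u * dist x y)
    nlinarith
  have h := key (right_mem_Icc.2 zero_le_one)
  simp only [hS, hp, mem_ofPred_eq, one_smul, zero_smul, add_zero, one_mul, add_sub_cancel] at h
  rwa [dist_comm]

end EigenFEM

/-! ### Finite element functions and affine interpolation on one element. -/

namespace EigenFEM
variable {d : ℕ} {Ω : Set (Sp d)} {K K₀ : Geometry.SimplicialComplex ℝ (Sp d)} {k : ℕ}
  {t : Finset (Sp d)}

/-! ### Finite element functions -/

lemma contDiff_eval (p : MvPolynomial (Fin d) ℝ) :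
    ContDiff ℝ ∞ fun x : Sp d => MvPolynomial.eval (fun i => x i) p := by
  induction p using MvPolynomial.induction_on with
  | C a => simpa using contDiff_const
  | add p q hp hq => simpa using hp.add hq
  | mul_X p i hp =>
    simp only [map_mul, MvPolynomial.eval_X]
    exact hp.mul (contDiff_piLp_apply (p := 2))

lemma IsPoly.contDiff {p : Sp d → ℝ} (hp : IsPoly k p) : ContDiff ℝ ∞ p := by
  obtain ⟨P, -, hP⟩ := hp
  rw [funext hP]
  exact contDiff_eval P

lemma isPoly_affine (hk : 1 ≤ k) (G : Sp d →L[ℝ] ℝ) (a : ℝ) : IsPoly k fun x => G x + a := by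
  refine ⟨∑ i, MvPolynomial.C (G (EuclideanSpace.single i 1)) * MvPolynomial.X i +
    MvPolynomial.C a, ?_, fun x => ?_⟩
  · refine (MvPolynomial.totalDegree_add _ _).trans (max_le ?_ (by simp))
    refine MvPolynomial.totalDegree_finsetSum_le fun i _ => ?_
    refine (MvPolynomial.totalDegree_mul _ _).trans ?_
    simpa using hk
  · have h : G x = ∑ i, G (EuclideanSpace.single i 1) * x i := by
      conv_lhs => rw [← (EuclideanSpace.basisFun (Fin d) ℝ).sum_repr x]
      simp [mul_comm]
    simp [h]

lemma gradient_eq_of_eqOn_interior {v p : Sp d → ℝ} {s : Set (Sp d)} (h : EqOn v p s) {x : Sp d}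
    (hx : x ∈ interior s) : gradient v x = gradient p x := by
  have : v =ᶠ[𝓝 x] p := by
    filter_upwards [mem_interior_iff_mem_nhds.1 hx] with y hy using h hy
  rw [gradient_eq_comp, gradient_eq_comp]
  simp only [this.fderiv_eq]

/-- The weak gradient of a finite element function is its elementwise gradient. -/
lemma weakGradient_fem (hΩ : IsPolytopicDomain Ω K₀) (hK : IsConformingMesh Ω K) {v : Sp d → ℝ}
    (hv : v ∈ femSpace Ω K k) {w : L2Pair Ω} (hw : w ∈ H10 Ω)
    (hwv : w.1 =ᵐ[volume.restrict Ω] v) : w.2 =ᵐ[volume.restrict Ω] gradient v := by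
  refine hΩ.ae_of_forall_element hK fun t ht => ?_
  obtain ⟨p, hp, hvp⟩ := hv.2.2.1 t ht
  have hsub := hΩ.interior_simplex_subset hK ht
  have h1 : w.1 =ᵐ[volume.restrict (interior (simplex t))] p := by
    filter_upwards [ae_mono (Measure.restrict_mono hsub le_rfl) hwv,
      ae_restrict_mem isOpen_interior.measurableSet] with x hx hxt
    rw [hx, hvp (interior_subset hxt)]
  filter_upwards [weakGradient_eq hw isOpen_interior hsub (hp.contDiff.of_le (by simp)) h1,
    ae_restrict_mem isOpen_interior.measurableSet] with x hx hxt
  rw [hx, gradient_eq_of_eqOn_interior hvp hxt]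

/-! ### Geometry of the elements -/

lemma diamS_le_meshSize (hK : IsConformingMesh Ω K) (ht : t ∈ elements K) :
    diamS t ≤ meshSize K :=
  le_csSup (hK.finite_elements.image _).bddAbove ⟨t, ht, rfl⟩

lemma dist_le_diamS {x y : Sp d} (hx : x ∈ simplex t) (hy : y ∈ simplex t) : dist x y ≤ diamS t :=
  Metric.dist_le_diam_of_mem (isCompact_simplex t).isBounded hx hy

lemma inDiam_set_bddAbove (hd : 1 ≤ d) (t : Finset (Sp d)) :
    BddAbove {ρ : ℝ | 0 ≤ ρ ∧ ∃ x, Metric.closedBall x ρ ⊆ simplex t} := by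
  have : Nontrivial (Sp d) := by
    have : Nonempty (Fin d) := ⟨⟨0, hd⟩⟩
    infer_instance
  refine ⟨diamS t, ?_⟩
  rintro ρ ⟨hρ, x, hx⟩
  obtain ⟨u, hu⟩ := exists_norm_eq (Sp d) hρ
  have := dist_le_diamS (hx (Metric.mem_closedBall_self hρ))
    (hx (show x + u ∈ Metric.closedBall x ρ by simp [hu]))
  simpa [hu] using this

lemma exists_closedBall_subset (hd : 1 ≤ d) (ht : t ∈ elements K) :
    0 < inDiam t ∧ ∃ x, Metric.closedBall x (inDiam t / 4) ⊆ simplex t := by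
  set S := {ρ : ℝ | 0 ≤ ρ ∧ ∃ x, Metric.closedBall x ρ ⊆ simplex t} with hS
  obtain ⟨x, hx⟩ := interior_simplex_nonempty ht
  obtain ⟨ε, hε, hεx⟩ := Metric.nhds_basis_closedBall.mem_iff.1 (mem_interior_iff_mem_nhds.1 hx)
  have hεS : ε ∈ S := ⟨hε.le, x, hεx⟩
  have hpos : 0 < sSup S := hε.trans_le (le_csSup (inDiam_set_bddAbove hd t) hεS)
  have hin : inDiam t = 2 * sSup S := rfl
  refine ⟨by rw [hin]; positivity, ?_⟩
  -- `inDiam` is twice a supremum; a ball of half the supremal radius exists without asking whether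
  -- the supremum is attained.
  obtain ⟨ρ, ⟨hρ0, y, hy⟩, hρ⟩ := exists_lt_of_lt_csSup ⟨ε, hεS⟩ (half_lt_self hpos)
  refine ⟨y, (Metric.closedBall_subset_closedBall ?_).trans hy⟩
  rw [hin]
  linarith

lemma exists_affine_interp (ht : t ∈ elements K) (φ : Sp d → ℝ) :
    ∃ (G : Sp d →L[ℝ] ℝ) (a : ℝ), ∀ x ∈ t, G x + a = φ x := by
  have htop : affineSpan ℝ (range ((↑) : t → Sp d)) = ⊤ :=
    (K.indep ht.1).affineSpan_eq_top_iff_card_eq_finrank_add_one.2 (by simp [ht.2])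
  let b : AffineBasis t ℝ (Sp d) := ⟨(↑), K.indep ht.1, htop⟩
  refine ⟨∑ i : t, φ i • LinearMap.toContinuousLinearMap (b.coord i).linear,
    ∑ i : t, φ i * b.coord i 0, fun x hx => ?_⟩
  have h1 : ∀ i, (b.coord i).linear x + b.coord i 0 = b.coord i x :=
    fun i => (congrFun (b.coord i).decomp x).symm
  have h3 : ∀ i : t, b.coord i x = if i = ⟨x, hx⟩ then 1 else 0 := fun i =>
    b.coord_apply i ⟨x, hx⟩
  simp only [sum_apply, smul_apply, LinearMap.coe_toContinuousLinearMap', smul_eq_mul,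
    ← Finset.sum_add_distrib, ← mul_add, h1, h3]
  simp

/-- Sublevel sets of the modulus of an affine function are convex. With `δ = 0` this shows that an
affine function vanishing at the vertices vanishes on the simplex. -/
lemma abs_affine_le_of_vertices {G : Sp d →L[ℝ] ℝ} {a δ : ℝ} (h : ∀ x ∈ t, |G x + a| ≤ δ)
    {x : Sp d} (hx : x ∈ simplex t) : |G x + a| ≤ δ := by
  have hconv : Convex ℝ {x : Sp d | |G x + a| ≤ δ} := by
    have : {x : Sp d | |G x + a| ≤ δ} = (G : Sp d →ₗ[ℝ] ℝ) ⁻¹' (Icc (-δ - a) (δ - a)) := by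
      ext x
      simp only [abs_le, mem_ofPred_eq, mem_preimage, mem_Icc, ContinuousLinearMap.coe_coe]
      constructor <;> rintro ⟨h1, h2⟩ <;> constructor <;> linarith
    rw [this]
    exact (convex_Icc _ _).linear_preimage _
  exact convexHull_min (fun y hy => h y hy) hconv hx

/-- An inverse estimate: comparing the values at two opposite points of the ball eliminates the
constant term. -/
lemma norm_le_of_abs_affine_le {G : Sp d →L[ℝ] ℝ} {a δ ρ : ℝ} {x : Sp d} (hρ : 0 < ρ)
    (h : ∀ y ∈ Metric.closedBall x ρ, |G y + a| ≤ δ) : ‖G‖ ≤ δ / ρ := by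
  have hδ : 0 ≤ δ := (abs_nonneg _).trans (h x (Metric.mem_closedBall_self hρ.le))
  refine G.opNorm_le_bound (by positivity) fun u => ?_
  rcases eq_or_ne u 0 with rfl | hu
  · simp
  have hu' : 0 < ‖u‖ := norm_pos_iff.2 hu
  have hn : ‖(ρ / ‖u‖) • u‖ = ρ := by
    rw [norm_smul, Real.norm_of_nonneg (by positivity), div_mul_cancel₀ _ hu'.ne']
  have h1 := h (x + (ρ / ‖u‖) • u) (by simp [hn])
  have h2 := h (x - (ρ / ‖u‖) • u) (by simp [hn])
  rw [map_add, map_smul, smul_eq_mul] at h1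
  rw [map_sub, map_smul, smul_eq_mul] at h2
  have h3 : |ρ / ‖u‖ * G u| ≤ δ := by
    rw [abs_le] at h1 h2 ⊢
    constructor <;> linarith
  rw [abs_mul, abs_of_pos (by positivity), div_mul_eq_mul_div, div_le_iff₀ hu'] at h3
  rw [Real.norm_eq_abs, div_mul_eq_mul_div, le_div_iff₀ hρ, mul_comm]
  exact h3

/-- The interpolation error on an element. -/
lemma interp_error (hd : 1 ≤ d) {φ : Sp d → ℝ} (hφ : Differentiable ℝ φ) {M γ : ℝ} (hM : 0 ≤ M)
    (hφM : ∀ x y, ‖fderiv ℝ φ x - fderiv ℝ φ y‖ ≤ M * dist x y) (ht : t ∈ elements K)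
    (hγ : diamS t ≤ γ * inDiam t) {G : Sp d →L[ℝ] ℝ} {a : ℝ} (hG : ∀ x ∈ t, G x + a = φ x)
    {x : Sp d} (hx : x ∈ simplex t) :
    |G x + a - φ x| ≤ 2 * (M * diamS t ^ 2) ∧
      ‖G - fderiv ℝ φ x‖ ≤ M * (4 * γ + 1) * diamS t := by
  have hD : 0 ≤ diamS t := Metric.diam_nonneg
  have taylor : ∀ y ∈ simplex t, |φ y - φ x - fderiv ℝ φ x (y - x)| ≤ M * diamS t ^ 2 := by
    intro y hy
    have := (convex_convexHull ℝ (t : Set (Sp d))).norm_image_sub_le_of_norm_hasFDerivWithin_le'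
      (f := φ) (f' := fderiv ℝ φ) (φ := fderiv ℝ φ x) (C := M * diamS t)
      (fun z _ => (hφ z).hasFDerivAt.hasFDerivWithinAt)
      (fun z hz => (hφM z x).trans (mul_le_mul_of_nonneg_left (dist_le_diamS hz hx) hM)) hx hy
    refine this.trans ?_
    rw [sq, ← mul_assoc, ← dist_eq_norm]
    exact mul_le_mul_of_nonneg_left (dist_le_diamS hy hx) (by positivity)
  -- `G + a` minus the Taylor polynomial of `φ` at `x` is affine and of size `M h²` at the vertices,
  -- hence on the element. On the ball of radius `inDiam / 4` this bounds its gradient by `4 M h² /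
  -- inDiam ≤ 4 γ M h`.
  set a' := a - φ x + fderiv ℝ φ x x with ha'
  have hdiff : ∀ y, (G - fderiv ℝ φ x) y + a' = (G y + a) - (φ x + fderiv ℝ φ x (y - x)) := by
    intro y
    simp only [sub_apply, map_sub, ha']
    ring
  have hall : ∀ y ∈ simplex t, |(G - fderiv ℝ φ x) y + a'| ≤ M * diamS t ^ 2 := fun y hy => by
    refine abs_affine_le_of_vertices (t := t) (fun z hz => ?_) hy
    rw [hdiff, hG z hz, ← sub_sub]
    exact taylor z (subset_convexHull ℝ _ hz)
  constructor
  · have h1 := hall x hx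
    rw [hdiff] at h1
    simp only [sub_self, map_zero, add_zero] at h1
    exact h1.trans (by nlinarith [mul_nonneg hM (sq_nonneg (diamS t))])
  · obtain ⟨hpos, y, hy⟩ := exists_closedBall_subset hd ht
    have h1 := norm_le_of_abs_affine_le (by positivity) fun z hz => hall z (hy hz)
    refine h1.trans ?_
    rw [div_le_iff₀ (by positivity)]
    nlinarith [mul_le_mul_of_nonneg_left hγ (mul_nonneg hM hD),
      mul_nonneg (mul_nonneg hM hD) hpos.le]

end EigenFEM

/-! ### Density of the finite element spaces. -/

namespace EigenFEM
variable {d : ℕ} {Ω : Set (Sp d)} {K K₀ : Geometry.SimplicialComplex ℝ (Sp d)} {k : ℕ}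

/-- The piecewise affine interpolant of a test function. -/
lemma exists_interpolant (hΩ : IsPolytopicDomain Ω K₀) (hK : IsConformingMesh Ω K) (hk : 1 ≤ k)
    {φ : Sp d → ℝ} (hφ : IsTest Ω φ) {h₀ : ℝ} (hthick : Metric.cthickening h₀ (tsupport φ) ⊆ Ω)
    (hmesh : meshSize K < h₀) :
    ∃ v ∈ femSpace Ω K k, ∀ t ∈ elements K, ∃ (G : Sp d →L[ℝ] ℝ) (a : ℝ),
      (∀ x ∈ t, G x + a = φ x) ∧ EqOn v (fun x => G x + a) (simplex t) := by
  classical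
  have hGex : ∀ t, ∃ (G : Sp d →L[ℝ] ℝ) (a : ℝ), t ∈ elements K → ∀ x ∈ t, G x + a = φ x := by
    intro t
    by_cases ht : t ∈ elements K
    · obtain ⟨G, a, h⟩ := exists_affine_interp ht φ
      exact ⟨G, a, fun _ => h⟩
    · exact ⟨0, 0, fun h => absurd h ht⟩
  choose G a hGa using hGex
  -- Conformity: two elements meet in the simplex of their common vertices, where both affine
  -- functions take the values of `φ`.
  have hcons : ∀ t ∈ elements K, ∀ t' ∈ elements K, ∀ x ∈ simplex t, x ∈ simplex t' →
      G t x + a t = G t' x + a t' := by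
    intro t ht t' ht' x hx hx'
    have hmem : x ∈ simplex (t ∩ t') := by
      have := K.inter_subset_convexHull ht.1 ht'.1 ⟨hx, hx'⟩
      rwa [← Finset.coe_inter] at this
    have := abs_affine_le_of_vertices (G := G t - G t') (a := a t - a t') (δ := 0) (t := t ∩ t')
      (fun y hy => by
        rw [Finset.mem_inter] at hy
        have h1 := hGa t ht y hy.1
        have h2 := hGa t' ht' y hy.2
        rw [sub_apply, show G t y - G t' y + (a t - a t') = 0 by linarith, abs_zero]) hmem
    rw [sub_apply] at this
    have := abs_nonpos_iff.1 this
    linarith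
  let v : Sp d → ℝ := fun x => if h : ∃ t ∈ elements K, x ∈ simplex t then G h.choose x + a h.choose
    else 0
  have hv : ∀ t ∈ elements K, ∀ x ∈ simplex t, v x = G t x + a t := by
    intro t ht x hx
    have h : ∃ t ∈ elements K, x ∈ simplex t := ⟨t, ht, hx⟩
    simp only [v, dif_pos h]
    exact hcons _ h.choose_spec.1 t ht x h.choose_spec.2 hx
  have hv0 : ∀ x ∉ closure Ω, v x = 0 := by
    intro x hx
    have h : ¬∃ t ∈ elements K, x ∈ simplex t := fun ⟨t, ht, hxt⟩ =>
      hx (hK.simplex_subset ht hxt)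
    simp only [v, dif_neg h]
  -- If the interpolant is nonzero in an element, `φ` is nonzero at one of its vertices, at distance
  -- less than `h₀`. So the support stays inside `Ω`.
  have hsupp : ∀ x, v x ≠ 0 → x ∈ Metric.thickening h₀ (tsupport φ) := by
    intro x hx
    have h : ∃ t ∈ elements K, x ∈ simplex t := by
      by_contra h
      exact hx (by simp only [v, dif_neg h])
    obtain ⟨t, ht, hxt⟩ := h
    by_contra hnot
    refine hx ?_
    rw [hv t ht x hxt, ← abs_nonpos_iff]
    refine abs_affine_le_of_vertices (fun y hy => ?_) hxt
    rw [hGa t ht y hy, abs_nonpos_iff]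
    by_contra hy0
    refine hnot (Metric.mem_thickening_iff.2 ⟨y, subset_tsupport _ hy0, ?_⟩)
    exact (dist_le_diamS hxt (subset_convexHull ℝ _ hy)).trans_lt
      ((diamS_le_meshSize hK ht).trans_lt hmesh)
  obtain ⟨B, hB⟩ := (hK.finite_elements.image fun t => ‖G t‖₊).bddAbove
  have := hK.finite_elements.to_subtype
  have hlip : LipschitzWith B v := by
    -- The closed cover consists of the elements and the complement of the thickening, where the
    -- interpolant vanishes.
    refine lipschitzWith_of_finite_closed_cover
      (C := fun o : Option (elements K) => o.elim (Metric.thickening h₀ (tsupport φ))ᶜ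
        fun t => simplex t.1) (fun o => ?_) ?_ (fun o => ?_)
    · cases o with
      | none => exact Metric.isOpen_thickening.isClosed_compl
      | some t => exact (isCompact_simplex t.1).isClosed
    · refine eq_univ_of_forall fun x => mem_iUnion.2 ?_
      by_cases hx : x ∈ closure Ω
      · rw [← hK.iUnion_simplex] at hx
        obtain ⟨t, ht, hxt⟩ := mem_iUnion₂.1 hx
        exact ⟨some ⟨t, ht⟩, hxt⟩
      · exact ⟨none, fun h => hx (subset_closure
          (hthick (Metric.thickening_subset_cthickening _ _ h)))⟩
    · cases o with
      | none =>
        have h0 : ∀ x ∈ (Metric.thickening h₀ (tsupport φ))ᶜ, v x = 0 := fun x hx => by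
          by_contra h
          exact hx (hsupp x h)
        refine LipschitzOnWith.of_dist_le_mul fun x hx y hy => ?_
        rw [h0 x hx, h0 y hy, dist_self]
        positivity
      | some t =>
        refine LipschitzOnWith.of_dist_le_mul fun x hx y hy => ?_
        rw [hv t t.2 x hx, hv t t.2 y hy, dist_add_right]
        refine ((G t).lipschitz.dist_le_mul x y).trans ?_
        gcongr
        exact hB ⟨t, t.2, rfl⟩
  have hts : tsupport v ⊆ Metric.cthickening h₀ (tsupport φ) :=
    closure_minimal (fun x hx => Metric.thickening_subset_cthickening _ _ (hsupp x hx))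
      Metric.isClosed_cthickening
  have hcs : HasCompactSupport v :=
    (hφ.hasCompactSupport.isCompact.cthickening).of_isClosed_subset (isClosed_tsupport v) hts
  refine ⟨v, ⟨hlip.continuous.continuousOn, hv0, fun t ht =>
    ⟨_, isPoly_affine hk (G t) (a t), hv t ht⟩,
    exists_mem_H10_of_lipschitz hlip hcs (hts.trans hthick) hΩ.isOpen hΩ.isBounded⟩,
    fun t ht => ⟨G t, a t, hGa t ht, hv t ht⟩⟩

/-- Density of the finite element spaces in `H¹₀(Ω)`. -/
lemma exists_fem_approx (hd : 1 ≤ d) (hΩ : IsPolytopicDomain Ω K₀) (hk : 1 ≤ k) (γ : ℝ)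
    {w : L2Pair Ω} (hw : w ∈ H10 Ω) {ε : ℝ} (hε : 0 < ε) :
    ∃ h₀ : ℝ, 0 < h₀ ∧ ∀ K : Geometry.SimplicialComplex ℝ (Sp d), IsConformingMesh Ω K →
      IsShapeRegular γ K → meshSize K < h₀ →
      ∃ v ∈ femSpace Ω K k, ∃ w' ∈ H10 Ω, w'.1 =ᵐ[volume.restrict Ω] v ∧ ‖w - w'‖ < ε := by
  have hfin : IsFiniteMeasure (volume.restrict Ω) := ⟨by simpa using hΩ.isBounded.measure_lt_top⟩
  obtain ⟨φ, hφ, hφw⟩ : ∃ φ, ∃ hφ : IsTest Ω φ, ‖w - hφ.pair‖ < ε / 2 := by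
    rw [H10_eq] at hw
    obtain ⟨p, hp, hpw⟩ := Metric.mem_closure_iff.1 hw (ε / 2) (half_pos hε)
    obtain ⟨φ, hφ, h1, h2⟩ := mem_testPairs.1 hp
    have : p = hφ.pair := Prod.ext (Lp.ext (h1.trans hφ.memLp.coeFn_toLp.symm))
      (Lp.ext (h2.trans hφ.memLp_gradient.coeFn_toLp.symm))
    exact ⟨φ, hφ, by rwa [← this, ← dist_eq_norm]⟩
  obtain ⟨M, hM⟩ := ((hφ.contDiff.of_le (by norm_cast : ((2 : ℕ) : WithTop ℕ∞) ≤ ∞)).fderiv_right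
    (m := 1) (by norm_num)).lipschitzWith_of_hasCompactSupport (hφ.hasCompactSupport.fderiv ℝ)
    one_ne_zero
  obtain ⟨h₁, hh₁, hthick⟩ :=
    hφ.hasCompactSupport.isCompact.exists_cthickening_subset_open hΩ.isOpen hφ.tsupport_subset
  set c : ℝ := measureUnivNNReal (volume.restrict Ω) ^ (2 : ENNReal).toReal⁻¹ with hcdef
  have hc0 : 0 ≤ c := by positivity
  -- Dominates both interpolation constants, `2 M` for values and `M (4 |γ| + 1)` for gradients. The
  -- bound `h ≤ 1` below replaces `h²` by `h`; the absolute value is there because no sign of `γ` is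
  -- assumed.
  set B : ℝ := M * (4 * |γ| + 2) with hBdef
  have hB0 : 0 ≤ B := by positivity
  have hsmall : 0 < min 1 (ε / (2 * (c * B + 1))) := by positivity
  refine ⟨min h₁ (min 1 (ε / (2 * (c * B + 1)))), lt_min hh₁ hsmall, fun K hK hγ hmesh => ?_⟩
  obtain ⟨v, hv, hvG⟩ := exists_interpolant hΩ hK hk hφ hthick (hmesh.trans_le (min_le_left _ _))
  obtain ⟨w', hw', hw'v⟩ := hv.2.2.2
  set h := min 1 (ε / (2 * (c * B + 1))) with hh
  have hlt : c * (B * h) < ε / 2 := by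
    have h1 : h ≤ ε / (2 * (c * B + 1)) := min_le_right _ _
    rw [le_div_iff₀ (by positivity)] at h1
    nlinarith
  have hpt : ∀ t ∈ elements K, ∀ x ∈ interior (simplex t),
      |φ x - v x| ≤ B * h ∧ ‖gradient φ x - gradient v x‖ ≤ B * h := by
    intro t ht x hx
    obtain ⟨G, a, hGa, hvt⟩ := hvG t ht
    have hdm : diamS t ≤ h :=
      ((diamS_le_meshSize hK ht).trans hmesh.le).trans (min_le_right _ _)
    have hd0 : 0 ≤ diamS t := Metric.diam_nonneg
    have hγt : diamS t ≤ |γ| * inDiam t := by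
      have hpos := (exists_closedBall_subset hd ht).1
      have := hγ t ht
      rw [div_le_iff₀ hpos] at this
      exact this.trans (mul_le_mul_of_nonneg_right (le_abs_self γ) hpos.le)
    obtain ⟨e1, e2⟩ := interp_error hd hφ.differentiable M.coe_nonneg
      (fun x y => by simpa [dist_eq_norm] using hM.dist_le_mul x y) ht hγt hGa (interior_subset hx)
    have hMγ : 0 ≤ M * |γ| := by positivity
    constructor
    · rw [hvt (interior_subset hx), abs_sub_comm]
      refine e1.trans ?_
      have h1 : diamS t ≤ 1 := hdm.trans (min_le_left _ _)
      have h2 : diamS t ^ 2 ≤ h := by nlinarith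
      rw [hBdef]
      nlinarith [mul_le_mul_of_nonneg_left h2 M.coe_nonneg, mul_nonneg hMγ hsmall.le]
    · rw [gradient_eq_of_eqOn_interior hvt hx, gradient_eq_comp, gradient_eq_comp]
      simp only
      rw [← map_sub, LinearIsometryEquiv.norm_map, norm_sub_rev,
        show fderiv ℝ (fun x => G x + a) x = G by rw [fderiv_add_const, G.fderiv]]
      refine e2.trans ?_
      rw [hBdef]
      have h3 : 0 ≤ M * (4 * |γ| + 1) := by positivity
      nlinarith [mul_le_mul_of_nonneg_left hdm h3, mul_nonneg M.coe_nonneg hsmall.le]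
  have hae := hΩ.ae_of_forall_element hK (P := fun x => |φ x - v x| ≤ B * h ∧
    ‖gradient φ x - gradient v x‖ ≤ B * h) fun t ht =>
      (ae_restrict_mem isOpen_interior.measurableSet).mono (hpt t ht)
  have hBh : 0 ≤ B * h := mul_nonneg hB0 hsmall.le
  have n1 : ‖hφ.pair.1 - w'.1‖ ≤ c * (B * h) := by
    refine Lp.norm_le_of_ae_bound hBh ?_
    filter_upwards [Lp.coeFn_sub hφ.pair.1 w'.1, hφ.memLp.coeFn_toLp, hw'v, hae] with x e1 e2 e3 e4
    rw [e1, Pi.sub_apply, e3, IsTest.pair, e2]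
    exact e4.1
  have n2 : ‖hφ.pair.2 - w'.2‖ ≤ c * (B * h) := by
    refine Lp.norm_le_of_ae_bound hBh ?_
    filter_upwards [Lp.coeFn_sub hφ.pair.2 w'.2, hφ.memLp_gradient.coeFn_toLp,
      weakGradient_fem hΩ hK hv hw' hw'v, hae] with x e1 e2 e3 e4
    rw [e1, Pi.sub_apply, e3, IsTest.pair, e2]
    exact e4.2
  refine ⟨v, hv, w', hw', hw'v, ?_⟩
  have n3 : ‖hφ.pair - w'‖ ≤ c * (B * h) := max_le n1 n2
  have := norm_sub_le_norm_sub_add_norm_sub w hφ.pair w'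
  linarith

end EigenFEM

/-! ### Transfer of eigenvalues, multiplicities and discrete eigenpairs to the Hilbert space. -/

namespace EigenFEM
open EigenApprox

section Model
variable {d : ℕ} {Ω : Set (Sp d)} {K K₀ : Geometry.SimplicialComplex ℝ (Sp d)} {k : ℕ}
  {A : Sp d → Matrix (Fin d) (Fin d) ℝ} {c : Sp d → ℝ}
  {X : Type*} [NormedAddCommGroup X] [InnerProductSpace ℝ X] [CompleteSpace X]
  {J : X →L[ℝ] L2Pair Ω} {ι : X →L[ℝ] L2 Ω} {a : X →L[ℝ] X →L[ℝ] ℝ}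

lemma inner_eq_bForm {f g : L2 Ω} {u v : Sp d → ℝ} (hf : f =ᵐ[volume.restrict Ω] u)
    (hg : g =ᵐ[volume.restrict Ω] v) : inner ℝ f g = bForm Ω u v := by
  rw [L2.inner_def, bForm]
  refine integral_congr_ae ?_
  filter_upwards [hf, hg] with x h1 h2
  rw [h1, h2]
  exact mul_comm _ _

lemma bForm_self {f g : L2 Ω} : bForm Ω f g = inner ℝ f g :=
  (inner_eq_bForm (.refl _ _) (.refl _ _)).symm

namespace IsSobolevModel

lemma exists_of_mem (h : IsSobolevModel Ω A c J ι a) {w : L2Pair Ω} (hw : w ∈ H10 Ω) :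
    ∃ x, J x = w := (h.mem_iff w).1 hw

lemma mem (h : IsSobolevModel Ω A c J ι a) (x : X) : J x ∈ H10 Ω := (h.mem_iff _).2 ⟨x, rfl⟩

/-- `L2Pair` carries the maximum norm and `X` the Euclidean one; the factor `√2` is rounded up to 2.
-/
lemma norm_lt (h : IsSobolevModel Ω A c J ι a) {x : X} {ε : ℝ} (hε : ‖J x‖ < ε) :
    ‖x‖ < 2 * ε := by
  have h1 : ‖(J x).1‖ < ε := (norm_fst_le (J x)).trans_lt hε
  have h2 : ‖(J x).2‖ < ε := (norm_snd_le (J x)).trans_lt hε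
  have h3 := h.norm_sq x
  refine lt_of_pow_lt_pow_left₀ 2 (by linarith [norm_nonneg (J x)]) ?_
  nlinarith [norm_nonneg (J x).1, norm_nonneg (J x).2]

/-- Bump functions supported in infinitely many disjoint open subsets of `Ω` are nonzero and
orthogonal in `L²`. -/
lemma not_finiteDimensional (h : IsSobolevModel Ω A c J ι a) (hd : 1 ≤ d) (hΩ : IsOpen Ω)
    (hne : Ω.Nonempty) : ¬FiniteDimensional ℝ X := by
  intro hfd
  have : Nonempty (Fin d) := ⟨⟨0, hd⟩⟩
  have : Infinite Ω := by
    obtain ⟨x, hx⟩ := hne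
    exact ((infinite_of_mem_nhds x (hΩ.mem_nhds hx))).to_subtype
  obtain ⟨U, hUi, hUo, hUd⟩ := exists_seq_infinite_isOpen_pairwise_disjoint Ω
  have hO : ∀ n, IsOpen ((↑) '' U n : Set (Sp d)) := fun n =>
    hΩ.isOpenEmbedding_subtypeVal.isOpenMap _ (hUo n)
  have hOΩ : ∀ n, ((↑) '' U n : Set (Sp d)) ⊆ Ω := fun n => Subtype.coe_image_subset _ _
  have hex : ∀ n, ∃ ψ : Sp d → ℝ, IsTest ((↑) '' U n) ψ ∧ ∃ x ∈ Ω, ψ x ≠ 0 := by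
    intro n
    obtain ⟨x, hx⟩ := (hUi n).nonempty
    obtain ⟨ψ, h1, h2, h3, -, h5⟩ := exists_contDiff_tsupport_subset (n := ⊤)
      ((hO n).mem_nhds (mem_image_of_mem _ hx))
    exact ⟨ψ, ⟨h3, h2, h1⟩, x, x.2, by simp [h5]⟩
  choose ψ hψ x hxΩ hx using hex
  have hψΩ := fun n => (hψ n).mono (hOΩ n)
  choose z hz using fun n => h.exists_of_mem (hψΩ n).pair_mem_H10
  have hι : ∀ n, ι (z n) =ᵐ[volume.restrict Ω] ψ n := fun n => by
    rw [h.fst, hz]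
    exact (hψΩ n).memLp.coeFn_toLp
  have hli : LinearIndependent ℝ fun n => ι (z n) := by
    refine linearIndependent_of_ne_zero_of_inner_eq_zero (fun n h0 => hx n ?_) fun i j hij => ?_
    · have h1 : ψ n =ᵐ[volume.restrict Ω] 0 := by
        refine (hι n).symm.trans ?_
        rw [h0]
        exact Lp.coeFn_zero _ _ _
      exact Measure.eqOn_open_of_ae_eq h1 hΩ (hψ n).contDiff.continuous.continuousOn
        continuousOn_const (hxΩ n)
    · change inner ℝ (ι (z i)) (ι (z j)) = 0
      rw [inner_eq_bForm (hι i) (hι j), bForm]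
      have h0 : ∀ y, ψ i y * ψ j y = 0 := by
        intro y
        by_contra hne
        obtain ⟨p, hp, rfl⟩ : y ∈ ((↑) '' U i : Set (Sp d)) := by
          by_contra hy
          exact hne (by rw [(hψ i).eq_zero hy, zero_mul])
        obtain ⟨p', hp', hpp⟩ : (p : Sp d) ∈ ((↑) '' U j : Set (Sp d)) := by
          by_contra hy
          exact hne (by rw [(hψ j).eq_zero hy, mul_zero])
        rw [Subtype.coe_injective hpp] at hp'
        exact disjoint_left.1 (hUd hij) hp hp'
      simp [h0]
  have hli' : LinearIndependent ℝ z := LinearIndependent.of_comp (ι : X →ₗ[ℝ] L2 Ω) hli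
  exact Infinite.not_finite hli'.finite

lemma mem_eigX_iff (h : IsSobolevModel Ω A c J ι a) {μ : ℝ} {x : X} :
    x ∈ eigX ι a μ ↔ J x ∈ eigenspace Ω A c μ := by
  rw [mem_eigX]
  constructor
  · refine fun hx => ⟨h.mem x, fun v hv => ?_⟩
    obtain ⟨y, rfl⟩ := h.exists_of_mem hv
    rw [← h.form, hx y, bForm_self, h.fst, h.fst]
  · rintro ⟨-, hx⟩ y
    rw [h.form, hx _ (h.mem y), bForm_self, h.fst, h.fst]

lemma image_eigX (h : IsSobolevModel Ω A c J ι a) (μ : ℝ) :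
    J '' (eigX ι a μ : Set X) = eigenspace Ω A c μ := by
  ext w
  constructor
  · rintro ⟨x, hx, rfl⟩
    exact h.mem_eigX_iff.1 hx
  · intro hw
    obtain ⟨x, rfl⟩ := h.exists_of_mem hw.1
    exact ⟨x, h.mem_eigX_iff.2 hw, rfl⟩

lemma isEigenvalue_iff (h : IsSobolevModel Ω A c J ι a) {μ : ℝ} :
    IsEigenvalue Ω A c μ ↔ eigX ι a μ ≠ ⊥ := by
  rw [Submodule.ne_bot_iff, IsEigenvalue, ← h.image_eigX]
  constructor
  · rintro ⟨_, ⟨x, hx, rfl⟩, h0⟩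
    exact ⟨x, hx, fun hx0 => h0 (by rw [hx0, map_zero])⟩
  · rintro ⟨x, hx, h0⟩
    exact ⟨J x, ⟨x, hx, rfl⟩, fun hJ => h0 (h.injective (by rw [hJ, map_zero]))⟩

lemma multiplicity_eq (h : IsSobolevModel Ω A c J ι a) (μ : ℝ) :
    multiplicity Ω A c μ = Module.finrank ℝ (eigX ι a μ) := by
  rw [multiplicity, Set.finrank, ← h.image_eigX]
  change Module.finrank ℝ (Submodule.span ℝ ((J : X →ₗ[ℝ] L2Pair Ω) '' (eigX ι a μ : Set X))) = _
  rw [Submodule.span_image, Submodule.span_eq]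
  exact (Submodule.equivMapOfInjective _ h.injective _).finrank_eq.symm

lemma numBelow_eq (h : IsSobolevModel Ω A c J ι a) (lam : ℝ) :
    numBelow Ω A c lam = Module.finrank ℝ (⨆ μ : Iio lam, eigX ι a μ : Submodule ℝ X) := by
  have hset : {w : L2Pair Ω | ∃ μ' < lam, w ∈ eigenspace Ω A c μ'} =
      (J : X →ₗ[ℝ] L2Pair Ω) '' (⋃ μ : Iio lam, (eigX ι a μ : Set X)) := by
    ext w
    simp only [image_iUnion, mem_iUnion, mem_ofPred_eq]
    constructor
    · rintro ⟨μ, hμ, hw⟩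
      exact ⟨⟨μ, hμ⟩, by rw [← h.image_eigX] at hw; exact hw⟩
    · rintro ⟨⟨μ, hμ⟩, hw⟩
      exact ⟨μ, hμ, by rw [← h.image_eigX]; exact hw⟩
  rw [numBelow, Set.finrank, hset, Submodule.span_image, ← Submodule.iSup_eq_span]
  exact (Submodule.equivMapOfInjective _ h.injective _).finrank_eq.symm

/-- A finite element function as an element of the Hilbert space. -/
lemma exists_of_fem (h : IsSobolevModel Ω A c J ι a) (hΩ : IsPolytopicDomain Ω K₀)
    (hK : IsConformingMesh Ω K) {v : Sp d → ℝ} (hv : v ∈ femSpace Ω K k) :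
    ∃ x, ι x =ᵐ[volume.restrict Ω] v ∧ (J x).2 =ᵐ[volume.restrict Ω] gradient v := by
  obtain ⟨w, hw, hwv⟩ := hv.2.2.2
  obtain ⟨x, rfl⟩ := h.exists_of_mem hw
  exact ⟨x, by rw [h.fst]; exact hwv, weakGradient_fem hΩ hK hv hw hwv⟩

lemma form_eq_aFormFE (h : IsSobolevModel Ω A c J ι a) {x y : X} {u v : Sp d → ℝ}
    (hx : ι x =ᵐ[volume.restrict Ω] u) (hx' : (J x).2 =ᵐ[volume.restrict Ω] gradient u)
    (hy : ι y =ᵐ[volume.restrict Ω] v) (hy' : (J y).2 =ᵐ[volume.restrict Ω] gradient v) :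
    a x y = aFormFE Ω A c u v := by
  rw [h.form]
  rw [h.fst] at hx hy
  refine integral_congr_ae ?_
  filter_upwards [hx, hx', hy, hy'] with z h1 h2 h3 h4
  rw [h1, h2, h3, h4]

/-- The weak gradient of a finite element function is its piecewise gradient, so the forms `aFormFE`
and `a` agree and the discrete problem becomes an abstract Galerkin problem. -/
lemma exists_isGalerkinEigenbasis (h : IsSobolevModel Ω A c J ι a) (hΩ : IsPolytopicDomain Ω K₀)
    (hK : IsConformingMesh Ω K) {n : ℕ} {Λ : Fin n → ℝ} {φ : Fin n → Sp d → ℝ}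
    (hφ : IsDiscreteEigenbasis Ω A c K k Λ φ) :
    ∃ x : Fin n → X, IsGalerkinEigenbasis ι a Λ x ∧ (∀ i, ι (x i) =ᵐ[volume.restrict Ω] φ i) ∧
      ∀ v ∈ femSpace Ω K k, ∀ y, ι y =ᵐ[volume.restrict Ω] v →
        y ∈ Submodule.span ℝ (range x) := by
  have hmem : ∀ i, φ i ∈ femSpace Ω K k := fun i => by
    rw [← hφ.span]
    exact Submodule.subset_span ⟨i, rfl⟩
  choose x hx hx' using fun i => h.exists_of_fem hΩ hK (hmem i)
  refine ⟨x, ⟨hφ.mono, ?_, fun i v hv => ?_⟩, hx, fun v hv y hy => ?_⟩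
  · rw [orthonormal_iff_ite]
    intro i j
    rw [inner_eq_bForm (hx i) (hx j)]
    exact hφ.orthonormal i j
  · induction hv using Submodule.span_induction with
    | mem v hv =>
      obtain ⟨j, rfl⟩ := hv
      rw [h.form_eq_aFormFE (hx i) (hx' i) (hx j) (hx' j), hφ.eigen i _ (hmem j),
        inner_eq_bForm (hx i) (hx j)]
    | zero => simp
    | add v w _ _ h1 h2 => simp only [map_add, inner_add_right, h1, h2, mul_add]
    | smul s v _ h1 =>
      simp only [map_smul, smul_eq_mul, h1, real_inner_smul_right]
      ring
  · rw [← hφ.span] at hv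
    obtain ⟨s, rfl⟩ := (Submodule.mem_span_range_iff_exists_fun ℝ).1 hv
    refine (Submodule.mem_span_range_iff_exists_fun ℝ).2 ⟨s, h.fst_injective (Lp.ext ?_)⟩
    refine EventuallyEq.trans ?_ hy.symm
    rw [map_sum]
    refine (Lp.coeFn_finsetSum _ _).trans ?_
    have hall : ∀ᵐ z ∂(volume.restrict Ω), ∀ i, ι (x i) z = φ i z :=
      (ae_all_iff (ι := Fin n)).2 hx
    have hall' : ∀ᵐ z ∂(volume.restrict Ω), ∀ i, ι (s i • x i) z = s i * ι (x i) z :=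
      (ae_all_iff (ι := Fin n)).2 fun i => by
        rw [map_smul]
        exact Lp.coeFn_smul _ _
    filter_upwards [hall, hall'] with z h1 h2
    simp only [Finset.sum_apply, h2, h1, Pi.smul_apply, smul_eq_mul]

end IsSobolevModel

/-- Finite element functions are determined by their values almost everywhere. -/
lemma fem_eq_of_ae_eq (hΩ : IsOpen Ω) {u v : Sp d → ℝ} (hu : u ∈ femSpace Ω K k)
    (hv : v ∈ femSpace Ω K k) (h : u =ᵐ[volume.restrict Ω] v) : u = v := by
  have h1 : EqOn u v Ω := Measure.eqOn_open_of_ae_eq h hΩ (hu.1.mono subset_closure)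
    (hv.1.mono subset_closure)
  have h2 : EqOn u v (closure Ω) := h1.of_subset_closure hu.1 hv.1 subset_closure subset_rfl
  funext x
  by_cases hx : x ∈ closure Ω
  · exact h2 hx
  · rw [hu.2.1 x hx, hv.2.1 x hx]

end Model
end EigenFEM

/-! ### Complexification, the discrete solution operator and the projection `E_h`. -/

namespace EigenFEM
open EigenApprox

section Complexification
variable {α : Type*} [MeasurableSpace α] {μ : Measure α}

/-- The complexification of a real `L²` function. -/
noncomputable def complexify (f : Lp ℝ 2 μ) : Lp ℂ 2 μ := Complex.ofRealCLM.compLp f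

lemma coeFn_complexify (f : Lp ℝ 2 μ) : complexify f =ᵐ[μ] fun x => (f x : ℂ) :=
  Complex.ofRealCLM.coeFn_compLp f

lemma coeFn_re (f : Lp ℂ 2 μ) : Complex.reCLM.compLp f =ᵐ[μ] fun x => (f x).re :=
  Complex.reCLM.coeFn_compLp f

lemma coeFn_im (f : Lp ℂ 2 μ) : Complex.imCLM.compLp f =ᵐ[μ] fun x => (f x).im :=
  Complex.imCLM.coeFn_compLp f

lemma inner_complexify_left (g : Lp ℝ 2 μ) (f : Lp ℂ 2 μ) :
    inner ℂ (complexify g) f = (inner ℝ g (Complex.reCLM.compLp f) : ℂ) +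
      (inner ℝ g (Complex.imCLM.compLp f) : ℂ) * Complex.I := by
  have h1 := L2.integrable_inner (𝕜 := ℝ) g (Complex.reCLM.compLp f)
  have h2 := L2.integrable_inner (𝕜 := ℝ) g (Complex.imCLM.compLp f)
  rw [L2.inner_def, L2.inner_def, L2.inner_def, ← integral_complex_ofReal,
    ← integral_complex_ofReal, ← integral_mul_const,
    ← integral_add h1.ofReal (h2.ofReal.mul_const _)]
  refine integral_congr_ae ?_
  filter_upwards [coeFn_complexify g, coeFn_re f, coeFn_im f] with x e1 e2 e3
  rw [e1, e2, e3]
  apply Complex.ext <;> simp [mul_comm]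

lemma inner_complexify (g f : Lp ℝ 2 μ) :
    inner ℂ (complexify g) (complexify f) = (inner ℝ g f : ℂ) := by
  have h1 : Complex.reCLM.compLp (complexify f) = f := Lp.ext <| by
    filter_upwards [coeFn_re (complexify f), coeFn_complexify f] with x e1 e2
    rw [e1, e2, Complex.ofReal_re]
  have h2 : Complex.imCLM.compLp (complexify f) = 0 := Lp.ext <| by
    filter_upwards [coeFn_im (complexify f), coeFn_complexify f, Lp.coeFn_zero ℝ 2 μ] with x e1 e2 e3
    rw [e1, e2, e3, Complex.ofReal_im]
    rfl
  rw [inner_complexify_left, h1, h2]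
  simp

lemma orthonormal_complexify {κ : Type*} {e : κ → Lp ℝ 2 μ} (he : Orthonormal ℝ e) :
    Orthonormal ℂ fun i => complexify (e i) := by
  classical
  rw [orthonormal_iff_ite] at he ⊢
  intro i j
  rw [inner_complexify, he i j]
  split_ifs <;> simp

/-- A combination of complexified functions, pointwise. -/
lemma coeFn_sum_smul_complexify {κ : Type*} [Finite κ] (s : Finset κ) (e : κ → Lp ℝ 2 μ)
    {φ : κ → α → ℝ} (he : ∀ i, e i =ᵐ[μ] φ i) (b b' : κ → ℝ) :
    (∑ i ∈ s, ((b i : ℂ) + (b' i : ℂ) * Complex.I) • complexify (e i) : Lp ℂ 2 μ) =ᵐ[μ]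
      fun x => (((∑ i ∈ s, b i • φ i) x : ℝ) : ℂ) + (((∑ i ∈ s, b' i • φ i) x : ℝ) : ℂ) *
        Complex.I := by
  refine (Lp.coeFn_finsetSum _ _).trans ?_
  have h1 : ∀ᵐ z ∂μ, ∀ i, (((b i : ℂ) + (b' i : ℂ) * Complex.I) • complexify (e i) : Lp ℂ 2 μ) z =
      ((b i : ℂ) + (b' i : ℂ) * Complex.I) * (φ i z : ℂ) := ae_all_iff.2 fun i => by
    filter_upwards [Lp.coeFn_smul ((b i : ℂ) + (b' i : ℂ) * Complex.I) (complexify (e i)),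
      coeFn_complexify (e i), he i] with z e1 e2 e3
    rw [e1, Pi.smul_apply, e2, e3, smul_eq_mul]
  filter_upwards [h1] with z hz
  simp only [Finset.sum_apply, hz, Pi.smul_apply, smul_eq_mul, Complex.ofReal_sum,
    Complex.ofReal_mul, Finset.sum_mul, ← Finset.sum_add_distrib]
  refine Finset.sum_congr rfl fun i _ => ?_
  ring

lemma sum_rankOne_complexify {κ : Type*} (s : Finset κ) (e : κ → Lp ℝ 2 μ) (w : Lp ℝ 2 μ) :
    (∑ i ∈ s, InnerProductSpace.rankOne ℂ (complexify (e i)) (complexify (e i)))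
      (complexify w) =
      ∑ i ∈ s, (((inner ℝ (e i) w : ℝ) : ℂ) + ((0 : ℝ) : ℂ) * Complex.I) • complexify (e i) := by
  rw [sum_apply]
  refine Finset.sum_congr rfl fun i _ => ?_
  rw [InnerProductSpace.rankOne_apply, inner_complexify]
  simp

end Complexification

section Discrete
variable {d : ℕ} {Ω : Set (Sp d)} {K K₀ : Geometry.SimplicialComplex ℝ (Sp d)} {k : ℕ}
  {A : Sp d → Matrix (Fin d) (Fin d) ℝ} {c : Sp d → ℝ}
  {X : Type*} [NormedAddCommGroup X] [InnerProductSpace ℝ X] [CompleteSpace X]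
  {J : X →L[ℝ] L2Pair Ω} {ι : X →L[ℝ] L2 Ω} {a : X →L[ℝ] X →L[ℝ] ℝ}
  {n : ℕ} {Λ : Fin n → ℝ} {φ : Fin n → Sp d → ℝ} {x : Fin n → X}

/-- The solution of the discrete source problem in terms of the discrete eigenpairs. -/
lemma galerkin_solution_eq (hs : ∀ x y, a x y = a y x) (hx : IsGalerkinEigenbasis ι a Λ x)
    (hΛ : ∀ i, Λ i ≠ 0) {y : X} (hy : y ∈ Submodule.span ℝ (range x)) {g : L2 Ω}
    (hg : ∀ i, a y (x i) = inner ℝ g (ι (x i))) :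
    ι y = ∑ i, ((Λ i)⁻¹ * inner ℝ (ι (x i)) g) • ι (x i) := by
  rw [← hx.sum_inner_smul hy]
  refine Finset.sum_congr rfl fun i _ => ?_
  congr 1
  have h1 := hg i
  rw [hs, hx.eigen i y hy, ← real_inner_comm g (ι (x i))] at h1
  rw [← h1, inv_mul_cancel_left₀ (hΛ i)]

lemma galerkin_solution_apply (hx : IsGalerkinEigenbasis ι a Λ x)
    (hΛ : ∀ i, Λ i ≠ 0) {v : X} (hv : v ∈ Submodule.span ℝ (range x)) (g : L2 Ω) :
    a (∑ i, ((Λ i)⁻¹ * inner ℝ (ι (x i)) g) • x i) v = inner ℝ g (ι v) := by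
  conv_rhs => rw [← hx.sum_inner_smul hv]
  rw [map_sum, sum_apply, inner_sum]
  refine Finset.sum_congr rfl fun i _ => ?_
  rw [map_smul, smul_apply, smul_eq_mul, hx.eigen i v hv, real_inner_smul_right,
    real_inner_comm g]
  field_simp [hΛ i]

/-- The discrete solution operator in terms of the discrete eigenpairs. -/
noncomputable def discreteOp (ι : X →L[ℝ] L2 Ω) (Λ : Fin n → ℝ) (x : Fin n → X) :
    L2C Ω →L[ℂ] L2C Ω :=
  ∑ i, (((Λ i)⁻¹ : ℝ) : ℂ) • InnerProductSpace.rankOne ℂ (complexify (ι (x i)))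
    (complexify (ι (x i)))

lemma discreteOp_apply (f : L2C Ω) : discreteOp ι Λ x f =
    ∑ i, (((((Λ i)⁻¹ * inner ℝ (ι (x i)) (Complex.reCLM.compLp f) : ℝ)) : ℂ) +
      (((Λ i)⁻¹ * inner ℝ (ι (x i)) (Complex.imCLM.compLp f) : ℝ) : ℂ) * Complex.I) •
        complexify (ι (x i)) := by
  rw [discreteOp, sum_apply]
  refine Finset.sum_congr rfl fun i _ => ?_
  rw [smul_apply, InnerProductSpace.rankOne_apply, smul_smul, inner_complexify_left]
  congr 1
  push_cast
  ring

lemma sum_smul_mem_fem (hφ : IsDiscreteEigenbasis Ω A c K k Λ φ) (s : Finset (Fin n))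
    (b : Fin n → ℝ) : ∑ i ∈ s, b i • φ i ∈ femSpace Ω K k := by
  rw [← hφ.span]
  exact Submodule.sum_mem _ fun i _ => Submodule.smul_mem _ _ (Submodule.subset_span ⟨i, rfl⟩)

lemma coeFn_map_sum (hxφ : ∀ i, ι (x i) =ᵐ[volume.restrict Ω] φ i) (b : Fin n → ℝ) :
    ι (∑ i, b i • x i) =ᵐ[volume.restrict Ω] ∑ i, b i • φ i := by
  rw [map_sum]
  refine (Lp.coeFn_finsetSum _ _).trans ?_
  have h1 : ∀ᵐ z ∂(volume.restrict Ω), ∀ i, ι (b i • x i) z = b i * φ i z :=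
    ae_all_iff.2 fun i => by
      filter_upwards [hxφ i, Lp.coeFn_smul (b i) (ι (x i))] with z e1 e2
      rw [map_smul, e2, Pi.smul_apply, e1, smul_eq_mul]
  filter_upwards [h1] with z e1
  simp only [Finset.sum_apply, e1, Pi.smul_apply, smul_eq_mul]

namespace IsSobolevModel

lemma isDiscreteSolutionOperator (h : IsSobolevModel Ω A c J ι a) (hΩ : IsPolytopicDomain Ω K₀)
    (hK : IsConformingMesh Ω K) (hφ : IsDiscreteEigenbasis Ω A c K k Λ φ)
    (hx : IsGalerkinEigenbasis ι a Λ x) (hxφ : ∀ i, ι (x i) =ᵐ[volume.restrict Ω] φ i)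
    (hxm : ∀ v ∈ femSpace Ω K k, ∀ y, ι y =ᵐ[volume.restrict Ω] v →
      y ∈ Submodule.span ℝ (range x)) :
    IsDiscreteSolutionOperator Ω A c K k (discreteOp ι Λ x) := by
  have hΛ : ∀ i, Λ i ≠ 0 := fun i => (hx.pos h.coercive i).ne'
  have key : ∀ (g : L2 Ω), ∀ v ∈ femSpace Ω K k,
      aFormFE Ω A c (∑ i, ((Λ i)⁻¹ * inner ℝ (ι (x i)) g) • φ i) v = bForm Ω g v := by
    intro g v hv
    have hp := sum_smul_mem_fem hφ Finset.univ fun i => (Λ i)⁻¹ * inner ℝ (ι (x i)) g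
    obtain ⟨y, hy, hy'⟩ := h.exists_of_fem hΩ hK hp
    obtain ⟨z, hz, hz'⟩ := h.exists_of_fem hΩ hK hv
    rw [← h.form_eq_aFormFE hy hy' hz hz', ← inner_eq_bForm (.refl _ _) hz,
      ← galerkin_solution_apply hx hΛ (hxm v hv z hz) g]
    congr 2
    exact h.fst_injective (Lp.ext (hy.trans (coeFn_map_sum hxφ _).symm))
  intro f
  refine ⟨_, sum_smul_mem_fem hφ Finset.univ fun i =>
      (Λ i)⁻¹ * inner ℝ (ι (x i)) (Complex.reCLM.compLp f), _,
    sum_smul_mem_fem hφ Finset.univ fun i =>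
      (Λ i)⁻¹ * inner ℝ (ι (x i)) (Complex.imCLM.compLp f), ?_, fun v hv => ⟨?_, ?_⟩⟩
  · rw [discreteOp_apply]
    exact coeFn_sum_smul_complexify _ _ hxφ _ _
  · rw [key _ v hv]
    refine integral_congr_ae ?_
    filter_upwards [coeFn_re f] with z e1
    rw [e1]
  · rw [key _ v hv]
    refine integral_congr_ae ?_
    filter_upwards [coeFn_im f] with z e1
    rw [e1]

/-- Uniqueness of Galerkin solutions: testing with the eigenfunctions determines all coefficients of
`T f`. This identifies the operator that `Classical.epsilon` selects. -/
lemma eq_discreteOp (h : IsSobolevModel Ω A c J ι a) (hAc : IsAdmissible Ω K₀ A c)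
    (hΩ : IsPolytopicDomain Ω K₀)
    (hK : IsConformingMesh Ω K) (hφ : IsDiscreteEigenbasis Ω A c K k Λ φ)
    (hx : IsGalerkinEigenbasis ι a Λ x) (hxφ : ∀ i, ι (x i) =ᵐ[volume.restrict Ω] φ i)
    (hxm : ∀ v ∈ femSpace Ω K k, ∀ y, ι y =ᵐ[volume.restrict Ω] v →
      y ∈ Submodule.span ℝ (range x)) {T : L2C Ω →L[ℂ] L2C Ω}
    (hT : IsDiscreteSolutionOperator Ω A c K k T) : T = discreteOp ι Λ x := by
  have hΛ : ∀ i, Λ i ≠ 0 := fun i => (hx.pos h.coercive i).ne'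
  have hsymm : ∀ y z, a y z = a z y := fun y z => by rw [h.form, h.form, hAc.aForm_comm]
  have hmem : ∀ i, φ i ∈ femSpace Ω K k := fun i => by
    rw [← hφ.span]
    exact Submodule.subset_span ⟨i, rfl⟩
  choose z hz hz' using fun i => h.exists_of_fem hΩ hK (hmem i)
  have hzx : ∀ i, z i = x i := fun i => h.fst_injective (Lp.ext ((hz i).trans (hxφ i).symm))
  have key : ∀ (g : L2 Ω), ∀ p ∈ femSpace Ω K k,
      (∀ v ∈ femSpace Ω K k, aFormFE Ω A c p v = bForm Ω g v) →
      p =ᵐ[volume.restrict Ω] ∑ i, ((Λ i)⁻¹ * inner ℝ (ι (x i)) g) • φ i := by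
    intro g p hp hpv
    obtain ⟨y, hy, hy'⟩ := h.exists_of_fem hΩ hK hp
    have := galerkin_solution_eq hsymm hx hΛ (hxm p hp y hy) (g := g) fun i => by
      rw [← hzx i, h.form_eq_aFormFE hy hy' (hz i) (hz' i), hpv _ (hmem i),
        inner_eq_bForm (.refl _ _) (hz i)]
    refine hy.symm.trans ?_
    rw [this]
    simp only [← map_smul, ← map_sum]
    exact coeFn_map_sum hxφ _
  ext1 f
  obtain ⟨p, hp, s, hs, hps, hv⟩ := hT f
  refine Lp.ext (hps.trans ?_)
  rw [discreteOp_apply]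
  refine EventuallyEq.trans ?_ (coeFn_sum_smul_complexify _ _ hxφ _ _).symm
  have h1 := key (Complex.reCLM.compLp f) p hp fun v hvm => by
    rw [(hv v hvm).1]
    refine integral_congr_ae ?_
    filter_upwards [coeFn_re f] with z e1
    rw [e1]
  have h2 := key (Complex.imCLM.compLp f) s hs fun v hvm => by
    rw [(hv v hvm).2]
    refine integral_congr_ae ?_
    filter_upwards [coeFn_im f] with z e1
    rw [e1]
  filter_upwards [h1, h2] with z e1 e2
  rw [e1, e2]

/-- The spectral projection of a real function is a sum over the discrete eigenfunctions to
eigenvalues in the circle. -/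
lemma projE_eq (h : IsSobolevModel Ω A c J ι a) (hAc : IsAdmissible Ω K₀ A c)
    (hΩ : IsPolytopicDomain Ω K₀)
    (hK : IsConformingMesh Ω K) (hφ : IsDiscreteEigenbasis Ω A c K k Λ φ)
    (hx : IsGalerkinEigenbasis ι a Λ x) (hxφ : ∀ i, ι (x i) =ᵐ[volume.restrict Ω] φ i)
    (hxm : ∀ v ∈ femSpace Ω K k, ∀ y, ι y =ᵐ[volume.restrict Ω] v →
      y ∈ Submodule.span ℝ (range x)) {κ₀ r : ℝ} (hr : 0 < r) (hr0 : r < κ₀)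
    (s : Finset (Fin n)) (hs : ∀ i ∈ s, |(Λ i)⁻¹ - κ₀| < r) (hs' : ∀ i ∉ s, r < |(Λ i)⁻¹ - κ₀|)
    (w : L2 Ω) : projE Ω A c K k κ₀ r w = ∑ i ∈ s, (inner ℝ (ι (x i)) w : ℝ) • φ i := by
  have hT : discreteSolutionOperator Ω A c K k = discreteOp ι Λ x :=
    h.eq_discreteOp hAc hΩ hK hφ hx hxφ hxm
      (Classical.epsilon_spec ⟨_, h.isDiscreteSolutionOperator hΩ hK hφ hx hxφ hxm⟩)
  have hE : spectralProjection Ω A c K k κ₀ r = ∑ i ∈ s,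
      InnerProductSpace.rankOne ℂ (complexify (ι (x i))) (complexify (ι (x i))) := by
    have h1 := contour_resolvent_sum_smul_rankOne (orthonormal_complexify hx.orthonormal)
      (fun i => (Λ i)⁻¹) hr hr0 s hs hs'
    exact (congrArg (fun T : L2C Ω →L[ℂ] L2C Ω => (2 * Real.pi * Complex.I : ℂ)⁻¹ •
      ∮ z in C((κ₀ : ℂ), r), resolvent T z) hT).trans h1
  have hEw : spectralProjection Ω A c K k κ₀ r (Complex.ofRealCLM.compLp w)
      =ᵐ[volume.restrict Ω] fun z => ((∑ i ∈ s, (inner ℝ (ι (x i)) w : ℝ) • φ i) z : ℂ) := by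
    have e : spectralProjection Ω A c K k κ₀ r (Complex.ofRealCLM.compLp w) =
        ∑ i ∈ s, (((inner ℝ (ι (x i)) w : ℝ) : ℂ) + ((0 : ℝ) : ℂ) * Complex.I) •
          complexify (ι (x i)) := by
      rw [hE]
      exact sum_rankOne_complexify s _ w
    rw [e]
    refine (coeFn_sum_smul_complexify s _ hxφ _ fun _ => 0).trans (.of_forall fun z => ?_)
    simp
  -- The explicit sum shows that a finite element representative exists; continuity then makes it
  -- unique as a function.
  have hspec := Classical.epsilon_spec (p := fun v => v ∈ femSpace Ω K k ∧
    (spectralProjection Ω A c K k κ₀ r (Complex.ofRealCLM.compLp w)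
      =ᵐ[volume.restrict Ω] fun x => (v x : ℂ))) ⟨_, sum_smul_mem_fem hφ s _, hEw⟩
  refine fem_eq_of_ae_eq hΩ.isOpen hspec.1 (sum_smul_mem_fem hφ s _) ?_
  filter_upwards [hspec.2, hEw] with z e1 e2
  exact Complex.ofReal_injective (e1.symm.trans e2)

end IsSobolevModel
end Discrete
end EigenFEM

/-! ### Measures, polynomial projections and quadratic estimates. -/

namespace EigenFEM

/-! ### Finiteness of the face measure -/

section FaceMeasure
variable {d : ℕ}

/-- Barycentric coordinates without the one of `x₀` exhibit the simplex as part of a Lipschitz image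
of the unit cube in dimension `n`. -/
lemma hausdorffMeasure_convexHull_lt_top {n : ℕ} {e : Finset (Sp d)} (he : e.card = n + 1) :
    μH[(n : ℝ)] (convexHull ℝ (e : Set (Sp d))) < ⊤ := by
  classical
  obtain ⟨x₀, hx₀⟩ : e.Nonempty := Finset.card_pos.1 (by omega)
  have hcard : Fintype.card (e.erase x₀) = n := by
    rw [Fintype.card_coe, Finset.card_erase_of_mem hx₀, he, Nat.add_sub_cancel]
  let L : ((e.erase x₀) → ℝ) →L[ℝ] Sp d :=
    ∑ i : e.erase x₀, (ContinuousLinearMap.proj i).smulRight ((i : Sp d) - x₀)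
  have hL : ∀ w, L w = ∑ i : e.erase x₀, w i • ((i : Sp d) - x₀) := fun w => by
    simp [L]
  have hsub : convexHull ℝ (e : Set (Sp d)) ⊆ (fun w => x₀ + L w) '' Icc 0 1 := by
    intro x hx
    obtain ⟨w, hw0, hw1, rfl⟩ := Finset.mem_convexHull'.1 hx
    refine ⟨fun i => w i, ⟨fun i => hw0 _ (Finset.mem_of_mem_erase i.2), fun i => ?_⟩, ?_⟩
    · rw [Pi.one_apply, ← hw1]
      exact Finset.single_le_sum (fun y hy => hw0 y hy) (Finset.mem_of_mem_erase i.2)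
    · simp only [hL]
      rw [Finset.sum_coe_sort (e.erase x₀) (fun y => w y • (y - x₀)),
        Finset.sum_erase _ (by simp)]
      simp only [smul_sub, Finset.sum_sub_distrib, ← Finset.sum_smul, hw1, one_smul]
      abel
  have hlip : LipschitzWith ‖L‖₊ fun w => x₀ + L w :=
    LipschitzWith.of_dist_le_mul fun w w' => by
      rw [dist_add_left]
      exact L.lipschitz.dist_le_mul w w'
  refine (measure_mono hsub).trans_lt
    ((hlip.hausdorffMeasure_image_le n.cast_nonneg _).trans_lt ?_)
  refine ENNReal.mul_lt_top (ENNReal.rpow_lt_top_of_nonneg n.cast_nonneg ENNReal.coe_ne_top) ?_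
  rw [← hcard, hausdorffMeasure_pi_real]
  exact isCompact_Icc.measure_lt_top

lemma isFiniteMeasure_faceMeasure (hd : 1 ≤ d) {e : Finset (Sp d)} (he : e.card = d) :
    IsFiniteMeasure (faceMeasure e) := by
  refine ⟨?_⟩
  rw [faceMeasure, Measure.restrict_apply_univ, Measure.euclideanHausdorffMeasure_def,
    Measure.smul_apply]
  exact ENNReal.mul_lt_top ENNReal.coe_lt_top
    (hausdorffMeasure_convexHull_lt_top (n := d - 1) (by omega))

lemma isFiniteMeasure_elementMeasure (t : Finset (Sp d)) : IsFiniteMeasure (elementMeasure t) :=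
  ⟨by rw [elementMeasure, Measure.restrict_apply_univ]; exact (isCompact_simplex t).measure_lt_top⟩

end FaceMeasure

/-! ### Projections onto polynomials -/

section Projection
variable {d : ℕ} {ν : Measure (Sp d)} {m : ℕ} {f g : Sp d → ℝ}

lemma IsPoly.sum {ι : Type*} (s : Finset ι) (b : ι → ℝ) {p : ι → Sp d → ℝ}
    (hp : ∀ i, IsPoly m (p i)) : IsPoly m (∑ i ∈ s, b i • p i) := by
  classical
  induction s using Finset.induction_on with
  | empty => exact ⟨0, by simp, fun x => by simp⟩
  | insert i s hi ih =>
    rw [Finset.sum_insert hi]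
    exact ((hp i).smul (b i)).add ih

/-- The `L²` class of a polynomial. -/
noncomputable def polyLp (hν : ∀ m (p : Sp d → ℝ), IsPoly m p → MemLp p 2 ν) :
    MvPolynomial (Fin d) ℝ →ₗ[ℝ] Lp ℝ 2 ν where
  toFun P := (hν P.totalDegree (fun x => MvPolynomial.eval (fun i => x i) P)
    ⟨P, le_rfl, fun _ => rfl⟩).toLp
  map_add' P Q := by
    rw [← MemLp.toLp_add]
    congr 1
    ext x
    simp
  map_smul' s P := by
    rw [RingHom.id_apply, ← MemLp.toLp_const_smul]
    congr 1
    ext x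
    simp

/-- Polynomials of bounded degree form a finite-dimensional subspace of `L²(ν)`, so the orthogonal
projection exists and has a polynomial representative. This need not be unique, as different
polynomials may agree on a face; only the defining orthogonality is used. -/
lemma exists_isL2Proj (hν : ∀ m (p : Sp d → ℝ), IsPoly m p → MemLp p 2 ν) (hf : MemLp f 2 ν) :
    ∃ g, IsL2Proj ν m f g := by
  let V : Submodule ℝ (Lp ℝ 2 ν) := (MvPolynomial.restrictTotalDegree (Fin d) ℝ m).map (polyLp hν)
  obtain ⟨P, hP, hPV⟩ : V.starProjection hf.toLp ∈ V := V.starProjection_apply_mem _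
  have hP' := (MvPolynomial.mem_restrictTotalDegree _ _ _).1 hP
  refine ⟨fun x => MvPolynomial.eval (fun i => x i) P, ⟨P, hP', fun _ => rfl⟩, ?_⟩
  rintro p ⟨Q, hQ, hpQ⟩
  have h1 : inner ℝ (polyLp hν Q) (hf.toLp - V.starProjection hf.toLp) = 0 :=
    (Submodule.mem_orthogonal _ _).1 (V.sub_starProjection_mem_orthogonal hf.toLp) _ ⟨Q, (MvPolynomial.mem_restrictTotalDegree _ _ _).2 hQ, rfl⟩
  rw [← hPV, L2.inner_def] at h1
  rw [← h1]
  refine integral_congr_ae ?_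
  filter_upwards [Lp.coeFn_sub hf.toLp (polyLp hν P), hf.coeFn_toLp,
    MemLp.coeFn_toLp (hν _ _ ⟨P, le_rfl, fun _ => rfl⟩),
    MemLp.coeFn_toLp (hν _ _ ⟨Q, le_rfl, fun _ => rfl⟩)] with x e1 e2 e3 e4
  have e3' : (polyLp hν P) x = MvPolynomial.eval (fun i => x i) P := e3
  have e4' : (polyLp hν Q) x = MvPolynomial.eval (fun i => x i) Q := e4
  rw [e1, Pi.sub_apply, e2, e3', e4', hpQ]
  rfl

lemma isL2Proj_l2Proj (hν : ∀ m (p : Sp d → ℝ), IsPoly m p → MemLp p 2 ν) (hf : MemLp f 2 ν) :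
    IsL2Proj ν m f (l2Proj ν m f) :=
  Classical.epsilon_spec (exists_isL2Proj hν hf)

/-- The projection is a best approximation. -/
lemma integral_sub_l2Proj_sq_le (hν : ∀ m (p : Sp d → ℝ), IsPoly m p → MemLp p 2 ν)
    (hf : MemLp f 2 ν) {p : Sp d → ℝ} (hp : IsPoly m p) :
    ∫ x, (f x - l2Proj ν m f x) ^ 2 ∂ν ≤ ∫ x, (f x - p x) ^ 2 ∂ν := by
  obtain ⟨hg, horth⟩ := isL2Proj_l2Proj (m := m) hν hf
  set g := l2Proj ν m f
  have hgp : IsPoly m (g + (-1 : ℝ) • p) := hg.add (hp.smul _)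
  have hfg : MemLp (f - g) 2 ν := hf.sub (hν _ _ hg)
  have hgp' := hν _ _ hgp
  have h1 : ∀ x, (f x - p x) ^ 2 = (f x - g x) ^ 2 +
      2 * ((f x - g x) * (g + (-1 : ℝ) • p) x) + ((g + (-1 : ℝ) • p) x) ^ 2 := fun x => by
    simp only [Pi.add_apply, Pi.smul_apply, smul_eq_mul]
    ring
  have i1 : Integrable (fun x => (f x - g x) ^ 2) ν := hfg.integrable_sq
  have i2 : Integrable (fun x => 2 * ((f x - g x) * (g + (-1 : ℝ) • p) x)) ν :=
    (hfg.integrable_mul hgp').const_mul 2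
  have i3 : Integrable (fun x => ((g + (-1 : ℝ) • p) x) ^ 2) ν := hgp'.integrable_sq
  have i12 : Integrable (fun x => (f x - g x) ^ 2 +
      2 * ((f x - g x) * (g + (-1 : ℝ) • p) x)) ν := i1.add i2
  simp only [h1]
  rw [integral_add i12 i3, integral_add i1 i2, integral_const_mul, horth _ hgp]
  have : 0 ≤ ∫ x, ((g + (-1 : ℝ) • p) x) ^ 2 ∂ν := integral_nonneg fun x => sq_nonneg _
  linarith

end Projection

/-! ### Quadratic estimates for linear combinations -/

section Quadratic
variable {d : ℕ} {ν : Measure (Sp d)} {m q : ℕ}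

lemma integral_sq_sum_le {f : Sp d → ℝ} {F : Fin q → Sp d → ℝ} (hF : ∀ j, MemLp (F j) 2 ν)
    (β : Fin q → ℝ) (hf : f =ᵐ[ν] ∑ j, β j • F j) :
    ∫ x, f x ^ 2 ∂ν ≤ (∑ j, β j ^ 2) * ∑ j, ∫ x, F j x ^ 2 ∂ν := by
  rw [← integral_finsetSum _ fun j _ => (hF j).integrable_sq, ← integral_const_mul]
  have hsum : MemLp (∑ j, β j • F j) 2 ν := memLp_finsetSum' _ fun j _ => (hF j).const_smul (β j)
  refine integral_mono_ae ((memLp_congr_ae hf).2 hsum).integrable_sq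
    ((integrable_finsetSum _ fun j _ => (hF j).integrable_sq).const_mul _) ?_
  filter_upwards [hf] with x hx
  rw [hx]
  simp only [Finset.sum_apply, Pi.smul_apply, smul_eq_mul]
  exact Finset.sum_mul_sq_le_sq_mul_sq _ _ _

/-- The combination of the projections of the `F j` is an admissible competitor for the best
approximation of `f`, so linearity of the chosen `l2Proj` is not needed. -/
lemma integral_sq_osc_sum_le (hν : ∀ m (p : Sp d → ℝ), IsPoly m p → MemLp p 2 ν)
    {f : Sp d → ℝ} {F : Fin q → Sp d → ℝ} (hF : ∀ j, MemLp (F j) 2 ν)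
    (β : Fin q → ℝ) (hf : f =ᵐ[ν] ∑ j, β j • F j) :
    ∫ x, (f x - l2Proj ν m f x) ^ 2 ∂ν ≤
      (∑ j, β j ^ 2) * ∑ j, ∫ x, (F j x - l2Proj ν m (F j) x) ^ 2 ∂ν := by
  have hfm : MemLp f 2 ν := (memLp_congr_ae hf).2
    (memLp_finsetSum' _ fun j _ => (hF j).const_smul (β j))
  have hproj := fun j => (isL2Proj_l2Proj (m := m) hν (hF j)).1
  refine (integral_sub_l2Proj_sq_le hν hfm (IsPoly.sum Finset.univ β hproj)).trans ?_
  refine integral_sq_sum_le (F := fun j => F j - l2Proj ν m (F j))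
    (fun j => (hF j).sub (hν _ _ (hproj j))) β ?_
  filter_upwards [hf] with x hx
  rw [hx]
  simp only [Finset.sum_apply, Pi.smul_apply, smul_eq_mul, Pi.sub_apply, mul_sub,
    Finset.sum_sub_distrib]

end Quadratic
end EigenFEM

/-! ### Integrability and linearity of the residuals. -/

namespace EigenFEM

section Residuals
variable {d : ℕ} {Ω : Set (Sp d)} {K K₀ : Geometry.SimplicialComplex ℝ (Sp d)} {k q : ℕ}
  {A : Sp d → Matrix (Fin d) (Fin d) ℝ} {c : Sp d → ℝ} {t e : Finset (Sp d)} {V : Sp d → ℝ}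
  {W U : Fin q → Sp d → ℝ}

lemma memLp_restrict_of_continuous {F : Type*} [NormedAddCommGroup F] {p : ENNReal}
    {μ : Measure (Sp d)} {S : Set (Sp d)} (hS : IsCompact S) [IsFiniteMeasure (μ.restrict S)]
    [SecondCountableTopology F] {g : Sp d → F} (hg : Continuous g) : MemLp g p (μ.restrict S) := by
  obtain ⟨C, hC⟩ := hS.exists_bound_of_continuousOn hg.continuousOn
  exact MemLp.of_bound hg.aestronglyMeasurable C
    ((ae_restrict_mem hS.isClosed.measurableSet).mono hC)

lemma memLp_poly_elementMeasure (t : Finset (Sp d)) (m : ℕ) (p : Sp d → ℝ) (hp : IsPoly m p) :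
    MemLp p 2 (elementMeasure t) :=
  have : IsFiniteMeasure (volume.restrict (simplex t)) := isFiniteMeasure_elementMeasure t
  memLp_restrict_of_continuous (isCompact_simplex t) hp.contDiff.continuous

lemma memLp_poly_faceMeasure (hd : 1 ≤ d) (he : e.card = d) (m : ℕ) (p : Sp d → ℝ)
    (hp : IsPoly m p) : MemLp p 2 (faceMeasure e) :=
  have : IsFiniteMeasure ((μHE[d - 1] : Measure (Sp d)).restrict (simplex e)) :=
    isFiniteMeasure_faceMeasure hd he
  memLp_restrict_of_continuous (isCompact_simplex e) hp.contDiff.continuous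

lemma contDiff_gradient {p : Sp d → ℝ} (hp : ContDiff ℝ ∞ p) : ContDiff ℝ 1 (gradient p) := by
  rw [gradient_eq_comp]
  exact (LinearIsometryEquiv.contDiff _).comp
    ((hp.of_le (by norm_cast : ((2 : ℕ) : WithTop ℕ∞) ≤ ∞)).fderiv_right (m := 1) (by norm_num))

lemma IsRefinement.interior_subset (hR : IsRefinement K K₀) (ht : t ∈ elements K) :
    ∃ t₀ ∈ elements K₀, interior (simplex t) ⊆ interior (simplex t₀) := by
  obtain ⟨t₀, ht₀, h⟩ := hR t ht
  exact ⟨t₀, ht₀, interior_mono h⟩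

/-- The flux of a finite element function is Lipschitz in each element. -/
lemma IsAdmissible.lipschitz_flux (hAc : IsAdmissible Ω K₀ A c) (hR : IsRefinement K K₀)
    (ht : t ∈ elements K) (hV : V ∈ femSpace Ω K k) :
    ∃ C, LipschitzOnWith C (flux A V) (interior (simplex t)) := by
  obtain ⟨p, hp, hVp⟩ := hV.2.2.1 t ht
  obtain ⟨t₀, ht₀, hsub⟩ := hR.interior_subset ht
  obtain ⟨C₁, hC₁⟩ := hAc.lipschitz_coefOp ht₀
  have hb : Bornology.IsBounded (simplex t) := (isCompact_simplex t).isBounded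
  obtain ⟨C₂, hC₂⟩ := (contDiff_gradient hp.contDiff).contDiffOn.exists_lipschitzOnWith one_ne_zero
    (convex_convexHull ℝ (t : Set (Sp d))) (isCompact_simplex t)
  obtain ⟨M₁, hM₁⟩ := exists_norm_le_of_lipschitzOnWith (hC₁.mono hsub)
    (hb.subset interior_subset)
  obtain ⟨M₂, hM₂⟩ := exists_norm_le_of_lipschitzOnWith hC₂ hb
  refine ⟨M₁.toNNReal * C₂ + C₁ * M₂.toNNReal, LipschitzOnWith.of_dist_le_mul fun x hx y hy => ?_⟩
  have e : ∀ z ∈ interior (simplex t), flux A V z = coefOp A z (gradient p z) := fun z hz => by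
    rw [flux, gradient_eq_of_eqOn_interior hVp hz]
    rfl
  rw [e x hx, e y hy, dist_eq_norm, show coefOp A x (gradient p x) - coefOp A y (gradient p y) =
    coefOp A x (gradient p x - gradient p y) + (coefOp A x - coefOp A y) (gradient p y) by
      rw [map_sub, sub_apply]; abel]
  have hx' := interior_subset hx
  have hy' := interior_subset hy
  have h1 : ‖coefOp A x (gradient p x - gradient p y)‖ ≤ M₁.toNNReal * (C₂ * dist x y) := by
    refine ((coefOp A x).le_opNorm _).trans ?_
    rw [← dist_eq_norm]
    exact mul_le_mul ((hM₁ x hx).trans (Real.le_coe_toNNReal _)) (hC₂.dist_le_mul x hx' y hy')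
      dist_nonneg (by positivity)
  have h2 : ‖(coefOp A x - coefOp A y) (gradient p y)‖ ≤ (C₁ * dist x y) * M₂.toNNReal := by
    refine ((coefOp A x - coefOp A y).le_opNorm _).trans ?_
    rw [← dist_eq_norm]
    exact mul_le_mul (hC₁.dist_le_mul x (hsub hx) y (hsub hy))
      ((hM₂ y hy').trans (Real.le_coe_toNNReal _)) (norm_nonneg _) (by positivity)
  refine (norm_add_le_of_le h1 h2).trans (le_of_eq ?_)
  push_cast
  ring

lemma differentiableAt_fem (ht : t ∈ elements K) (hV : V ∈ femSpace Ω K k) {x : Sp d}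
    (hx : x ∈ interior (simplex t)) : DifferentiableAt ℝ V x := by
  obtain ⟨p, hp, hVp⟩ := hV.2.2.1 t ht
  have : V =ᶠ[𝓝 x] p := by
    filter_upwards [mem_interior_iff_mem_nhds.1 hx] with y hy using hVp hy
  exact ((hp.contDiff.differentiable (by simp)) x).congr_of_eventuallyEq this

lemma flux_sum (ht : t ∈ elements K) (hW : ∀ j, W j ∈ femSpace Ω K k) (β : Fin q → ℝ) {x : Sp d}
    (hx : x ∈ interior (simplex t)) :
    flux A (∑ j, β j • W j) x = ∑ j, β j • flux A (W j) x := by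
  have h1 : gradient (∑ j, β j • W j) x = ∑ j, β j • gradient (W j) x := by
    simp only [gradient_eq_comp]
    rw [fderiv_sum fun j _ => (differentiableAt_fem ht (hW j) hx).const_smul (β j), map_sum]
    refine Finset.sum_congr rfl fun j _ => ?_
    rw [fderiv_const_smul (differentiableAt_fem ht (hW j) hx), map_smul]
  rw [flux, h1, map_sum]
  refine Finset.sum_congr rfl fun j _ => ?_
  rw [map_smul]
  rfl

/-! ### Jump residuals -/

lemma simplex_subset_closure_interior (ht : t ∈ elements K) :
    simplex t ⊆ closure (interior (simplex t)) := by
  rw [(convex_convexHull ℝ (t : Set (Sp d))).closure_interior_eq_closure_of_nonempty_interior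
    (interior_simplex_nonempty ht)]
  exact subset_closure

/-- The trace of the flux on the boundary of an element. -/
lemma IsAdmissible.exists_trace (hAc : IsAdmissible Ω K₀ A c) (hR : IsRefinement K K₀)
    (ht : t ∈ elements K) (hV : V ∈ femSpace Ω K k) :
    ∃ g : Sp d → Sp d, Continuous g ∧
      (∀ x, Tendsto (flux A V) (𝓝[interior (simplex t)] x) (𝓝 (g x))) ∧
      ∀ x ∈ simplex t, extendFrom (interior (simplex t)) (flux A V) x = g x := by
  obtain ⟨C, hC⟩ := hAc.lipschitz_flux hR ht hV
  -- A Lipschitz extension to the whole space shows that the one-sided limits exist, so `extendFrom`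
  -- returns a genuine trace.
  obtain ⟨g, hg, hfg⟩ := hC.extend_finite_dimension
  have hlim : ∀ x, Tendsto (flux A V) (𝓝[interior (simplex t)] x) (𝓝 (g x)) := fun x => by
    refine ((hg.continuous.tendsto x).mono_left nhdsWithin_le_nhds).congr' ?_
    filter_upwards [self_mem_nhdsWithin] with y hy using (hfg hy).symm
  exact ⟨g, hg.continuous, hlim, fun x hx =>
    extendFrom_eq (simplex_subset_closure_interior ht hx) (hlim x)⟩

lemma simplex_mono (h : e ⊆ t) : simplex e ⊆ simplex t :=
  convexHull_mono (by exact_mod_cast h)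

lemma IsConformingMesh.finite_adjacent (hK : IsConformingMesh Ω K) (e : Finset (Sp d)) :
    {t | t ∈ elements K ∧ e ⊆ t}.Finite :=
  hK.finite_elements.subset fun _ ht => ht.1

lemma jumpResidual_eq_sum (hK : IsConformingMesh Ω K) (x : Sp d) :
    jumpResidual A K e V x = ∑ t ∈ (hK.finite_adjacent e).toFinset,
      -inner ℝ (extendFrom (interior (simplex t)) (flux A V) x) (outerNormal t e) :=
  finsum_mem_eq_finite_toFinset_sum _ (hK.finite_adjacent e)

lemma IsAdmissible.memLp_jumpResidual (hAc : IsAdmissible Ω K₀ A c) (hd : 1 ≤ d)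
    (hK : IsConformingMesh Ω K) (hR : IsRefinement K K₀) (he : e.card = d)
    (hV : V ∈ femSpace Ω K k) : MemLp (jumpResidual A K e V) 2 (faceMeasure e) := by
  have : IsFiniteMeasure ((μHE[d - 1] : Measure (Sp d)).restrict (simplex e)) :=
    isFiniteMeasure_faceMeasure hd he
  have hex : ∀ t, ∃ g : Sp d → Sp d, Continuous g ∧ (t ∈ elements K → ∀ x ∈ simplex t,
      extendFrom (interior (simplex t)) (flux A V) x = g x) := fun t => by
    by_cases ht : t ∈ elements K
    · obtain ⟨g, h1, -, h2⟩ := hAc.exists_trace hR ht hV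
      exact ⟨g, h1, fun _ => h2⟩
    · exact ⟨0, continuous_const, fun h => absurd h ht⟩
  choose g hg hgt using hex
  have hcont : Continuous fun x => ∑ t ∈ (hK.finite_adjacent e).toFinset,
      -(inner ℝ (g t x) (outerNormal t e) : ℝ) :=
    continuous_finsetSum _ fun t _ => ((hg t).inner continuous_const).neg
  refine (memLp_congr_ae ?_).1 (memLp_restrict_of_continuous (isCompact_simplex e) hcont)
  filter_upwards [ae_restrict_mem (isCompact_simplex e).isClosed.measurableSet] with x hx
  rw [jumpResidual_eq_sum hK]
  refine Finset.sum_congr rfl fun t ht => ?_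
  obtain ⟨ht, het⟩ := (hK.finite_adjacent e).mem_toFinset.1 ht
  rw [hgt t ht x (simplex_mono het hx)]

/-- The flux is linear inside each element, and so are its limits at the face. Existence of the
individual limits is essential, since `extendFrom` is otherwise an arbitrary value. -/
lemma IsAdmissible.jumpResidual_sum (hAc : IsAdmissible Ω K₀ A c) (hK : IsConformingMesh Ω K)
    (hR : IsRefinement K K₀) (hW : ∀ j, W j ∈ femSpace Ω K k) (β : Fin q → ℝ) :
    jumpResidual A K e (∑ j, β j • W j) =ᵐ[faceMeasure e] ∑ j, β j • jumpResidual A K e (W j) := by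
  filter_upwards [ae_restrict_mem (isCompact_simplex e).isClosed.measurableSet] with x hx
  simp only [Finset.sum_apply, Pi.smul_apply, smul_eq_mul, jumpResidual_eq_sum hK,
    Finset.mul_sum]
  rw [Finset.sum_comm]
  refine Finset.sum_congr rfl fun t ht => ?_
  obtain ⟨ht, het⟩ := (hK.finite_adjacent e).mem_toFinset.1 ht
  have hxt := simplex_mono het hx
  choose g _ hg hgx using fun j => hAc.exists_trace hR ht (hW j)
  have hlim : Tendsto (flux A (∑ j, β j • W j)) (𝓝[interior (simplex t)] x)
      (𝓝 (∑ j, β j • g j x)) := by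
    refine (tendsto_finsetSum _ fun j _ => (hg j x).const_smul (β j)).congr' ?_
    filter_upwards [self_mem_nhdsWithin] with y hy using (flux_sum ht hW β hy).symm
  rw [extendFrom_eq (simplex_subset_closure_interior ht hxt) hlim, sum_inner,
    ← Finset.sum_neg_distrib]
  refine Finset.sum_congr rfl fun j _ => ?_
  rw [hgx j x hxt, real_inner_smul_left, mul_neg]

/-! ### Element residuals -/

lemma memLp_fem_element (ht : t ∈ elements K) (hV : V ∈ femSpace Ω K k) :
    MemLp V 2 (elementMeasure t) := by
  obtain ⟨p, hp, hVp⟩ := hV.2.2.1 t ht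
  refine (memLp_congr_ae ?_).2 (memLp_poly_elementMeasure t k p hp)
  exact (ae_restrict_mem (isCompact_simplex t).isClosed.measurableSet).mono fun x hx => hVp hx

lemma memLp_fem (hV : V ∈ femSpace Ω K k) : MemLp V 2 (volume.restrict Ω) := by
  obtain ⟨w, -, hw⟩ := hV.2.2.2
  exact (memLp_congr_ae hw).1 (Lp.memLp w.1)

lemma elementMeasure_eq (t : Finset (Sp d)) :
    elementMeasure t = volume.restrict (interior (simplex t)) := restrict_simplex_eq t

/-- The flux is Lipschitz, so its divergence is bounded; where the flux is not differentiable,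
`fderiv` is 0 by convention. The other terms are polynomials on the element, one of them times the
bounded `c`. -/
lemma IsAdmissible.memLp_elementResidual (hAc : IsAdmissible Ω K₀ A c)
    (hΩ : IsPolytopicDomain Ω K₀) (hK : IsConformingMesh Ω K) (hR : IsRefinement K K₀)
    (ht : t ∈ elements K) (Λ : Fin q → ℝ) (hU : ∀ j, U j ∈ femSpace Ω K k)
    (hV : V ∈ femSpace Ω K k) : MemLp (elementResidual Ω A c Λ U V) 2 (elementMeasure t) := by
  have := isFiniteMeasure_elementMeasure t
  have h1 : MemLp (source Ω Λ U V) 2 (elementMeasure t) := by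
    have : source Ω Λ U V = ∑ j, (bForm Ω V (U j) * Λ j) • U j := by
      ext x
      simp [source]
    rw [this]
    exact memLp_finsetSum' _ fun j _ => (memLp_fem_element ht (hU j)).const_smul _
  have h2 : MemLp (divergence (flux A V)) 2 (elementMeasure t) := by
    obtain ⟨C, hC⟩ := hAc.lipschitz_flux hR ht hV
    have hmeas : Measurable (divergence (flux A V)) := by
      refine Finset.measurable_fun_sum _ fun i _ => ?_
      exact ((EuclideanSpace.proj (𝕜 := ℝ) i).continuous.measurable).comp
        ((measurable_fderiv ℝ (flux A V)).apply_continuousLinearMap _)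
    refine MemLp.of_bound hmeas.aestronglyMeasurable (∑ _i : Fin d, (C : ℝ)) ?_
    rw [elementMeasure_eq]
    filter_upwards [ae_restrict_mem isOpen_interior.measurableSet] with x hx
    refine norm_sum_le_of_le _ fun i _ => ?_
    refine (PiLp.norm_apply_le _ i).trans ?_
    refine ((fderiv ℝ (flux A V) x).le_opNorm _).trans ?_
    rw [PiLp.norm_single, norm_one, mul_one]
    exact norm_fderiv_le_of_lipschitzOn ℝ (isOpen_interior.mem_nhds hx) hC
  have h3 : MemLp (fun x => c x * V x) 2 (elementMeasure t) := by
    have hc : MemLp c ⊤ (elementMeasure t) := by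
      rw [elementMeasure_eq]
      exact hAc.c_memLp.mono_measure
        (Measure.restrict_mono (hΩ.interior_simplex_subset hK ht) le_rfl)
    exact (memLp_fem_element ht hV).mul hc
  exact (h1.add h2).sub h3

/-- Additivity of `fderiv` requires differentiability of each flux, which Rademacher's theorem
provides almost everywhere. The source term is linear because its coefficients are. -/
lemma IsAdmissible.elementResidual_sum (hAc : IsAdmissible Ω K₀ A c) (hR : IsRefinement K K₀)
    (ht : t ∈ elements K) (Λ : Fin q → ℝ) (hU : ∀ j, U j ∈ femSpace Ω K k)
    (hW : ∀ j, W j ∈ femSpace Ω K k) (β : Fin q → ℝ) :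
    elementResidual Ω A c Λ U (∑ j, β j • W j) =ᵐ[elementMeasure t]
      ∑ j, β j • elementResidual Ω A c Λ U (W j) := by
  have hdiff : ∀ᵐ x ∂(elementMeasure t), ∀ j, DifferentiableWithinAt ℝ (flux A (W j))
      (interior (simplex t)) x := by
    rw [elementMeasure_eq]
    refine ae_all_iff.2 fun j => ?_
    obtain ⟨C, hC⟩ := hAc.lipschitz_flux hR ht (hW j)
    exact hC.ae_differentiableWithinAt isOpen_interior.measurableSet
  have hmem : ∀ᵐ x ∂(elementMeasure t), x ∈ interior (simplex t) := by
    rw [elementMeasure_eq]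
    exact ae_restrict_mem isOpen_interior.measurableSet
  have hb : ∀ i, bForm Ω (∑ j, β j • W j) (U i) = ∑ j, β j * bForm Ω (W j) (U i) := fun i => by
    have hint : ∀ j, Integrable (fun x => β j * (W j x * U i x)) (volume.restrict Ω) := fun j =>
      ((memLp_fem (hW j)).integrable_mul (memLp_fem (hU i))).const_mul _
    simp only [bForm, ← integral_const_mul]
    rw [← integral_finsetSum _ fun j _ => hint j]
    refine integral_congr_ae (.of_forall fun x => ?_)
    simp only [Finset.sum_apply, Pi.smul_apply, smul_eq_mul, Finset.sum_mul, mul_assoc]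
  filter_upwards [hdiff, hmem] with x hx hxt
  have hsrc : source Ω Λ U (∑ j, β j • W j) x = ∑ j, β j * source Ω Λ U (W j) x := by
    simp only [source, hb, Finset.mul_sum, Finset.sum_mul]
    rw [Finset.sum_comm]
    refine Finset.sum_congr rfl fun j _ => Finset.sum_congr rfl fun i _ => ?_
    ring
  have hdiv : divergence (flux A (∑ j, β j • W j)) x = ∑ j, β j * divergence (flux A (W j)) x := by
    have h1 : flux A (∑ j, β j • W j) =ᶠ[𝓝 x] ∑ j, β j • flux A (W j) := by
      filter_upwards [isOpen_interior.mem_nhds hxt] with y hy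
      rw [flux_sum ht hW β hy]
      simp
    have h2 : ∀ j, DifferentiableAt ℝ (flux A (W j)) x := fun j =>
      (hx j).differentiableAt (isOpen_interior.mem_nhds hxt)
    have h3 : fderiv ℝ (flux A (∑ j, β j • W j)) x = ∑ j, β j • fderiv ℝ (flux A (W j)) x := by
      rw [h1.fderiv_eq, fderiv_sum fun j _ => (h2 j).const_smul (β j)]
      exact Finset.sum_congr rfl fun j _ => fderiv_const_smul (h2 j) _
    simp only [divergence, h3, Finset.mul_sum]
    rw [Finset.sum_comm]
    refine Finset.sum_congr rfl fun i _ => ?_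
    simp
  simp only [elementResidual, hsrc, hdiv, Finset.sum_apply, Pi.smul_apply, smul_eq_mul,
    Finset.mul_sum, ← Finset.sum_add_distrib, ← Finset.sum_sub_distrib]
  refine Finset.sum_congr rfl fun j _ => ?_
  ring

end Residuals
end EigenFEM

/-! ### Estimators of linear combinations, and the transition matrix. -/

namespace EigenFEM
open EigenApprox

section Estimators
variable {d : ℕ} {Ω : Set (Sp d)} {K K₀ : Geometry.SimplicialComplex ℝ (Sp d)} {k q : ℕ}
  {A : Sp d → Matrix (Fin d) (Fin d) ℝ} {c : Sp d → ℝ} {t : Finset (Sp d)}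
  {W U : Fin q → Sp d → ℝ}

/-- Combines the volume and face estimates with their mesh weights, which are common to all members
of the tuple. -/
lemma weighted_sum_le {κ : Type*} (s : Finset κ) {D β : ℝ} {a : Fin q → ℝ} {a' : ℝ} {h : κ → ℝ}
    {b : Fin q → κ → ℝ} {b' : κ → ℝ} (hD : 0 ≤ D) (hh : ∀ e, 0 ≤ h e)
    (ha : a' ≤ β * ∑ j, a j) (hb : ∀ e ∈ s, b' e ≤ β * ∑ j, b j e) :
    D * a' + ∑ e ∈ s, h e * b' e ≤ β * ∑ j, (D * a j + ∑ e ∈ s, h e * b j e) := by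
  have h1 : D * a' ≤ D * (β * ∑ j, a j) := mul_le_mul_of_nonneg_left ha hD
  have h2 : ∑ e ∈ s, h e * b' e ≤ ∑ e ∈ s, h e * (β * ∑ j, b j e) :=
    Finset.sum_le_sum fun e he => mul_le_mul_of_nonneg_left (hb e he) (hh e)
  refine (add_le_add h1 h2).trans (le_of_eq ?_)
  rw [Finset.sum_add_distrib, mul_add, ← Finset.mul_sum, Finset.sum_comm]
  congr 1
  · ring
  · rw [Finset.mul_sum]
    refine Finset.sum_congr rfl fun e _ => ?_
    rw [← Finset.mul_sum]
    ring

lemma card_of_mem_interiorFaces {e : Finset (Sp d)} (he : e ∈ interiorFaces K t) : e.card = d := by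
  classical
  exact (Finset.mem_filter.1 he).2.1

lemma diamS_nonneg (t : Finset (Sp d)) : 0 ≤ diamS t := Metric.diam_nonneg

lemma IsAdmissible.etaSq_sum_le (hAc : IsAdmissible Ω K₀ A c) (hd : 1 ≤ d)
    (hΩ : IsPolytopicDomain Ω K₀) (hK : IsConformingMesh Ω K) (hR : IsRefinement K K₀)
    (ht : t ∈ elements K) (Λ : Fin q → ℝ) (hU : ∀ j, U j ∈ femSpace Ω K k)
    (hW : ∀ j, W j ∈ femSpace Ω K k) (β : Fin q → ℝ) :
    etaSq Ω A c K Λ U (∑ j, β j • W j) t ≤ (∑ j, β j ^ 2) * ∑ j, etaSq Ω A c K Λ U (W j) t :=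
  weighted_sum_le _ (sq_nonneg _) diamS_nonneg
    (integral_sq_sum_le (fun j => hAc.memLp_elementResidual hΩ hK hR ht Λ hU (hW j)) β
      (hAc.elementResidual_sum hR ht Λ hU hW β))
    fun _ he => integral_sq_sum_le
      (fun j => hAc.memLp_jumpResidual hd hK hR (card_of_mem_interiorFaces he) (hW j)) β
      (hAc.jumpResidual_sum hK hR hW β)

lemma IsAdmissible.oscSq_sum_le (hAc : IsAdmissible Ω K₀ A c) (hd : 1 ≤ d)
    (hΩ : IsPolytopicDomain Ω K₀) (hK : IsConformingMesh Ω K) (hR : IsRefinement K K₀)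
    (ht : t ∈ elements K) (m m' : ℕ) (Λ : Fin q → ℝ) (hU : ∀ j, U j ∈ femSpace Ω K k)
    (hW : ∀ j, W j ∈ femSpace Ω K k) (β : Fin q → ℝ) :
    oscSq Ω A c K m m' Λ U (∑ j, β j • W j) t ≤
      (∑ j, β j ^ 2) * ∑ j, oscSq Ω A c K m m' Λ U (W j) t :=
  weighted_sum_le _ (sq_nonneg _) diamS_nonneg
    (integral_sq_osc_sum_le (memLp_poly_elementMeasure t)
      (fun j => hAc.memLp_elementResidual hΩ hK hR ht Λ hU (hW j)) β
      (hAc.elementResidual_sum hR ht Λ hU hW β))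
    fun _ he => integral_sq_osc_sum_le (memLp_poly_faceMeasure hd (card_of_mem_interiorFaces he))
      (fun j => hAc.memLp_jumpResidual hd hK hR (card_of_mem_interiorFaces he) (hW j)) β
      (hAc.jumpResidual_sum hK hR hW β)

lemma etaSqTuple_nonneg (Λ : Fin q → ℝ) : 0 ≤ etaSqTuple Ω A c K Λ U W t :=
  Finset.sum_nonneg fun _ _ => add_nonneg
    (mul_nonneg (sq_nonneg _) (integral_nonneg fun _ => sq_nonneg _))
    (Finset.sum_nonneg fun e _ => mul_nonneg (diamS_nonneg e) (integral_nonneg fun _ => sq_nonneg _))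

lemma oscSqTuple_nonneg (m m' : ℕ) (Λ : Fin q → ℝ) : 0 ≤ oscSqTuple Ω A c K m m' Λ U W t :=
  Finset.sum_nonneg fun _ _ => add_nonneg
    (mul_nonneg (sq_nonneg _) (integral_nonneg fun _ => sq_nonneg _))
    (Finset.sum_nonneg fun e _ => mul_nonneg (diamS_nonneg e) (integral_nonneg fun _ => sq_nonneg _))

lemma IsAdmissible.etaSqTuple_le (hAc : IsAdmissible Ω K₀ A c) (hd : 1 ≤ d)
    (hΩ : IsPolytopicDomain Ω K₀) (hK : IsConformingMesh Ω K) (hR : IsRefinement K K₀)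
    (ht : t ∈ elements K) (Λ : Fin q → ℝ) (hU : ∀ j, U j ∈ femSpace Ω K k)
    (hW : ∀ j, W j ∈ femSpace Ω K k) {β : Fin q → Fin q → ℝ} {W' : Fin q → Sp d → ℝ}
    (hW' : ∀ l, W' l = ∑ j, β l j • W j) {C : ℝ} (hβ : ∑ l, ∑ j, β l j ^ 2 ≤ C) :
    etaSqTuple Ω A c K Λ U W' t ≤ C * etaSqTuple Ω A c K Λ U W t := by
  refine le_trans ?_ (mul_le_mul_of_nonneg_right hβ (etaSqTuple_nonneg Λ))
  rw [Finset.sum_mul]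
  refine Finset.sum_le_sum fun l _ => ?_
  rw [hW' l]
  exact hAc.etaSq_sum_le hd hΩ hK hR ht Λ hU hW (β l)

lemma IsAdmissible.oscSqTuple_le (hAc : IsAdmissible Ω K₀ A c) (hd : 1 ≤ d)
    (hΩ : IsPolytopicDomain Ω K₀) (hK : IsConformingMesh Ω K) (hR : IsRefinement K K₀)
    (ht : t ∈ elements K) (m m' : ℕ) (Λ : Fin q → ℝ) (hU : ∀ j, U j ∈ femSpace Ω K k)
    (hW : ∀ j, W j ∈ femSpace Ω K k) {β : Fin q → Fin q → ℝ} {W' : Fin q → Sp d → ℝ}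
    (hW' : ∀ l, W' l = ∑ j, β l j • W j) {C : ℝ} (hβ : ∑ l, ∑ j, β l j ^ 2 ≤ C) :
    oscSqTuple Ω A c K m m' Λ U W' t ≤ C * oscSqTuple Ω A c K m m' Λ U W t := by
  refine le_trans ?_ (mul_le_mul_of_nonneg_right hβ (oscSqTuple_nonneg m m' Λ))
  rw [Finset.sum_mul]
  refine Finset.sum_le_sum fun l _ => ?_
  rw [hW' l]
  exact hAc.oscSq_sum_le hd hΩ hK hR ht m m' Λ hU hW (β l)

end Estimators

section Transition
variable {L : Type*} [NormedAddCommGroup L] [InnerProductSpace ℝ L] {q : ℕ}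

/-- If the orthogonal projection of `span f` to `span e` does not lose more than half of the norm,
the transition matrix is invertible with bounded inverse. -/
lemma exists_inverse_transition {e f : Fin q → L} (he : Orthonormal ℝ e) (hf : Orthonormal ℝ f)
    (h : ∀ u ∈ Submodule.span ℝ (range f),
      ‖u - ∑ j, (inner ℝ (e j) u : ℝ) • e j‖ ≤ 2⁻¹ * ‖u‖) :
    ∃ β : Fin q → Fin q → ℝ, (∀ i j, ∑ l, β i l * inner ℝ (e j) (f l) = if i = j then 1 else 0) ∧
      ∑ i, ∑ l, β i l ^ 2 ≤ 4 * q := by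
  let T : (Fin q → ℝ) →ₗ[ℝ] (Fin q → ℝ) :=
    { toFun := fun b j => ∑ l, b l * inner ℝ (e j) (f l)
      map_add' := fun b b' => by
        ext j
        simp only [Pi.add_apply, add_mul, Finset.sum_add_distrib]
      map_smul' := fun s b => by
        ext j
        simp only [Pi.smul_apply, smul_eq_mul, RingHom.id_apply, Finset.mul_sum, mul_assoc] }
  have hT : ∀ b j, T b j = ∑ l, b l * inner ℝ (e j) (f l) := fun _ _ => rfl
  have hTin : ∀ b j, T b j = inner ℝ (e j) (∑ l, b l • f l) := fun b j => by
    rw [hT, inner_sum]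
    exact Finset.sum_congr rfl fun l _ => (real_inner_smul_right _ _ _).symm
  have hnorm : ∀ {g : Fin q → L}, Orthonormal ℝ g → ∀ b : Fin q → ℝ,
      ‖∑ l, b l • g l‖ ^ 2 = ∑ l, b l ^ 2 := fun {g} hg b => by
    rw [← real_inner_self_eq_norm_sq, hg.inner_sum]
    simp [sq]
  -- The projection keeps at least half of the norm, and both systems are orthonormal, so norms are
  -- Euclidean norms of coefficients.
  have hbound : ∀ b, ∑ l, b l ^ 2 ≤ 4 * ∑ j, T b j ^ 2 := fun b => by
    set u := ∑ l, b l • f l with hu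
    have hmem : u ∈ Submodule.span ℝ (range f) :=
      Submodule.sum_mem _ fun l _ => Submodule.smul_mem _ _ (Submodule.subset_span ⟨l, rfl⟩)
    have h1 := h u hmem
    have h2 : ‖u‖ ≤ 2 * ‖∑ j, (inner ℝ (e j) u : ℝ) • e j‖ := by
      have := norm_sub_norm_le u (∑ j, (inner ℝ (e j) u : ℝ) • e j)
      linarith
    have h3 := pow_le_pow_left₀ (norm_nonneg u) h2 2
    rw [mul_pow, hnorm he, hu, hnorm hf] at h3
    simp only [hTin]
    linarith
  have hinj : Function.Injective T := by
    refine (injective_iff_map_eq_zero T).2 fun b hb => ?_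
    have h1 := hbound b
    rw [hb] at h1
    simp only [Pi.zero_apply] at h1
    have h2 : ∑ l, b l ^ 2 = 0 := le_antisymm (by simpa using h1)
      (Finset.sum_nonneg fun l _ => sq_nonneg _)
    ext l
    have := (Finset.sum_eq_zero_iff_of_nonneg fun l _ => sq_nonneg (b l)).1 h2 l (Finset.mem_univ l)
    simpa using this
  -- The rows of the inverse are preimages of the unit vectors. Each has squared norm at most 4,
  -- which gives the total `4 q`.
  choose β hβ using fun i => LinearMap.injective_iff_surjective.1 hinj (Pi.single i 1)
  have hβ' : ∀ i j, T (β i) j = if i = j then 1 else 0 := fun i j => by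
    rw [hβ, Pi.single_apply]
    simp only [eq_comm]
  refine ⟨β, fun i j => by rw [← hT, hβ'], ?_⟩
  refine (Finset.sum_le_sum fun i _ => hbound (β i)).trans (le_of_eq ?_)
  simp [hβ', mul_comm]

end Transition
end EigenFEM

/-! ### The main theorem. -/

theorem mainTheorem7 (d : ℕ) (hd : 1 ≤ d) (Ω : Set (Sp d))
    (K₀ : Geometry.SimplicialComplex ℝ (Sp d)) (hΩ : IsPolytopicDomain Ω K₀)
    (A : Sp d → Matrix (Fin d) (Fin d) ℝ) (c : Sp d → ℝ) (hAc : IsAdmissible Ω K₀ A c)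
    (k : ℕ) (hk : 1 ≤ k) (m m' : ℕ) (γ : ℝ)
    (lam : ℝ) (hlam : IsEigenvalue Ω A c lam)
    -- `Γ` is the circle with center `lam⁻¹` and radius `r`, enclosing no other eigenvalue `μ⁻¹`
    (r : ℝ) (hr : 0 < r) (hΓ : ∀ μ, IsEigenvalue Ω A c μ → μ ≠ lam → r < |μ⁻¹ - lam⁻¹|) :
    ∃ h₀ : ℝ, 0 < h₀ ∧ ∃ C : ℝ, 0 < C ∧
      ∀ K : Geometry.SimplicialComplex ℝ (Sp d), IsConformingMesh Ω K → IsRefinement K K₀ →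
        IsShapeRegular γ K → meshSize K < h₀ →
      ∀ (n : ℕ) (Λ : Fin n → ℝ) (φ : Fin n → Sp d → ℝ), IsDiscreteEigenbasis Ω A c K k Λ φ →
      ∃ hn : numBelow Ω A c lam + multiplicity Ω A c lam ≤ n,
        let Λh : Fin (multiplicity Ω A c lam) → ℝ := fun l => Λ (clusterIndex hn l)
        let Uh : Fin (multiplicity Ω A c lam) → Sp d → ℝ := fun l => φ (clusterIndex hn l)
        ∀ u : Fin (multiplicity Ω A c lam) → L2Pair Ω, IsOrthonormalBasisOf Ω A c lam u →
          let EhU : Fin (multiplicity Ω A c lam) → Sp d → ℝ :=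
            fun l => projE Ω A c K k lam⁻¹ r (u l).1
          ∀ t ∈ elements K,
            (etaSqTuple Ω A c K Λh Uh Uh t ≤ C * etaSqTuple Ω A c K Λh Uh EhU t ∧
              etaSqTuple Ω A c K Λh Uh EhU t ≤ C * etaSqTuple Ω A c K Λh Uh Uh t) ∧
            (oscSqTuple Ω A c K m m' Λh Uh Uh t ≤ C * oscSqTuple Ω A c K m m' Λh Uh EhU t ∧
              oscSqTuple Ω A c K m m' Λh Uh EhU t ≤ C * oscSqTuple Ω A c K m m' Λh Uh Uh t) := by
  obtain ⟨X, _, _, _, J, ι, a, h⟩ := hAc.exists_isSobolevModel hd hΩ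
  have hsymm : ∀ x y, a x y = a y x := fun x y => by rw [h.form, h.form, hAc.aForm_comm]
  have hlam0 : 0 < lam := by
    by_contra! hle
    exact h.isEigenvalue_iff.1 hlam (EigenApprox.eigX_eq_bot h.coercive hle)
  have hΓ' : ∀ μ, EigenApprox.eigX ι a μ ≠ ⊥ → μ ≠ lam → r < |μ⁻¹ - lam⁻¹| := fun μ hμ =>
    hΓ μ (h.isEigenvalue_iff.2 hμ)
  have hrl : r < lam⁻¹ := EigenApprox.radius_lt h.coercive hsymm h.compact h.fst_injective
    (h.not_finiteDimensional hd hΩ.isOpen hΩ.isConnected.nonempty) hlam0 hΓ'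
  obtain ⟨F, ε, hε, hF⟩ := EigenApprox.exists_finset_galerkin h.coercive hsymm h.compact
    h.fst_injective hlam0 hr hrl hΓ'
  rw [← h.multiplicity_eq, ← h.numBelow_eq] at hF
  -- Half of `ε` compensates the factor 2 of `norm_lt` between the two norms.
  choose H hH0 hH using fun w : X => exists_fem_approx (k := k) hd hΩ hk γ (h.mem w) (half_pos hε)
  obtain ⟨h₀, hh₀, hle⟩ : ∃ h₀ : ℝ, 0 < h₀ ∧ ∀ w ∈ F, h₀ ≤ H w := by
    rcases F.eq_empty_or_nonempty with rfl | hne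
    · exact ⟨1, one_pos, by simp⟩
    · exact ⟨F.inf' hne H, (Finset.lt_inf'_iff hne).2 fun w _ => hH0 w, fun w hw =>
        Finset.inf'_le H hw⟩
  -- `q²` bounds the squared entries of the matrix from `U_h` to `E_hU`, `4 q` those of its inverse;
  -- the 1 secures positivity.
  refine ⟨h₀, hh₀, (multiplicity Ω A c lam : ℝ) ^ 2 + 4 * multiplicity Ω A c lam + 1,
    by positivity, fun K hK hR hγ hmesh n Λ φ hφ => ?_⟩
  obtain ⟨x, hx, hxφ, hxm⟩ := h.exists_isGalerkinEigenbasis hΩ hK hφ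
  obtain ⟨hn, hlow, hmid, hhigh, hproj⟩ := hF n Λ x hx fun w hw => by
    obtain ⟨v, hv, w', hw', hw'v, hww'⟩ := hH w K hK hγ (hmesh.trans_le (hle w hw))
    obtain ⟨y, rfl⟩ := h.exists_of_mem hw'
    refine ⟨y, hxm v hv y (by rw [h.fst]; exact hw'v), ?_⟩
    have := h.norm_lt (x := w - y) (by rwa [map_sub])
    linarith
  refine ⟨hn, ?_⟩
  intro Λh Uh u hu EhU t ht
  have hci : Function.Injective (clusterIndex hn) := fun l l' hll => by
    have := congrArg Fin.val hll
    simp only [clusterIndex] at this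
    exact Fin.ext (by omega)
  let s : Finset (Fin n) := Finset.univ.map ⟨clusterIndex hn, hci⟩
  have hs : ∀ i ∈ s, |(Λ i)⁻¹ - lam⁻¹| < r := fun i hi => by
    obtain ⟨l, -, rfl⟩ := Finset.mem_map.1 hi
    exact hmid _ (Nat.le_add_right _ _) (Nat.add_lt_add_left l.2 _)
  -- An index outside the cluster lies below `k₀` or from `k₀ + q` on; in both cases its reciprocal
  -- eigenvalue is outside `Γ`.
  have hs' : ∀ i ∉ s, r < |(Λ i)⁻¹ - lam⁻¹| := fun i hi => by
    rcases lt_or_ge (i : ℕ) (numBelow Ω A c lam) with h1 | h1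
    · exact hlow i h1
    rcases lt_or_ge (i : ℕ) (numBelow Ω A c lam + multiplicity Ω A c lam) with h2 | h2
    · refine absurd (Finset.mem_map.2 ⟨⟨i - numBelow Ω A c lam, by omega⟩, Finset.mem_univ _, ?_⟩) hi
      exact Fin.ext (Nat.add_sub_cancel' h1)
    · exact hhigh i h2
  have hmem : ∀ i, φ i ∈ femSpace Ω K k := fun i => by
    rw [← hφ.span]
    exact Submodule.subset_span ⟨i, rfl⟩
  have hUh : ∀ j, Uh j ∈ femSpace Ω K k := fun j => hmem _
  choose y hy using fun l => h.exists_of_mem (hu.mem l).1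
  let e : Fin (multiplicity Ω A c lam) → L2 Ω := fun j => ι (x (clusterIndex hn j))
  let f : Fin (multiplicity Ω A c lam) → L2 Ω := fun l => ι (y l)
  have he : Orthonormal ℝ e := hx.orthonormal.comp _ hci
  have hf1 : ∀ l, f l = (u l).1 := fun l => by rw [← hy l]; exact h.fst _
  have hf : Orthonormal ℝ f := by
    rw [orthonormal_iff_ite]
    intro i j
    rw [hf1, hf1, ← bForm_self]
    exact hu.orthonormal i j
  have hEhU : ∀ l, EhU l = ∑ j, (inner ℝ (e j) (f l) : ℝ) • Uh j := fun l => by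
    have := h.projE_eq hAc hΩ hK hφ hx hxφ hxm hr hrl s hs hs' (u l).1
    rw [Finset.sum_map] at this
    rw [hf1]
    exact this
  -- The half-norm estimate is needed on all of `M(λ)`, not only on the basis vectors, to invert the
  -- matrix.
  have hloss : ∀ v ∈ Submodule.span ℝ (Set.range f),
      ‖v - ∑ j, (inner ℝ (e j) v : ℝ) • e j‖ ≤ 2⁻¹ * ‖v‖ := fun v hv => by
    obtain ⟨b, rfl⟩ := (Submodule.mem_span_range_iff_exists_fun ℝ).1 hv
    have hb : ∑ l, b l • f l = ι (∑ l, b l • y l) := by simp [f]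
    have hby : ∑ l, b l • y l ∈ EigenApprox.eigX ι a lam :=
      Submodule.sum_mem _ fun l _ => Submodule.smul_mem _ _
        (h.mem_eigX_iff.2 (by rw [hy l]; exact hu.mem l))
    have := hproj _ hby s fun i hi => (hs' i hi).le
    rw [Finset.sum_map] at this
    rw [hb]
    exact this
  obtain ⟨β, hβ, hβC⟩ := exists_inverse_transition he hf hloss
  have hEmem : ∀ l, EhU l ∈ femSpace Ω K k := fun l => by
    rw [hEhU]
    exact Submodule.sum_mem _ fun j _ => Submodule.smul_mem _ _ (hUh j)
  -- Inverting the transition matrix expresses the discrete eigenfunctions by the projected exact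
  -- ones.
  have hUE : ∀ i, Uh i = ∑ l, β i l • EhU l := fun i => by
    simp only [hEhU, Finset.smul_sum, smul_smul]
    rw [Finset.sum_comm]
    simp only [← Finset.sum_smul, hβ]
    simp
  have hq0 : (0 : ℝ) ≤ multiplicity Ω A c lam := Nat.cast_nonneg _
  have hC1 : ∑ i, ∑ l, β i l ^ 2 ≤
      (multiplicity Ω A c lam : ℝ) ^ 2 + 4 * multiplicity Ω A c lam + 1 := by
    nlinarith
  have hC2 : ∑ l, ∑ j, (inner ℝ (e j) (f l) : ℝ) ^ 2 ≤
      (multiplicity Ω A c lam : ℝ) ^ 2 + 4 * multiplicity Ω A c lam + 1 := by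
    have h1 : ∀ l j, (inner ℝ (e j) (f l) : ℝ) ^ 2 ≤ 1 := fun l j => by
      have := abs_real_inner_le_norm (e j) (f l)
      rw [he.1, hf.1, one_mul] at this
      rw [← sq_abs]
      exact pow_le_one₀ (abs_nonneg _) this
    have h2 : ∑ l, ∑ j, (inner ℝ (e j) (f l) : ℝ) ^ 2 ≤
        ∑ _l : Fin (multiplicity Ω A c lam), ∑ _j : Fin (multiplicity Ω A c lam), (1 : ℝ) :=
      Finset.sum_le_sum fun l _ => Finset.sum_le_sum fun j _ => h1 l j
    simp only [Finset.sum_const, Finset.card_univ, Fintype.card_fin, nsmul_eq_mul, mul_one] at h2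
    nlinarith
  exact ⟨⟨hAc.etaSqTuple_le hd hΩ hK hR ht Λh hUh hEmem hUE hC1,
    hAc.etaSqTuple_le hd hΩ hK hR ht Λh hUh hUh hEhU hC2⟩,
    hAc.oscSqTuple_le hd hΩ hK hR ht m m' Λh hUh hEmem hUE hC1,
    hAc.oscSqTuple_le hd hΩ hK hR ht m m' Λh hUh hUh hEhU hC2⟩
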